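/- A *unit disk contact (UDC) representation* of a finite graph $G=(V,E)$ assigns to every vertex a closed disk of radius $1$ in the Euclidean plane such that the disks of distinct vertices have disjoint interiors, and two of these disks touch if and only if the two vertices are adjacent; $G$ is a *UDC graph* if it has such a representation (no combinatorial embedding of $G$ is prescribed). A *caterpillar* is a finite tree for which a (possibly empty) path $(v_1,\dots,v_k)$, its *inner path*, remains after removing all leaves (vertices of degree $1$). Let $\Delta$ denote the maximum degree of $G$. **Theorem.** 1. Let $G$ be a caterpillar. If $\Delta\le 4$, then $G$ is a UDC graph. If $\Delta\ge 6$, then $G$ is not a UDC graph. If $\Delta=5$, then $G$ is a UDC graph if and only if for all $i<j$ with $\deg v_i=\deg v_j=5$ there is an $l$ with $i<l<j$ and $\deg v_l\le 3$. 2. Given a caterpillar $G$ on $n$ vertices by a list of its edges, it can be decided in time $O(n)$ whether $G$ is a UDC graph. This needs no real arithmetic: it is done by an ordinary unit-cost RAM (addition, truncated subtraction, comparison, indirect addressing) whose integer arithmetic produces only values $O(n)$. 3. Given a caterpillar $G$ on $n$ vertices by a list of its edges, a UDC representation of $G$ (the coordinates of the disk centres), if one exists, can be constructed in time $O(n)$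 on a Real RAM, i.e. a RAM as above with additional real registers and real arrays on which $+,-,\cdot,/$, square roots, sine, cosine and comparisons cost one step each. -/

import Mathlib

/-! ### Unit disk contact graphs and caterpillars -/

/-- `p` assigns to every vertex the centre of a closed unit disk in the Euclidean plane so that
distinct vertices get interior-disjoint disks, and two disks meet if and only if the vertices are
adjacent. -/
def IsUDCRepresentation {V : Type*} (G : SimpleGraph V)
    (p : V → EuclideanSpace ℝ (Fin 2)) : Prop :=
  ∀ u v : V, u ≠ v →
    Disjoint (Metric.ball (p u) 1) (Metric.ball (p v) 1) ∧
    ((Metric.closedBall (p u) 1 ∩ Metric.closedBall (p v) 1).Nonempty ↔ G.Adj u v)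

/-- Unit disk contact graphs; no embedding of the graph is prescribed. -/
def IsUDCGraph {V : Type*} (G : SimpleGraph V) : Prop :=
  ∃ p : V → EuclideanSpace ℝ (Fin 2), IsUDCRepresentation G p

/-- The graph that remains after all leaves (vertices of degree one) are removed. -/
abbrev innerGraph {V : Type*} [Fintype V] (G : SimpleGraph V) [DecidableRel G.Adj] :
    SimpleGraph {v : V | G.degree v ≠ 1} :=
  G.induce {v : V | G.degree v ≠ 1}

/-- An enumeration `v₀, …, v_{k-1}` of the inner path. -/
abbrev InnerPath {V : Type*} [Fintype V] (G : SimpleGraph V) [DecidableRel G.Adj] (k : ℕ) :=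
  SimpleGraph.pathGraph k ≃g innerGraph G

/-- A caterpillar is a tree for which a (possibly empty) path remains after removing all leaves. -/
def IsCaterpillar {V : Type*} [Fintype V] (G : SimpleGraph V) [DecidableRel G.Adj] : Prop :=
  G.IsTree ∧ ∃ k : ℕ, Nonempty (InnerPath G k)

/-! ### Real RAM with a step count -/

namespace RealRAM

/-- Memory: registers and arrays for natural numbers, registers and arrays for real numbers.
A program mentions only finitely many registers and finitely many arrays; the entries of an
array are addressed indirectly, through the content of a register. -/
structure State where
  reg : ℕ → ℕ
  mem : ℕ → ℕ → ℕ
  rreg : ℕ → ℝ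
  rmem : ℕ → ℕ → ℝ

/-- Elementary instructions. The first argument of all but the store instructions is the
register that receives the result. -/
inductive Instr where
  | const (x : ℕ) (k : ℕ)
  | copy (x y : ℕ)
  | add (x y z : ℕ)
  | sub (x y z : ℕ)
  | load (x a i : ℕ)
  | store (a i x : ℕ)
  | rconst (x : ℕ) (q : ℚ)
  | rofNat (x y : ℕ)
  | rcopy (x y : ℕ)
  | radd (x y z : ℕ)
  | rsub (x y z : ℕ)
  | rmul (x y z : ℕ)
  | rdiv (x y z : ℕ)
  | rsqrt (x y : ℕ)
  | rsin (x y : ℕ)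
  | rcos (x y : ℕ)
  | rload (x a i : ℕ)
  | rstore (a i x : ℕ)

/-- Comparisons of two integer registers or of two real registers. -/
inductive Test where
  | lt (x y : ℕ)
  | eq (x y : ℕ)
  | rlt (x y : ℕ)
  | req (x y : ℕ)

/-- Programs. -/
inductive Prog where
  | skip
  | instr (i : Instr)
  | seq (p q : Prog)
  | ite (b : Test) (p q : Prog)
  | loop (b : Test) (p : Prog)

namespace State

def setReg (s : State) (x k : ℕ) : State :=
  { s with reg := Function.update s.reg x k }

def setMem (s : State) (a i k : ℕ) : State :=
  { s with mem := Function.update s.mem a (Function.update (s.mem a) i k) }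

def setRReg (s : State) (x : ℕ) (r : ℝ) : State :=
  { s with rreg := Function.update s.rreg x r }

def setRMem (s : State) (a i : ℕ) (r : ℝ) : State :=
  { s with rmem := Function.update s.rmem a (Function.update (s.rmem a) i r) }

end State

/-- Effect of one instruction on a machine whose integer arithmetic produces values of at most `w`
only; there is no effect (`none`, the machine is stuck) on an overflow, on a division by zero and
on the square root of a negative number. Integer subtraction is truncated at zero. -/
noncomputable def Instr.exec (w : ℕ) (s : State) : Instr → Option State
  | .const x k => some (s.setReg x k)
  | .copy x y => some (s.setReg x (s.reg y))
  | .add x y z => if s.reg y + s.reg z ≤ w then some (s.setReg x (s.reg y + s.reg z)) else none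
  | .sub x y z => some (s.setReg x (s.reg y - s.reg z))
  | .load x a i => some (s.setReg x (s.mem a (s.reg i)))
  | .store a i x => some (s.setMem a (s.reg i) (s.reg x))
  | .rconst x q => some (s.setRReg x (q : ℝ))
  | .rofNat x y => some (s.setRReg x (s.reg y : ℝ))
  | .rcopy x y => some (s.setRReg x (s.rreg y))
  | .radd x y z => some (s.setRReg x (s.rreg y + s.rreg z))
  | .rsub x y z => some (s.setRReg x (s.rreg y - s.rreg z))
  | .rmul x y z => some (s.setRReg x (s.rreg y * s.rreg z))
  | .rdiv x y z =>
      open Classical in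
      if s.rreg z ≠ 0 then some (s.setRReg x (s.rreg y / s.rreg z)) else none
  | .rsqrt x y =>
      open Classical in
      if 0 ≤ s.rreg y then some (s.setRReg x (Real.sqrt (s.rreg y))) else none
  | .rsin x y => some (s.setRReg x (Real.sin (s.rreg y)))
  | .rcos x y => some (s.setRReg x (Real.cos (s.rreg y)))
  | .rload x a i => some (s.setRReg x (s.rmem a (s.reg i)))
  | .rstore a i x => some (s.setRMem a (s.reg i) (s.rreg x))

def Test.Holds (s : State) : Test → Prop
  | .lt x y => s.reg x < s.reg y
  | .eq x y => s.reg x = s.reg y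
  | .rlt x y => s.rreg x < s.rreg y
  | .req x y => s.rreg x = s.rreg y

/-- `Exec w p s s' t`: with word bound `w`, the program `p` started in the state `s` halts in the
state `s'` after exactly `t` steps. Every instruction and every evaluation of a test is one step. -/
inductive Exec (w : ℕ) : Prog → State → State → ℕ → Prop
  | skip (s : State) : Exec w .skip s s 1
  | instr (i : Instr) (s s' : State) : i.exec w s = some s' → Exec w (.instr i) s s' 1
  | seq (p q : Prog) (s₁ s₂ s₃ : State) (t₁ t₂ : ℕ) :
      Exec w p s₁ s₂ t₁ → Exec w q s₂ s₃ t₂ → Exec w (.seq p q) s₁ s₃ (t₁ + t₂)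
  | iteTrue (b : Test) (p q : Prog) (s s' : State) (t : ℕ) :
      b.Holds s → Exec w p s s' t → Exec w (.ite b p q) s s' (t + 1)
  | iteFalse (b : Test) (p q : Prog) (s s' : State) (t : ℕ) :
      ¬ b.Holds s → Exec w q s s' t → Exec w (.ite b p q) s s' (t + 1)
  | loopTrue (b : Test) (p : Prog) (s₁ s₂ s₃ : State) (t₁ t₂ : ℕ) :
      b.Holds s₁ → Exec w p s₁ s₂ t₁ → Exec w (.loop b p) s₂ s₃ t₂ →
      Exec w (.loop b p) s₁ s₃ (t₁ + t₂ + 1)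
  | loopFalse (b : Test) (p : Prog) (s : State) :
      ¬ b.Holds s → Exec w (.loop b p) s s 1

/-- Instructions of an ordinary RAM, without real numbers. -/
def Instr.IsDiscrete : Instr → Prop
  | .const _ _ | .copy _ _ | .add _ _ _ | .sub _ _ _ | .load _ _ _ | .store _ _ _ => True
  | _ => False

def Test.IsDiscrete : Test → Prop
  | .lt _ _ | .eq _ _ => True
  | _ => False

/-- Programs of an ordinary RAM: no real number is ever touched. -/
def Prog.IsDiscrete : Prog → Prop
  | .skip => True
  | .instr i => i.IsDiscrete
  | .seq p q => p.IsDiscrete ∧ q.IsDiscrete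
  | .ite b p q => b.IsDiscrete ∧ p.IsDiscrete ∧ q.IsDiscrete
  | .loop b p => b.IsDiscrete ∧ p.IsDiscrete

/-- `E` lists every edge of `G` exactly once, in any order and with any orientation. -/
def IsEdgeList {n : ℕ} (G : SimpleGraph (Fin n)) (E : List (Fin n × Fin n)) : Prop :=
  (E.map fun e => s(e.1, e.2)).Nodup ∧
    ∀ u v : Fin n, G.Adj u v ↔ s(u, v) ∈ E.map fun e => s(e.1, e.2)

/-- Initial state for a graph on `n` vertices given by an edge list: register `0` holds the number
of vertices, register `1` the number of edges, arrays `0` and `1` hold the two endpoints of the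
edges; everything else is zero. -/
def input {n : ℕ} (E : List (Fin n × Fin n)) : State where
  reg x := if x = 0 then n else if x = 1 then E.length else 0
  mem a i :=
    if a = 0 then (E.map fun e => (e.1 : ℕ)).getD i 0
    else if a = 1 then (E.map fun e => (e.2 : ℕ)).getD i 0
    else 0
  rreg _ := 0
  rmem _ _ := 0

/-- The points of the plane whose coordinates are found in the real arrays `0` and `1`. -/
def outputPoints (n : ℕ) (s : State) : Fin n → EuclideanSpace ℝ (Fin 2) :=
  fun v => !₂[s.rmem 0 v, s.rmem 1 v]

end RealRAM

/-!
A caterpillar is a unit disk contact graph if and only if its spine satisfies a condition on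
degrees (`SpineCondition`): no degree exceeds five, and between two vertices of degree five there
is one of degree at most three. The statements on the maximum degree follow from this, and both
programs are built on it.

*Necessity.* Distances are halved, so that adjacent centres have distance one and all others have
distance greater than one (`IsUnitRealization`). Neighbours of a vertex that are not adjacent to
each other are then seen under angles greater than `π / 3`, which bounds the degree by five. For
two vertices of degree five, follow the spine from the first to the second and maintain, at each
edge, that the vertices met so far cover an arc on either side of the unit circle about the head of
the edge and leave free an arc shorter than `π` (`EdgeCrowded`). A vertex of degree
five starts such a state; a vertex of degree at least four hands it on, because the geometry of the
unit rhombus carries a covered arc over to the next vertex; and at a second vertex of degree five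
four neighbours would have to fit into an arc of length less than `π`, which is impossible
(`exists_degree_le_three_between`).

*Sufficiency.* The spine is laid out almost straight from left to right and bends down by a small
angle at each vertex of degree five (`Placement.spineX`, `Placement.spineY`). The first leaf of a
vertex hangs below it and the others stand above it, close to the directions `π / 3` and `2π / 3`
relative to the spine. Each leaf direction is turned a little against the preceding one, so that
parallel edges drift apart and no unwanted contact arises. A vertex of degree four whose first
vertex to the left that is not of degree four has degree five leans to the right instead of to the
left; the room for this has been gained by the bend. Two vertices of degree five with a vertex of
degree at most three between them never compete for this room (`Placement.four_lt_sqDist`,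
`isUDCRepresentation_of_slotting`).

*Programs.* Partial correctness and running time are proved together (`RealRAM.Runs`), with
weakest preconditions for the parts without loops and a rule for counting loops. One pass over the
edges finds the degrees; a second one finds, for each spine vertex, the number and the sum of its
neighbours on the spine. The sum allows to walk along the spine without adjacency lists, since the
next vertex is the sum minus the preceding vertex. The decision program watches the degrees
during this walk. The construction writes the points for each spine vertex and a table of the
places for its leaves; since `π` is not available to the machine, the directions near `π / 3` are
obtained by multiplying with a fixed rotation. A last pass over the edges gives each leaf the first
free place in the table of its neighbour.
-/

/-! ### Unit rhombi and arcs covered by unit disks -/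

/-- Equality holds for `β = L`, where the unit rhombus closes. -/
theorem one_add_cos_le_cos_add_cos {L β : ℝ} (hL : 0 ≤ L) (hLβ : L ≤ β) (hβ : β ≤ Real.pi) :
    1 + Real.cos β ≤ Real.cos L + Real.cos (β - L) := by
  have h1 : 1 + Real.cos β = 2 * Real.cos (β / 2) * Real.cos (β / 2) := by
    have := Real.cos_sq (β / 2)
    rw [show 2 * (β / 2) = β by ring] at this
    nlinarith
  have h2 : Real.cos L + Real.cos (β - L) = 2 * Real.cos (β / 2) * Real.cos (L - β / 2) := by
    rw [Real.cos_add_cos, show (L + (β - L)) / 2 = β / 2 by ring,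
      show (L - (β - L)) / 2 = L - β / 2 by ring]
  have h3 : 0 ≤ Real.cos (β / 2) := Real.cos_nonneg_of_mem_Icc ⟨by linarith, by linarith⟩
  have h4 : Real.cos (β / 2) ≤ Real.cos (L - β / 2) := by
    rw [← Real.cos_abs (L - β / 2)]
    exact Real.cos_le_cos_of_nonneg_of_le_pi (abs_nonneg _) (by linarith)
      (abs_le.2 ⟨by linarith, by linarith⟩)
  rw [h1, h2]
  exact mul_le_mul_of_nonneg_left h4 (by positivity)

theorem quadratic_nonpos_between {K M r r₁ r₂ : ℝ} (h₁ : r₁ ≤ r) (h₂ : r ≤ r₂)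
    (h : r₁ ^ 2 - 2 * r₁ * K + M ≤ 0) (h' : r₂ ^ 2 - 2 * r₂ * K + M ≤ 0) :
    r ^ 2 - 2 * r * K + M ≤ 0 := by
  rcases eq_or_lt_of_le (h₁.trans h₂) with e | e
  · obtain rfl : r = r₁ := le_antisymm (e ▸ h₂) h₁
    exact h
  · have h3 : (r₂ - r₁) * (r ^ 2 - 2 * r * K + M) ≤ 0 := by
      have e1 : (r₂ - r₁) * (r ^ 2 - 2 * r * K + M) =
        (r₂ - r) * (r₁ ^ 2 - 2 * r₁ * K + M) + (r - r₁) * (r₂ ^ 2 - 2 * r₂ * K + M)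
          - (r - r₁) * (r₂ - r) * (r₂ - r₁) := by ring
      rw [e1]
      have a := mul_nonneg (mul_nonneg (sub_nonneg.2 h₁) (sub_nonneg.2 h₂)) (sub_nonneg.2 e.le)
      have b := mul_nonpos_of_nonneg_of_nonpos (sub_nonneg.2 h₂) h
      have c := mul_nonpos_of_nonneg_of_nonpos (sub_nonneg.2 h₁) h'
      linarith
    by_contra hc
    push Not at hc
    have := mul_pos (sub_pos.2 e) hc
    linarith

/-- A cosine of at least `1 / 2` forces an angle of at most `π / 3`; at the bound `5 * π / 3` the
inequality has to be strict. -/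
theorem abs_le_pi_div_three_of_half_le_cos {x : ℝ} (h1 : |x| ≤ 5 * Real.pi / 3)
    (h : 1 / 2 < Real.cos x ∨ (1 / 2 ≤ Real.cos x ∧ |x| < 5 * Real.pi / 3)) :
    |x| ≤ Real.pi / 3 := by
  have hp := Real.pi_pos
  rw [← Real.cos_abs] at h
  by_contra hc
  push Not at hc
  have h0 := abs_nonneg x
  generalize |x| = y at *
  rcases le_or_gt y Real.pi with hy | hy
  · have := Real.cos_lt_cos_of_nonneg_of_le_pi (by positivity) hy hc
    rw [Real.cos_pi_div_three] at this
    rcases h with h | h <;> linarith [h]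
  · have e : Real.cos y = Real.cos (2 * Real.pi - y) := by rw [Real.cos_two_pi_sub]
    rcases h with h | ⟨h, h'⟩
    · have := Real.cos_le_cos_of_nonneg_of_le_pi (x := Real.pi / 3) (y := 2 * Real.pi - y)
        (by positivity) (by linarith) (by linarith)
      rw [Real.cos_pi_div_three] at this
      linarith
    · have := Real.cos_lt_cos_of_nonneg_of_le_pi (x := Real.pi / 3) (y := 2 * Real.pi - y)
        (by positivity) (by linarith) (by linarith)
      rw [Real.cos_pi_div_three] at this
      linarith

/-- Polar form of `norm_sub_le_one_of_rotated`: along a fixed ray the left side is a convex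
function of `r`, so it suffices to look at the two circles between which `r` has to lie. -/
theorem polar_rotated_cover {r γ α : ℝ} (hα : 0 < α) (hα' : α ≤ Real.pi / 3) (hr : 1 ≤ r)
    (hγ : -Real.pi ≤ γ) (hγ' : γ ≤ Real.pi) (h1 : 2 * Real.cos γ ≤ r)
    (hb : r ≤ 2 * Real.cos (γ - α)) :
    r ^ 2 - 2 * r * (Real.cos γ + Real.cos (γ - (α + Real.pi / 3)))
      + (1 + 2 * Real.cos (α + Real.pi / 3)) ≤ 0 := by
  have hp := Real.pi_pos
  have hga : |γ - α| ≤ Real.pi / 3 := by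
    refine abs_le_pi_div_three_of_half_le_cos ?_ (Or.inr ⟨by linarith, ?_⟩)
    · exact abs_le.2 ⟨by linarith, by linarith⟩
    · exact abs_lt.2 ⟨by linarith, by linarith⟩
  rw [abs_le] at hga
  have hhalf : α / 2 ≤ γ := by
    by_contra hc
    push Not at hc
    have : Real.cos (γ - α) < Real.cos γ := by
      rw [← Real.cos_abs γ, ← Real.cos_neg (γ - α), neg_sub]
      exact Real.cos_lt_cos_of_nonneg_of_le_pi (abs_nonneg _) (by linarith)
        (abs_lt.2 ⟨by linarith, by linarith⟩)
    linarith
  -- the outer end of the ray lies on the circle around `exp (α * I)`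
  have hout : (2 * Real.cos (γ - α)) ^ 2 - 2 * (2 * Real.cos (γ - α)) *
      (Real.cos γ + Real.cos (γ - (α + Real.pi / 3))) +
      (1 + 2 * Real.cos (α + Real.pi / 3)) ≤ 0 := by
    have q := one_add_cos_le_cos_add_cos (L := 2 * γ - α) (β := 2 * γ - α + (Real.pi / 3 - α))
      (by linarith) (by linarith) (by linarith)
    have e1 : 2 * Real.cos (γ - α) * Real.cos (γ - α) = Real.cos (2 * γ - 2 * α) + 1 := by
      rw [Real.two_mul_cos_mul_cos]; ring_nf; simp
    have e2 : 2 * Real.cos (γ - α) * Real.cos γ = Real.cos α + Real.cos (2 * γ - α) := by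
      rw [Real.two_mul_cos_mul_cos, show γ - α - γ = -α by ring, Real.cos_neg]; ring_nf
    have e3 : 2 * Real.cos (γ - α) * Real.cos (γ - (α + Real.pi / 3)) =
        1 / 2 + Real.cos (2 * γ - 2 * α - Real.pi / 3) := by
      rw [Real.two_mul_cos_mul_cos, show γ - α - (γ - (α + Real.pi / 3)) = Real.pi / 3 by ring,
        Real.cos_pi_div_three]; ring_nf
    have e4 : Real.cos (2 * γ - α + (Real.pi / 3 - α)) =
        Real.cos (2 * γ - 2 * α + Real.pi / 3) := by ring_nf
    have e5 : Real.cos (2 * γ - α + (Real.pi / 3 - α) - (2 * γ - α)) =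
        Real.cos (Real.pi / 3 - α) := by ring_nf
    -- both sides are compared through `2 * cos x * cos (π / 3) = cos x`
    have e6 : Real.cos (2 * γ - 2 * α + Real.pi / 3) + Real.cos (2 * γ - 2 * α - Real.pi / 3) =
        Real.cos (2 * γ - 2 * α) := by
      rw [Real.cos_add_cos]; ring_nf; rw [show Real.pi * (1 / 3) = Real.pi / 3 by ring,
        Real.cos_pi_div_three]; ring
    have e7 : Real.cos (α + Real.pi / 3) + Real.cos (Real.pi / 3 - α) = Real.cos α := by
      rw [← Real.cos_neg (Real.pi / 3 - α), neg_sub, Real.cos_add_cos]; ring_nf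
      rw [show Real.pi * (1 / 3) = Real.pi / 3 by ring, Real.cos_pi_div_three]; ring
    rw [e4, e5] at q
    nlinarith
  rcases le_or_gt (Real.pi / 3) γ with hg | hg
  · refine quadratic_nonpos_between hr hb ?_ hout
    have q := one_add_cos_le_cos_add_cos (L := γ) (β := α + Real.pi / 3) (by linarith)
      (by linarith) (by linarith)
    have e : Real.cos (γ - (α + Real.pi / 3)) = Real.cos (α + Real.pi / 3 - γ) := by
      rw [← Real.cos_neg, neg_sub]
    rw [e]
    linarith
  · refine quadratic_nonpos_between h1 hb ?_ hout
    have e1 : 2 * Real.cos γ * Real.cos γ = Real.cos (2 * γ) + 1 := by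
      rw [Real.two_mul_cos_mul_cos]; ring_nf; simp
    have e2 : 2 * Real.cos γ * Real.cos (γ - (α + Real.pi / 3)) =
        Real.cos (α + Real.pi / 3) + Real.cos (2 * γ - (α + Real.pi / 3)) := by
      rw [Real.two_mul_cos_mul_cos]; ring_nf
    have e3 : 1 / 2 ≤ Real.cos (2 * γ - (α + Real.pi / 3)) := by
      rw [← Real.cos_pi_div_three, ← Real.cos_abs (2 * γ - _)]
      exact Real.cos_le_cos_of_nonneg_of_le_pi (abs_nonneg _) (by linarith)
        (abs_le.2 ⟨by linarith, by linarith⟩)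
    nlinarith

open Complex in
theorem normSq_exp_sub_one_add_exp (L β : ℝ) :
    normSq (exp (L * I) - (1 + exp (β * I))) =
      3 + 2 * Real.cos β - 2 * Real.cos L - 2 * Real.cos (β - L) := by
  rw [normSq_apply, Real.cos_sub]
  simp only [sub_re, sub_im, add_re, add_im, exp_ofReal_mul_I_re, exp_ofReal_mul_I_im, one_re,
    one_im]
  nlinarith [Real.sin_sq_add_cos_sq L, Real.sin_sq_add_cos_sq β]

open Complex in
/-- The key covering fact. Every unit disk that contains the point `exp (α * I)` of the unit circle
around `0`, but whose centre is outside the open unit disks around `0` and `1`, contains the point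
of the unit circle around `1` that is obtained by rotating the direction by `π / 3`. -/
theorem norm_sub_le_one_of_rotated {c : ℂ} {α : ℝ} (hα : 0 < α) (hα' : α ≤ Real.pi / 3)
    (h0 : 1 ≤ ‖c‖) (h1 : 1 ≤ ‖c - 1‖) (hb : ‖c - exp (α * I)‖ ≤ 1) :
    ‖c - (1 + exp ((α + Real.pi / 3 : ℝ) * I))‖ ≤ 1 := by
  have hr : 0 < ‖c‖ := by linarith
  have hre : c.re = ‖c‖ * Real.cos c.arg := (norm_mul_cos_arg c).symm
  have him : c.im = ‖c‖ * Real.sin c.arg := (norm_mul_sin_arg c).symm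
  have s1 := Real.sin_sq_add_cos_sq c.arg
  have k := polar_rotated_cover hα hα' h0 (neg_pi_lt_arg c).le (arg_le_pi c) ?_ ?_
  · rw [← abs_of_nonneg (norm_nonneg (c - _)), ← sq_le_one_iff_abs_le_one, ← normSq_eq_norm_sq,
      normSq_apply]
    simp only [sub_re, sub_im, add_re, add_im, exp_ofReal_mul_I_re, exp_ofReal_mul_I_im, one_re,
      one_im, hre, him]
    rw [Real.cos_sub] at k
    nlinarith [Real.sin_sq_add_cos_sq (α + Real.pi / 3)]
  · have : 1 ≤ ‖c - 1‖ ^ 2 := by nlinarith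
    rw [← normSq_eq_norm_sq, normSq_apply] at this
    simp only [sub_re, sub_im, one_re, one_im, hre, him] at this
    have : 0 ≤ ‖c‖ * (‖c‖ - 2 * Real.cos c.arg) := by linear_combination this + ‖c‖ ^ 2 * s1
    linarith [nonneg_of_mul_nonneg_right this hr]
  · have : ‖c - exp (α * I)‖ ^ 2 ≤ 1 := by nlinarith [norm_nonneg (c - exp (α * I))]
    rw [← normSq_eq_norm_sq, normSq_apply] at this
    simp only [sub_re, sub_im, exp_ofReal_mul_I_re, exp_ofReal_mul_I_im, hre, him] at this
    have : 0 ≤ ‖c‖ * (2 * Real.cos (c.arg - α) - ‖c‖) := by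
      rw [Real.cos_sub]
      linear_combination this - ‖c‖ ^ 2 * s1 - Real.sin_sq_add_cos_sq α
    linarith [nonneg_of_mul_nonneg_right this hr]

open Complex in
/-- Normalization of a step `c₁ → c₂` of length one to `0 → 1`, followed by a reflection if
`s = 1`. -/
theorem exists_normalization {c₁ c₂ : ℂ} (h : ‖c₂ - c₁‖ = 1) {s : ℝ} (hs : s = 1 ∨ s = -1) :
    ∃ f : ℂ → ℂ, (∀ x y, ‖f x - f y‖ = ‖x - y‖) ∧ f c₁ = 0 ∧ f c₂ = 1 ∧
      (∀ t : ℝ, f (c₁ + (c₂ - c₁) * exp ((s * t : ℝ) * I)) = exp ((-t : ℝ) * I)) ∧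
      ∀ t : ℝ, f (c₂ + (c₁ - c₂) * exp ((s * t : ℝ) * I)) =
        1 + exp ((Real.pi - t : ℝ) * I) := by
  have hne : c₂ - c₁ ≠ 0 := by intro e; rw [e, norm_zero] at h; exact zero_ne_one h
  have hE : ∀ t : ℝ, exp ((Real.pi - t : ℝ) * I) = -exp ((-t : ℝ) * I) := by
    intro t
    rw [show ((Real.pi - t : ℝ) : ℂ) * I = Real.pi * I + (-t : ℝ) * I by push_cast; ring,
      Complex.exp_add, exp_pi_mul_I]; ring
  have hq : ∀ z : ℂ, (c₂ - c₁) * z / (c₂ - c₁) = z := fun z => by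
    rw [mul_div_assoc, mul_div_cancel₀ _ hne]
  have aux : ∀ t : ℝ, (c₂ + (c₁ - c₂) * exp (t * I) - c₁) / (c₂ - c₁) = 1 - exp (t * I) := by
    intro t; field_simp; ring
  rcases hs with rfl | rfl
  · refine ⟨fun x => (starRingEnd ℂ) ((x - c₁) / (c₂ - c₁)), ?_, ?_, ?_, ?_, ?_⟩
    · intro x y
      rw [← map_sub, norm_conj, ← sub_div, norm_div, h, div_one]; congr 1; ring
    · simp
    · simp [div_self hne]
    · intro t
      simp only [add_sub_cancel_left, hq, one_mul]
      rw [← exp_conj]; simp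
    · intro t
      rw [hE]
      simp only [one_mul, aux, map_sub, map_one]
      rw [← exp_conj]; simp [sub_eq_add_neg]
  · refine ⟨fun x => (x - c₁) / (c₂ - c₁), ?_, ?_, ?_, ?_, ?_⟩
    · intro x y
      rw [← sub_div, norm_div, h, div_one]; congr 1; ring
    · simp
    · simp [div_self hne]
    · intro t
      simp only [add_sub_cancel_left, hq]
      congr 2; push_cast; ring
    · intro t
      rw [hE]
      simp only [aux]
      rw [sub_eq_add_neg]; congr 4; push_cast; ring

open Complex in
/-- A unit disk around a neighbour of `c₁` at angle `L` from the step `c₁ → c₂` covers the arc of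
the unit circle around `c₂` from `c₁` to the point that completes the unit rhombus. -/
theorem arc_covered_of_neighbour {c₁ c₂ : ℂ} (h : ‖c₂ - c₁‖ = 1) {s : ℝ} (hs : s = 1 ∨ s = -1)
    {L ψ : ℝ} (hL : 0 ≤ L) (hψ : 0 ≤ ψ) (hψL : ψ ≤ Real.pi - L) :
    ‖c₂ + (c₁ - c₂) * exp ((s * ψ : ℝ) * I) - (c₁ + (c₂ - c₁) * exp ((-(s * L) : ℝ) * I))‖ ≤ 1 := by
  obtain ⟨f, hf, -, -, h1, h2⟩ := exists_normalization h hs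
  rw [← hf, h2, show -(s * L) = s * -L by ring, h1, neg_neg, norm_sub_rev,
    ← abs_of_nonneg (norm_nonneg (_ - _)), ← sq_le_one_iff_abs_le_one, ← normSq_eq_norm_sq,
    normSq_exp_sub_one_add_exp]
  have := one_add_cos_le_cos_add_cos hL (by linarith : L ≤ Real.pi - ψ) (by linarith)
  linarith

open Complex in
/-- Covered arcs are transported along a step `c₁ → c₂`, with the direction rotated by `π / 3`. -/
theorem covered_of_rotated {c₁ c₂ x : ℂ} (h : ‖c₂ - c₁‖ = 1) {s : ℝ} (hs : s = 1 ∨ s = -1)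
    {α : ℝ} (hα : 0 < α) (hα' : α ≤ Real.pi / 3) (h₁ : 1 ≤ ‖x - c₁‖) (h₂ : 1 ≤ ‖x - c₂‖)
    (hb : ‖c₁ + (c₂ - c₁) * exp ((-(s * α) : ℝ) * I) - x‖ ≤ 1) :
    ‖c₂ + (c₁ - c₂) * exp ((s * (2 * Real.pi / 3 - α) : ℝ) * I) - x‖ ≤ 1 := by
  obtain ⟨f, hf, h0, h1, h3, h4⟩ := exists_normalization h hs
  rw [← hf, h4, norm_sub_rev, show Real.pi - (2 * Real.pi / 3 - α) = α + Real.pi / 3 by ring]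
  refine norm_sub_le_one_of_rotated hα hα' ?_ ?_ ?_
  · rwa [← hf, h0, sub_zero] at h₁
  · rwa [← hf, h1] at h₂
  · rwa [← hf, show -(s * α) = s * -α by ring, h3, neg_neg, norm_sub_rev] at hb

open Complex in
theorem abs_sub_of_one_lt_norm {u : ℂ} (hu : ‖u‖ = 1) {a b : ℝ} (hab : |a - b| ≤ 2 * Real.pi)
    (h : 1 < ‖u * exp (a * I) - u * exp (b * I)‖) :
    Real.pi / 3 < |a - b| ∧ |a - b| < 5 * Real.pi / 3 := by
  have hp := Real.pi_pos
  rw [← mul_sub, norm_mul, hu, one_mul] at h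
  have h2 : 1 < ‖exp (a * I) - exp (b * I)‖ ^ 2 := by nlinarith
  rw [← normSq_eq_norm_sq, normSq_apply] at h2
  simp only [sub_re, sub_im, exp_ofReal_mul_I_re, exp_ofReal_mul_I_im] at h2
  have h3 : Real.cos |a - b| < 1 / 2 := by
    rw [Real.cos_abs, Real.cos_sub]
    nlinarith [Real.sin_sq_add_cos_sq a, Real.sin_sq_add_cos_sq b]
  have h0 := abs_nonneg (a - b)
  generalize |a - b| = y at *
  constructor
  · by_contra hc
    push Not at hc
    have := Real.cos_le_cos_of_nonneg_of_le_pi h0 (by linarith) hc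
    rw [Real.cos_pi_div_three] at this; linarith
  · by_contra hc
    push Not at hc
    have := Real.cos_le_cos_of_nonneg_of_le_pi (x := 2 * Real.pi - y) (y := Real.pi / 3)
      (by linarith) (by linarith) (by linarith)
    rw [Real.cos_pi_div_three, Real.cos_two_pi_sub] at this; linarith

open Complex in
theorem exists_angle {u w : ℂ} (hu : ‖u‖ = 1) (hw : ‖w‖ = 1) :
    ∃ ψ : ℝ, 0 ≤ ψ ∧ ψ < 2 * Real.pi ∧ w = u * exp (ψ * I) := by
  have hp := Real.pi_pos
  have hu0 : u ≠ 0 := by intro e; rw [e, norm_zero] at hu; exact zero_ne_one hu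
  have key : w = u * exp ((w / u).arg * I) := by
    have h1 := norm_mul_exp_arg_mul_I (w / u)
    rw [norm_div, hw, hu, div_one, ofReal_one, one_mul] at h1
    rw [h1, mul_div_cancel₀ _ hu0]
  rcases le_or_gt 0 (w / u).arg with h | h
  · exact ⟨_, h, by linarith [arg_le_pi (w / u)], key⟩
  · refine ⟨(w / u).arg + 2 * Real.pi, by linarith [neg_pi_lt_arg (w / u)], by linarith, ?_⟩
    rw [key]
    conv_rhs => rw [← key]
    congr 1
    push_cast
    rw [add_mul, exp_add, exp_two_pi_mul_I, mul_one]

/-! ### The spine of a caterpillar -/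

section Spine

variable {V : Type*} [Fintype V] {G : SimpleGraph V} [DecidableRel G.Adj] {k : ℕ}

theorem spine_adj_iff (v : InnerPath G k) (i j : Fin k) :
    G.Adj (v i) (v j) ↔ i.val + 1 = j.val ∨ j.val + 1 = i.val := by
  have h := v.map_adj_iff (v := i) (w := j)
  rw [SimpleGraph.pathGraph_adj] at h
  exact h

theorem spine_injective (v : InnerPath G k) : Function.Injective fun i => (v i : V) :=
  Subtype.val_injective.comp v.injective

theorem spine_degree_ne_one (v : InnerPath G k) (i : Fin k) : G.degree (v i) ≠ 1 := (v i).2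

theorem exists_spine_eq (v : InnerPath G k) {x : V} (hx : G.degree x ≠ 1) :
    ∃ i, (v i : V) = x :=
  ⟨v.symm ⟨x, hx⟩, by simp⟩

theorem eq_of_degree_eq_one {x a b : V} (hx : G.degree x = 1) (ha : G.Adj x a)
    (hb : G.Adj x b) : a = b :=
  (SimpleGraph.degree_eq_one_iff_existsUnique_adj.1 hx).unique ha hb

/-- The neighbours of a spine vertex form an independent set. -/
theorem not_adj_of_adj_spine (v : InnerPath G k) {i : Fin k} {x y : V} (hx : G.Adj (v i) x)
    (hy : G.Adj (v i) y) : ¬ G.Adj x y := by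
  intro hxy
  by_cases hx1 : G.degree x = 1
  · exact hy.ne (eq_of_degree_eq_one hx1 hx.symm hxy)
  by_cases hy1 : G.degree y = 1
  · exact hx.ne (eq_of_degree_eq_one hy1 hy.symm hxy.symm)
  obtain ⟨a, rfl⟩ := exists_spine_eq v hx1
  obtain ⟨b, rfl⟩ := exists_spine_eq v hy1
  rw [spine_adj_iff] at *
  omega

end Spine

/-! ### Representations in terms of distances -/

theorem isUDCRepresentation_iff {V : Type*} {G : SimpleGraph V}
    {p : V → EuclideanSpace ℝ (Fin 2)} :
    IsUDCRepresentation G p ↔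
      ∀ u v, u ≠ v → 2 ≤ dist (p u) (p v) ∧ (dist (p u) (p v) ≤ 2 ↔ G.Adj u v) := by
  refine forall_congr' fun u => forall_congr' fun v => imp_congr_right fun _ => ?_
  rw [disjoint_ball_ball_iff one_pos one_pos, ← Set.not_disjoint_iff_nonempty_inter,
    disjoint_closedBall_closedBall_iff zero_le_one zero_le_one, not_lt]
  norm_num

/-- Half of a point of the Euclidean plane as a complex number, so that touching unit disks have
centres at distance one. -/
noncomputable def halfComplex (x : EuclideanSpace ℝ (Fin 2)) : ℂ := ⟨x 0 / 2, x 1 / 2⟩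

theorem norm_halfComplex_sub (x y : EuclideanSpace ℝ (Fin 2)) :
    ‖halfComplex x - halfComplex y‖ = dist x y / 2 := by
  rw [EuclideanSpace.dist_eq, Fin.sum_univ_two, Real.dist_eq, Real.dist_eq, sq_abs, sq_abs,
    ← abs_of_nonneg (norm_nonneg (_ - _)), ← Real.sqrt_sq_eq_abs, ← Complex.normSq_eq_norm_sq,
    Complex.normSq_apply, ← Real.sqrt_sq (show (0:ℝ) ≤ 2 by norm_num),
    ← Real.sqrt_div' _ (by positivity)]
  congr 1
  simp only [halfComplex, Complex.sub_re, Complex.sub_im]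
  ring

/-- A realization of a graph in the complex plane with adjacent vertices at distance one and all
other pairs of vertices farther apart. -/
def IsUnitRealization {V : Type*} (G : SimpleGraph V) (q : V → ℂ) : Prop :=
  ∀ u v, u ≠ v → (G.Adj u v → ‖q u - q v‖ = 1) ∧ (¬ G.Adj u v → 1 < ‖q u - q v‖)

theorem IsUDCRepresentation.isUnitRealization {V : Type*} {G : SimpleGraph V}
    {p : V → EuclideanSpace ℝ (Fin 2)} (h : IsUDCRepresentation G p) :
    IsUnitRealization G fun u => halfComplex (p u) := by
  intro u v huv
  obtain ⟨h1, h2⟩ := isUDCRepresentation_iff.1 h u v huv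
  simp only [norm_halfComplex_sub]
  refine ⟨fun ha => ?_, fun ha => ?_⟩
  · linarith [h2.2 ha]
  · have := not_le.1 (mt h2.1 ha)
    linarith

theorem IsUnitRealization.one_le {V : Type*} {G : SimpleGraph V} {q : V → ℂ}
    (hq : IsUnitRealization G q) {u v : V} (h : u ≠ v) : 1 ≤ ‖q u - q v‖ := by
  by_cases ha : G.Adj u v
  · exact ((hq u v h).1 ha).ge
  · exact ((hq u v h).2 ha).le

/-! ### Degree conditions that are necessary -/

/-- Among `m + 1` reals with pairwise distances above `c`, two differ by more than `m * c`. -/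
theorem exists_mul_lt_sub {m : ℕ} (hm : 0 < m) {c : ℝ} (t : Fin (m + 1) → ℝ)
    (h : ∀ i j, i ≠ j → c < |t i - t j|) : ∃ i j, m * c < t j - t i := by
  have hmono := Tuple.monotone_sort t
  set σ := Tuple.sort t
  have step : ∀ j (hj : j + 1 < m + 1), c < t (σ ⟨j + 1, hj⟩) - t (σ ⟨j, by omega⟩) := by
    intro j hj
    have h1 := h (σ ⟨j + 1, hj⟩) (σ ⟨j, by omega⟩) (by simp)
    have h2 : t (σ ⟨j, by omega⟩) ≤ t (σ ⟨j + 1, hj⟩) := hmono (by simp)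
    rwa [abs_of_nonneg (sub_nonneg.2 h2)] at h1
  have all : ∀ j (hj : j < m + 1), 0 < j → j * c < t (σ ⟨j, hj⟩) - t (σ ⟨0, by omega⟩) := by
    intro j
    induction j with
    | zero => intro _ h0; exact absurd h0 (lt_irrefl _)
    | succ j ih =>
      intro hj _
      have := step j hj
      rcases Nat.eq_zero_or_pos j with rfl | hpos
      · simpa using this
      · have := ih (by omega) hpos
        push_cast
        linarith
  exact ⟨_, _, all m (by omega) hm⟩

/-- With angles at `c` measured from the neighbour `b`, two of any `m + 1` neighbours of `c` are at
angles that differ by more than `m * (π / 3)`. -/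
theorem exists_spread_angles {V : Type*} {G : SimpleGraph V} {q : V → ℂ}
    (hq : IsUnitRealization G q) {b c : V} (hbc : G.Adj c b)
    (hind : ∀ x y, G.Adj c x → G.Adj c y → ¬ G.Adj x y) {m : ℕ} (hm : 0 < m)
    (f : Fin (m + 1) ↪ V) (hf : ∀ i, G.Adj c (f i)) :
    ∃ (i j : Fin (m + 1)) (a a' : ℝ), 0 ≤ a ∧ a' < 2 * Real.pi ∧ m * (Real.pi / 3) < a' - a ∧
      q (f i) = q c + (q b - q c) * Complex.exp (a * Complex.I) ∧
      q (f j) = q c + (q b - q c) * Complex.exp (a' * Complex.I) := by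
  have hu : ‖q b - q c‖ = 1 := (hq _ _ hbc.ne').1 hbc.symm
  have ex : ∀ i, ∃ ψ : ℝ, 0 ≤ ψ ∧ ψ < 2 * Real.pi ∧
      q (f i) - q c = (q b - q c) * Complex.exp (ψ * Complex.I) := fun i =>
    exists_angle hu ((hq _ _ (hf i).ne').1 (hf i).symm)
  choose t h0 h1 ht using ex
  obtain ⟨i, j, hij⟩ := exists_mul_lt_sub hm t (c := Real.pi / 3) (by
    intro i j hij
    refine (abs_sub_of_one_lt_norm hu
      (abs_le.2 ⟨by linarith [h0 i, h1 j], by linarith [h1 i, h0 j]⟩) ?_).1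
    rw [← ht, ← ht, sub_sub_sub_cancel_right]
    exact (hq _ _ (f.injective.ne hij)).2 (hind _ _ (hf i) (hf j)))
  exact ⟨i, j, t i, t j, h0 i, h1 j, hij, by rw [← ht]; ring, by rw [← ht]; ring⟩

theorem exists_angle_of_adj {V : Type*} {G : SimpleGraph V} {q : V → ℂ}
    (hq : IsUnitRealization G q) {b c x : V} (hbc : G.Adj c b) (hx : G.Adj c x) :
    ∃ ψ : ℝ, 0 ≤ ψ ∧ ψ < 2 * Real.pi ∧
      q x = q c + (q b - q c) * Complex.exp (ψ * Complex.I) := by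
  obtain ⟨ψ, h0, h1, h⟩ := exists_angle ((hq _ _ hbc.ne').1 hbc.symm)
    ((hq _ _ hx.ne').1 hx.symm)
  exact ⟨ψ, h0, h1, by rw [← h]; ring⟩

/-- Two neighbours of `c` that are not adjacent to each other are seen from `c` under an angle
greater than `π / 3`, measured either way round. -/
theorem angle_gap {V : Type*} {G : SimpleGraph V} {q : V → ℂ}
    (hq : IsUnitRealization G q) {b c x y : V} (hbc : G.Adj c b) (hne : x ≠ y)
    (hxy : ¬ G.Adj x y) {a a' : ℝ} (h0 : 0 ≤ a) (h1 : a < 2 * Real.pi) (h0' : 0 ≤ a')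
    (h1' : a' < 2 * Real.pi)
    (hx : q x = q c + (q b - q c) * Complex.exp (a * Complex.I))
    (hy : q y = q c + (q b - q c) * Complex.exp (a' * Complex.I)) :
    Real.pi / 3 < |a - a'| ∧ |a - a'| < 5 * Real.pi / 3 := by
  refine abs_sub_of_one_lt_norm ((hq _ _ hbc.ne').1 hbc.symm)
    (abs_le.2 ⟨by linarith, by linarith⟩) ?_
  rw [← add_sub_add_left_eq_sub _ _ (q c), ← hx, ← hy]
  exact (hq _ _ hne).2 hxy

/-- Five neighbours besides `b` would span more than `4 * (π / 3)`, which is the length of the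
interval from `π / 3` to `5 * π / 3` that `b` leaves to them. -/
theorem degree_le_five {V : Type*} [Fintype V] {G : SimpleGraph V} [DecidableRel G.Adj]
    {q : V → ℂ} (hq : IsUnitRealization G q) {c : V}
    (hind : ∀ x y, G.Adj c x → G.Adj c y → ¬ G.Adj x y) : G.degree c ≤ 5 := by
  classical
  by_contra hc
  push Not at hc
  obtain ⟨b, hb⟩ := (G.degree_pos_iff_exists_adj c).1 (by omega)
  have hcard : Fintype.card (Fin (4 + 1)) ≤ Fintype.card ((G.neighborFinset c).erase b) := by
    rw [Fintype.card_fin, Fintype.card_coe, Finset.card_erase_of_mem (by simpa using hb),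
      SimpleGraph.card_neighborFinset_eq_degree]
    omega
  obtain ⟨g⟩ := Function.Embedding.nonempty_of_card_le hcard
  have hg : ∀ i, (g i : V) ≠ b ∧ G.Adj c (g i) := fun i =>
    ⟨(Finset.mem_erase.1 (g i).2).1,
      (G.mem_neighborFinset _ _).1 (Finset.mem_erase.1 (g i).2).2⟩
  obtain ⟨i, j, a, a', h0, h1, hlt, hi, hj⟩ := exists_spread_angles hq hb hind (by norm_num)
    (g.trans (Function.Embedding.subtype _)) (fun i => (hg i).2)
  have hp := Real.pi_pos
  have hbase : q b = q c + (q b - q c) * Complex.exp ((0 : ℝ) * Complex.I) := by simp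
  push_cast at hlt
  have g1 := angle_gap hq hb (hg i).1 (hind _ _ (hg i).2 hb) h0 (by linarith) le_rfl
    (by linarith) hi hbase
  have g2 := angle_gap hq hb (hg j).1 (hind _ _ (hg j).2 hb) (by linarith) h1 le_rfl
    (by linarith) hj hbase
  rw [sub_zero, abs_of_nonneg (by linarith)] at g1 g2
  linarith

/-! ### Covered arcs along the spine -/

/-- The vertices of the caterpillar on one side of the spine edge from position `i` to position
`i + 1`: the spine up to position `i` and the leaves attached there. -/
def sideSet {V : Type*} [Fintype V] {G : SimpleGraph V} [DecidableRel G.Adj] {k : ℕ}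
    (v : InnerPath G k) (i : ℕ) : Set V :=
  {x | ∃ j : Fin k, j.val ≤ i ∧ (x = v j ∨ (G.degree x = 1 ∧ G.Adj (v j) x))}

/-- On the unit circle around `c₂`, the arc of length `A` that starts in the direction of `c₁` and
runs in the sense of rotation `s = ±1` is covered by the closed unit disks around the vertices
in `S`. -/
def ArcCovered {V : Type*} (q : V → ℂ) (S : Set V) (c₁ c₂ : ℂ) (s A : ℝ) : Prop :=
  ∀ ψ, 0 ≤ ψ → ψ ≤ A →
    ∃ x ∈ S, ‖c₂ + (c₁ - c₂) * Complex.exp ((s * ψ : ℝ) * Complex.I) - q x‖ ≤ 1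

theorem exp_mul_exp_assoc (c₁ c₂ : ℂ) {θ s L : ℝ} {c₃ : ℂ}
    (h : c₃ = c₂ + (c₁ - c₂) * Complex.exp (θ * Complex.I)) :
    c₂ + (c₃ - c₂) * Complex.exp ((s * L : ℝ) * Complex.I) =
      c₂ + (c₁ - c₂) * Complex.exp ((θ + s * L : ℝ) * Complex.I) := by
  rw [h, add_sub_cancel_left, mul_assoc, ← Complex.exp_add]
  congr 3
  push_cast; ring

theorem norm_one_sub_exp_le_one {ψ : ℝ} (h0 : 0 ≤ ψ) (h1 : ψ ≤ Real.pi / 3) {s : ℝ}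
    (hs : s = 1 ∨ s = -1) : ‖1 - Complex.exp ((s * ψ : ℝ) * Complex.I)‖ ≤ 1 := by
  rw [← abs_of_nonneg (norm_nonneg (_ - _)), ← sq_le_one_iff_abs_le_one,
    ← Complex.normSq_eq_norm_sq, Complex.normSq_apply]
  simp only [Complex.sub_re, Complex.sub_im, Complex.exp_ofReal_mul_I_re,
    Complex.exp_ofReal_mul_I_im, Complex.one_re, Complex.one_im]
  have h2 : Real.cos (s * ψ) = Real.cos ψ := by
    rcases hs with rfl | rfl
    · rw [one_mul]
    · rw [neg_one_mul, Real.cos_neg]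
  have h3 := Real.cos_le_cos_of_nonneg_of_le_pi h0 (by linarith [Real.pi_pos]) h1
  rw [Real.cos_pi_div_three, ← h2] at h3
  nlinarith [Real.sin_sq_add_cos_sq (s * ψ)]

/-- A neighbour `x` of `c₁` at angle `L` from the edge `c₁ → c₂` covers an arc. -/
theorem arcCovered_of_neighbour {V : Type*} {q : V → ℂ} {S : Set V} {c₁ c₂ : ℂ}
    (h : ‖c₂ - c₁‖ = 1) {s L : ℝ} (hs : s = 1 ∨ s = -1) (hL : 0 ≤ L) {x : V} (hx : x ∈ S)
    (hqx : q x = c₁ + (c₂ - c₁) * Complex.exp ((-(s * L) : ℝ) * Complex.I)) :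
    ArcCovered q S c₁ c₂ s (Real.pi - L) :=
  fun _ h0 h1 => ⟨x, hx, hqx ▸ arc_covered_of_neighbour h hs hL h0 h1⟩

/-- If the spine bends at `c₂` by making the angle `θ` on one side, the covered arc on that side is
passed on from `c₂` to `c₃`. -/
theorem ArcCovered.bend {V : Type*} {q : V → ℂ} {S T : Set V} {c₁ c₃ : ℂ} {y : V} {s L θ : ℝ}
    (hs : s = 1 ∨ s = -1) (hcov : ArcCovered q S c₁ (q y) s (Real.pi - L)) (hθ : Real.pi / 3 < θ)
    (hLθ : Real.pi < L + θ) (hST : S ⊆ T) (hy : y ∈ T) (h23 : ‖c₃ - q y‖ = 1)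
    (h₁ : ∀ x ∈ S, 1 ≤ ‖q x - q y‖) (h₂ : ∀ x ∈ S, 1 ≤ ‖q x - c₃‖)
    (hc₃ : c₃ = q y + (c₁ - q y) * Complex.exp ((s * θ : ℝ) * Complex.I)) :
    ArcCovered q T (q y) c₃ s (Real.pi - (L + θ - 2 * Real.pi / 3)) := by
  intro ψ h0 h1
  rcases le_or_gt ψ (Real.pi / 3) with h | h
  · refine ⟨y, hy, ?_⟩
    rw [show c₃ + (q y - c₃) * Complex.exp ((s * ψ : ℝ) * Complex.I) - q y =
      (c₃ - q y) * (1 - Complex.exp ((s * ψ : ℝ) * Complex.I)) by ring, norm_mul, h23, one_mul]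
    exact norm_one_sub_exp_le_one h0 h hs
  · obtain ⟨x, hx, hb⟩ := hcov (θ - (2 * Real.pi / 3 - ψ)) (by linarith) (by linarith)
    refine ⟨x, hST hx, ?_⟩
    have := covered_of_rotated h23 hs (α := 2 * Real.pi / 3 - ψ) (by linarith) (by linarith)
      (h₁ x hx) (h₂ x hx) ?_
    · rwa [sub_sub_cancel] at this
    · rw [show -(s * (2 * Real.pi / 3 - ψ)) = s * -(2 * Real.pi / 3 - ψ) by ring,
        exp_mul_exp_assoc _ _ hc₃]
      rwa [show s * θ + s * -(2 * Real.pi / 3 - ψ) = s * (θ - (2 * Real.pi / 3 - ψ)) by ring]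

/-- The state of a spine edge `c₁ → c₂`: the free angles `L` and `R` on its two sides, seen
from `c₁`, are less than `π` in total, and what the vertices behind the edge cover on the unit
circle around `c₂` is the same as if there were neighbours of `c₁` at these angles. If there is
no leaf of `c₁` on one side because the spine bends there, the angle on that side is virtual. -/
def EdgeCrowded {V : Type*} [Fintype V] {G : SimpleGraph V} [DecidableRel G.Adj] {k : ℕ}
    (v : InnerPath G k) (q : V → ℂ) (i : ℕ) (c₁ c₂ : ℂ) : Prop :=
  ∃ L R : ℝ, Real.pi / 3 < L ∧ Real.pi / 3 < R ∧ L + R < Real.pi ∧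
    ArcCovered q (sideSet v i) c₁ c₂ 1 (Real.pi - L) ∧
    ArcCovered q (sideSet v i) c₁ c₂ (-1) (Real.pi - R)

section Crowded

variable {V : Type*} [Fintype V] {G : SimpleGraph V} [DecidableRel G.Adj] {k : ℕ}
  {v : InnerPath G k} {q : V → ℂ}

theorem sideSet_mono {i j : ℕ} (h : i ≤ j) : sideSet v i ⊆ sideSet v j :=
  fun _ ⟨l, hl, hx⟩ => ⟨l, hl.trans h, hx⟩

theorem ne_spine_of_mem_sideSet {i : ℕ} {j : Fin k} (hij : i < j.val) {x : V}
    (hx : x ∈ sideSet v i) : x ≠ v j := by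
  obtain ⟨l, hl, rfl | ⟨h1, -⟩⟩ := hx
  · intro h
    have := spine_injective v h
    subst this
    omega
  · rintro rfl
    exact spine_degree_ne_one v j h1

theorem mem_sideSet_of_adj {i : Fin k} {x : V} (hx : G.Adj (v i) x)
    (h : ∀ j : Fin k, j.val = i.val + 1 → x ≠ v j) : x ∈ sideSet v i := by
  by_cases h1 : G.degree x = 1
  · exact ⟨i, le_rfl, Or.inr ⟨h1, hx⟩⟩
  · obtain ⟨j, rfl⟩ := exists_spine_eq v h1
    have := (spine_adj_iff v i j).1 hx
    have h2 : j.val ≠ i.val + 1 := fun e => h j e rfl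
    exact ⟨j, by omega, Or.inl rfl⟩

/-- Neighbours of the next spine vertex, except the present one, are far from all vertices behind
the edge. -/
theorem one_lt_norm_of_mem_sideSet (hq : IsUnitRealization G q) {i j : Fin k}
    (hij : i.val + 1 = j.val) {x y : V} (hx : x ∈ sideSet v i) (hy : G.Adj (v j) y)
    (hyi : y ≠ v i) : 1 < ‖q y - q x‖ := by
  have key : x ≠ y ∧ ¬ G.Adj y x := by
    by_cases h1 : G.degree y = 1
    · have hu : ∀ z, G.Adj y z → z = v j := fun z hz => eq_of_degree_eq_one h1 hz hy.symm
      refine ⟨?_, fun h => ?_⟩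
      · rintro rfl
        obtain ⟨l, hl, rfl | ⟨-, h2⟩⟩ := hx
        · exact spine_degree_ne_one v l h1
        · have := spine_injective v (hu _ h2.symm)
          subst this
          omega
      · exact ne_spine_of_mem_sideSet (by omega) hx (hu _ h)
    · obtain ⟨l, rfl⟩ := exists_spine_eq v h1
      have hl := (spine_adj_iff v j l).1 hy
      have hli : l ≠ i := by rintro rfl; exact hyi rfl
      have hli' : l.val ≠ i.val := fun e => hli (Fin.ext e)
      refine ⟨ne_spine_of_mem_sideSet (by omega) hx, fun h => ?_⟩
      obtain ⟨m, hm, rfl | ⟨h2, h3⟩⟩ := hx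
      · have := (spine_adj_iff v l m).1 h
        omega
      · have := spine_injective v (eq_of_degree_eq_one h2 h.symm h3.symm)
        subst this
        omega
  exact (hq _ _ key.1.symm).2 key.2

end Crowded

/-! ### Two spine vertices of degree five -/

section Crowded

variable {V : Type*} [Fintype V] {G : SimpleGraph V} [DecidableRel G.Adj] {k : ℕ}
  {v : InnerPath G k} {q : V → ℂ}

theorem exists_embedding_neighbors {c b : V} (hb : G.Adj c b) {m : ℕ} (h : m < G.degree c) :
    ∃ f : Fin m ↪ V, ∀ i, G.Adj c (f i) ∧ f i ≠ b := by
  classical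
  have hcard : Fintype.card (Fin m) ≤ Fintype.card ((G.neighborFinset c).erase b) := by
    rw [Fintype.card_fin, Fintype.card_coe, Finset.card_erase_of_mem (by simpa using hb),
      SimpleGraph.card_neighborFinset_eq_degree]
    omega
  obtain ⟨g⟩ := Function.Embedding.nonempty_of_card_le hcard
  exact ⟨g.trans (Function.Embedding.subtype _), fun i =>
    ⟨(G.mem_neighborFinset _ _).1 (Finset.mem_erase.1 (g i).2).2, (Finset.mem_erase.1 (g i).2).1⟩⟩

/-- A spine vertex of degree five crowds the next edge. -/
theorem edgeCrowded_of_five_le_degree (hq : IsUnitRealization G q) {i j : Fin k}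
    (hij : i.val + 1 = j.val) (hdeg : 5 ≤ G.degree (v i)) :
    EdgeCrowded v q i (q (v i)) (q (v j)) := by
  have hp := Real.pi_pos
  have hadj : G.Adj (v i) (v j) := (spine_adj_iff v i j).2 (Or.inl hij)
  obtain ⟨f, hf⟩ := exists_embedding_neighbors hadj (m := 3 + 1) (by omega)
  obtain ⟨a, b, t, t', h0, h1, hlt, ha, hb⟩ := exists_spread_angles hq hadj
    (fun _ _ => not_adj_of_adj_spine v) (by norm_num) f (fun l => (hf l).1)
  push_cast at hlt
  have hu : ‖q (v j) - q (v i)‖ = 1 := (hq _ _ hadj.ne').1 hadj.symm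
  have hbase : q (v j) = q (v i) + (q (v j) - q (v i)) * Complex.exp ((0 : ℝ) * Complex.I) := by
    simp
  have g1 := angle_gap hq hadj (hf a).2 (not_adj_of_adj_spine v (hf a).1 hadj) h0
    (by linarith) le_rfl (by linarith) ha hbase
  have g2 := angle_gap hq hadj (hf b).2 (not_adj_of_adj_spine v (hf b).1 hadj) (by linarith)
    h1 le_rfl (by linarith) hb hbase
  rw [sub_zero, abs_of_nonneg (by linarith)] at g1 g2
  have hmem : ∀ l, f l ∈ sideSet v i := fun l => mem_sideSet_of_adj (hf l).1 fun m hm => by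
    have : m = j := Fin.ext (hm.trans hij)
    exact this ▸ (hf l).2
  refine ⟨2 * Real.pi - t', t, by linarith, by linarith, by linarith, ?_, ?_⟩
  · refine arcCovered_of_neighbour hu (Or.inl rfl) (by linarith) (hmem b) ?_
    rw [hb]
    congr 2
    rw [show ((-(1 * (2 * Real.pi - t')) : ℝ) : ℂ) * Complex.I =
      t' * Complex.I - 2 * Real.pi * Complex.I by push_cast; ring, Complex.exp_sub,
      Complex.exp_two_pi_mul_I, div_one]
  · refine arcCovered_of_neighbour hu (Or.inr rfl) (by linarith) (hmem a) ?_
    rw [ha]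
    congr 3
    simp

/-- The angles of the neighbours of `v j`, relative to the spine edge that ends there, lie in the
interval that a crowded edge leaves free. -/
theorem exists_angle_of_edgeCrowded (hq : IsUnitRealization G q) {i j : Fin k}
    (hij : i.val + 1 = j.val) {L R : ℝ}
    (hcL : ArcCovered q (sideSet v i) (q (v i)) (q (v j)) 1 (Real.pi - L))
    (hcR : ArcCovered q (sideSet v i) (q (v i)) (q (v j)) (-1) (Real.pi - R))
    {y : V} (hy : G.Adj (v j) y) (hyi : y ≠ v i) {ψ : ℝ} (h0 : 0 ≤ ψ) (h1 : ψ < 2 * Real.pi)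
    (hψ : q y = q (v j) + (q (v i) - q (v j)) * Complex.exp (ψ * Complex.I)) :
    Real.pi - L < ψ ∧ ψ < Real.pi + R := by
  constructor
  · by_contra hc
    push Not at hc
    obtain ⟨x, hx, hle⟩ := hcL ψ h0 hc
    rw [one_mul, ← hψ] at hle
    exact (one_lt_norm_of_mem_sideSet hq hij hx hy hyi).not_ge hle
  · by_contra hc
    push Not at hc
    obtain ⟨x, hx, hle⟩ := hcR (2 * Real.pi - ψ) (by linarith) (by linarith)
    rw [show ((-1 * (2 * Real.pi - ψ) : ℝ) : ℂ) * Complex.I =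
      ψ * Complex.I - 2 * Real.pi * Complex.I by push_cast; ring, Complex.exp_sub,
      Complex.exp_two_pi_mul_I, div_one, ← hψ] at hle
    exact (one_lt_norm_of_mem_sideSet hq hij hx hy hyi).not_ge hle

/-- A crowded edge does not lead to a vertex of degree five. -/
theorem degree_le_four_of_edgeCrowded (hq : IsUnitRealization G q) {i j : Fin k}
    (hij : i.val + 1 = j.val) (hc : EdgeCrowded v q i (q (v i)) (q (v j))) :
    G.degree (v j) ≤ 4 := by
  by_contra hdeg
  push Not at hdeg
  have hadj : G.Adj (v j) (v i) := (spine_adj_iff v j i).2 (Or.inr hij)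
  obtain ⟨L, R, hL, hR, hLR, hcL, hcR⟩ := hc
  obtain ⟨f, hf⟩ := exists_embedding_neighbors hadj (m := 3 + 1) (by omega)
  obtain ⟨a, b, t, t', h0, h1, hlt, ha, hb⟩ := exists_spread_angles hq hadj
    (fun _ _ => not_adj_of_adj_spine v) (by norm_num) f (fun l => (hf l).1)
  push_cast at hlt
  have hp := Real.pi_pos
  have g1 := exists_angle_of_edgeCrowded hq hij hcL hcR (hf a).1 (hf a).2 h0
    (by linarith) ha
  have g2 := exists_angle_of_edgeCrowded hq hij hcL hcR (hf b).1 (hf b).2 (by linarith)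
    h1 hb
  linarith

/-- A crowded edge that leads to a vertex of degree at least four crowds the next edge. -/
theorem EdgeCrowded.step (hq : IsUnitRealization G q) {i j l : Fin k}
    (hij : i.val + 1 = j.val) (hjl : j.val + 1 = l.val) (hdeg : 4 ≤ G.degree (v j))
    (hc : EdgeCrowded v q i (q (v i)) (q (v j))) :
    EdgeCrowded v q j (q (v j)) (q (v l)) := by
  classical
  have hp := Real.pi_pos
  have hadj : G.Adj (v j) (v i) := (spine_adj_iff v j i).2 (Or.inr hij)
  have hadj' : G.Adj (v j) (v l) := (spine_adj_iff v j l).2 (Or.inl hjl)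
  have hli : (v l : V) ≠ v i := fun e => by
    have := spine_injective v e
    subst this
    omega
  obtain ⟨L, R, hL, hR, hLR, hcL, hcR⟩ := hc
  -- two neighbours of `v j` that are not on the spine
  have hcard : 1 < (((G.neighborFinset (v j)).erase (v i)).erase (v l)).card := by
    rw [Finset.card_erase_of_mem (by simp [hadj', hli]),
      Finset.card_erase_of_mem (by simpa using hadj), SimpleGraph.card_neighborFinset_eq_degree]
    omega
  obtain ⟨a, ha, b, hb, hab⟩ := Finset.one_lt_card.1 hcard
  simp only [Finset.mem_erase, SimpleGraph.mem_neighborFinset, ne_eq] at ha hb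
  obtain ⟨ψ, h0, h1, hψ⟩ := exists_angle_of_adj hq hadj hadj'
  obtain ⟨α, hα0, hα1, hα⟩ := exists_angle_of_adj hq hadj ha.2.2
  obtain ⟨β, hβ0, hβ1, hβ⟩ := exists_angle_of_adj hq hadj hb.2.2
  have iψ := exists_angle_of_edgeCrowded hq hij hcL hcR hadj' hli h0 h1 hψ
  have gab := (angle_gap hq hadj hab (not_adj_of_adj_spine v ha.2.2 hb.2.2) hα0 hα1 hβ0 hβ1
    hα hβ).1
  wlog hlt : α < β generalizing a b α β
  · refine this b a (Ne.symm hab) hb ha β hβ0 hβ1 hβ α hα0 hα1 hα (by rwa [abs_sub_comm]) ?_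
    refine lt_of_le_of_ne (not_lt.1 hlt) fun e => ?_
    rw [e, sub_self, abs_zero] at gab
    linarith
  have iα := exists_angle_of_edgeCrowded hq hij hcL hcR ha.2.2 ha.2.1 hα0 hα1 hα
  have iβ := exists_angle_of_edgeCrowded hq hij hcL hcR hb.2.2 hb.2.1 hβ0 hβ1 hβ
  have gα := angle_gap hq hadj ha.1 (not_adj_of_adj_spine v ha.2.2 hadj') hα0 hα1 h0 h1 hα hψ
  have gβ := angle_gap hq hadj hb.1 (not_adj_of_adj_spine v hb.2.2 hadj') hβ0 hβ1 h0 h1 hβ hψ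
  have hbase : q (v i) = q (v j) + (q (v i) - q (v j)) * Complex.exp ((0 : ℝ) * Complex.I) := by
    simp
  have gψ := angle_gap hq hadj hli (not_adj_of_adj_spine v hadj' hadj) h0 h1 le_rfl
    (by linarith) hψ hbase
  rw [sub_zero, abs_of_nonneg h0] at gψ
  rw [abs_sub_comm, abs_of_pos (sub_pos.2 hlt)] at gab
  have hu : ‖q (v l) - q (v j)‖ = 1 := (hq _ _ hadj'.ne').1 hadj'.symm
  have hleaf : ∀ y, G.Adj (v j) y → y ≠ v l → y ∈ sideSet v j := fun y hy hyl =>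
    mem_sideSet_of_adj hy fun m hm => by
      have : m = l := Fin.ext (hm.trans hjl)
      exact this ▸ hyl
  have hSij : sideSet v i ⊆ sideSet v j := sideSet_mono (by omega)
  have d1 : ∀ x ∈ sideSet v i, 1 ≤ ‖q x - q (v j)‖ := fun x hx =>
    hq.one_le (ne_spine_of_mem_sideSet (by omega) hx)
  have d2 : ∀ x ∈ sideSet v i, 1 ≤ ‖q x - q (v l)‖ := fun x hx =>
    hq.one_le (ne_spine_of_mem_sideSet (by omega) hx)
  have covL : ∀ y t, G.Adj (v j) y → y ≠ v l → t ≤ ψ →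
      q y = q (v j) + (q (v i) - q (v j)) * Complex.exp (t * Complex.I) →
      ArcCovered q (sideSet v j) (q (v j)) (q (v l)) 1 (Real.pi - (ψ - t)) := by
    intro y t hy hyl ht hqy
    refine arcCovered_of_neighbour hu (Or.inl rfl) (by linarith) (hleaf y hy hyl) ?_
    rw [show -(1 * (ψ - t)) = 1 * (t - ψ) by ring, exp_mul_exp_assoc _ _ hψ, hqy]
    congr 3
    push_cast
    ring
  have covR : ∀ y t, G.Adj (v j) y → y ≠ v l → ψ ≤ t →
      q y = q (v j) + (q (v i) - q (v j)) * Complex.exp (t * Complex.I) →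
      ArcCovered q (sideSet v j) (q (v j)) (q (v l)) (-1) (Real.pi - (t - ψ)) := by
    intro y t hy hyl ht hqy
    refine arcCovered_of_neighbour hu (Or.inr rfl) (by linarith) (hleaf y hy hyl) ?_
    rw [show -(-1 * (t - ψ)) = 1 * (t - ψ) by ring, exp_mul_exp_assoc _ _ hψ, hqy]
    congr 3
    push_cast
    ring
  -- The next spine vertex is on one side of both leaves, and the spine bends, or between them.
  rcases lt_or_ge ψ α with hc1 | hc1
  · rw [abs_of_pos (sub_pos.2 hc1)] at gα
    refine ⟨L + ψ - 2 * Real.pi / 3, α - ψ, by linarith, by linarith, by linarith, ?_,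
      covR a α ha.2.2 ha.1 hc1.le hα⟩
    exact hcL.bend (Or.inl rfl) gψ.1 (by linarith) hSij ⟨j, le_rfl, Or.inl rfl⟩ hu d1 d2
      (by rw [one_mul]; exact hψ)
  rcases lt_or_ge β ψ with hc2 | hc2
  · rw [abs_sub_comm, abs_of_pos (sub_pos.2 hc2)] at gβ
    refine ⟨ψ - β, R + (2 * Real.pi - ψ) - 2 * Real.pi / 3, by linarith, by linarith,
      by linarith, covL b β hb.2.2 hb.1 hc2.le hβ, ?_⟩
    refine hcR.bend (Or.inr rfl) (by linarith) (by linarith) hSij ⟨j, le_rfl, Or.inl rfl⟩ hu d1 d2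
      ?_
    rw [show ((-1 * (2 * Real.pi - ψ) : ℝ) : ℂ) * Complex.I =
      ψ * Complex.I - 2 * Real.pi * Complex.I by push_cast; ring, Complex.exp_sub,
      Complex.exp_two_pi_mul_I, div_one, ← hψ]
  · rw [abs_of_nonneg (sub_nonneg.2 hc2)] at gβ
    rw [abs_sub_comm, abs_of_nonneg (sub_nonneg.2 hc1)] at gα
    exact ⟨ψ - α, β - ψ, by linarith, by linarith, by linarith,
      covL a α ha.2.2 ha.1 hc1 hα, covR b β hb.2.2 hb.1 hc2 hβ⟩

/-- After a vertex of degree five, all edges are crowded as long as the degrees are at least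
four. -/
theorem edgeCrowded_between (hq : IsUnitRealization G q) {i : Fin k} (hi : 5 ≤ G.degree (v i))
    (m : ℕ) : ∀ a b : Fin k, a.val = i.val + m → a.val + 1 = b.val →
      (∀ l : Fin k, i < l → l < b → 4 ≤ G.degree (v l)) →
      EdgeCrowded v q a (q (v a)) (q (v b)) := by
  induction m with
  | zero =>
    intro a b ha hab _
    obtain rfl : a = i := Fin.ext ha
    exact edgeCrowded_of_five_le_degree hq hab hi
  | succ m ih =>
    intro a b ha hab h4
    have hk : i.val + m < k := by omega
    refine EdgeCrowded.step hq (i := ⟨i.val + m, hk⟩) (by simp; omega) hab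
      (h4 a (Fin.lt_def.2 (by omega)) (Fin.lt_def.2 (by omega))) ?_
    exact ih ⟨i.val + m, hk⟩ a rfl (by simp; omega) fun l h1 h2 => h4 l h1 (h2.trans
      (Fin.lt_def.2 (by omega)))

/-- Between two spine vertices of degree five there is one of degree at most three. -/
theorem exists_degree_le_three_between (hq : IsUnitRealization G q) {i j : Fin k} (hij : i < j)
    (hi : 5 ≤ G.degree (v i)) (hj : 5 ≤ G.degree (v j)) :
    ∃ l, i < l ∧ l < j ∧ G.degree (v l) ≤ 3 := by
  by_contra hc
  push Not at hc
  have hij' := Fin.lt_def.1 hij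
  have h := edgeCrowded_between hq hi (j.val - 1 - i.val) ⟨j.val - 1, by omega⟩ j
    (by simp; omega) (by simp; omega) (fun l h1 h2 => hc l h1 h2)
  have := degree_le_four_of_edgeCrowded hq (by simp; omega) h
  omega

end Crowded

/-! ### A placement of disks for a sequence of degrees -/

namespace Placement

/-- Whether, among the positions before `i`, there is one of degree five after which no degree is
at most three. -/
def armed (d : ℕ → ℕ) : ℕ → Bool
  | 0 => false
  | i + 1 => if d i = 5 then true else if d i ≤ 3 then false else armed d i

/-- The unit of angle for a spine with at most `N` edges. Each leaf direction is turned by one unit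
against the preceding one, so that the whole spine uses up at most `N + 1` of them. -/
noncomputable def tick (N : ℕ) : ℝ := 1 / (1000 * (N : ℝ) * N)

/-- The turn of the spine at a vertex of degree five: more than all the units of angle used up by
the leaves, and so small that all turns together stay below `1 / 500`. -/
noncomputable def bend (N : ℕ) : ℝ := 2 * N * tick N

/-- Direction of the spine edge that ends at position `i`. -/
noncomputable def dir (N : ℕ) (d : ℕ → ℕ) : ℕ → ℝ
  | 0 => 0
  | i + 1 => if d i = 5 then dir N d i - bend N else dir N d i

/-- Abscissa of the spine vertex at position `i`. -/
noncomputable def spineX (N : ℕ) (d : ℕ → ℕ) : ℕ → ℝ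
  | 0 => 0
  | i + 1 => spineX N d i + 2 * Real.cos (dir N d (i + 1))

/-- Ordinate of the spine vertex at position `i`. -/
noncomputable def spineY (N : ℕ) (d : ℕ → ℕ) : ℕ → ℝ
  | 0 => 0
  | i + 1 => spineY N d i + 2 * Real.sin (dir N d (i + 1))

/-- Direction from position `i` to its leaf number `κ`: leaf `1` is below the spine, leaves `2` and
`3` are above it. -/
noncomputable def leafAngle (N : ℕ) (d : ℕ → ℕ) (i κ : ℕ) : ℝ :=
  if κ = 1 then i * tick N - Real.pi / 2
  else if κ = 2 then
    if armed d i then (dir N d i + bend N - (i + 1) * tick N) + Real.pi / 3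
    else (dir N d i - (i + 1) * tick N) + 2 * Real.pi / 3
  else (dir N d i - (i + 3 / 2) * tick N) + Real.pi / 3

/-- Abscissa of the spine vertex (`κ = 0`) or of leaf number `κ` at position `i`. -/
noncomputable def ptX (N : ℕ) (d : ℕ → ℕ) (i κ : ℕ) : ℝ :=
  if κ = 0 then spineX N d i else spineX N d i + 2 * Real.cos (leafAngle N d i κ)

/-- Ordinate of the spine vertex (`κ = 0`) or of leaf number `κ` at position `i`. -/
noncomputable def ptY (N : ℕ) (d : ℕ → ℕ) (i κ : ℕ) : ℝ :=
  if κ = 0 then spineY N d i else spineY N d i + 2 * Real.sin (leafAngle N d i κ)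

/-- The square of the distance of two places, each given by a position and the number of a
leaf. -/
noncomputable def sqDist (N : ℕ) (d : ℕ → ℕ) (a b : ℕ × ℕ) : ℝ :=
  (ptX N d a.1 a.2 - ptX N d b.1 b.2) ^ 2 + (ptY N d a.1 a.2 - ptY N d b.1 b.2) ^ 2

/-- The places that exist at position `i`: the spine vertex, and a number of leaves that is two less
than the degree. -/
def IsPlace (N : ℕ) (d : ℕ → ℕ) (a : ℕ × ℕ) : Prop :=
  a.1 ≤ N ∧ a.2 ≤ 3 ∧ (a.2 ≠ 0 → a.1 < N ∧ a.2 + 2 ≤ d a.1)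

/-- Adjacency of places. -/
def PlaceAdj (a b : ℕ × ℕ) : Prop :=
  (a.2 = 0 ∧ b.2 = 0 ∧ (a.1 + 1 = b.1 ∨ b.1 + 1 = a.1)) ∨
    (a.1 = b.1 ∧ (a.2 = 0 ∧ b.2 ≠ 0 ∨ a.2 ≠ 0 ∧ b.2 = 0))

theorem four_lt_of_projection {x y φ : ℝ} (h : 2 < x * Real.cos φ + y * Real.sin φ) :
    4 < x ^ 2 + y ^ 2 := by
  nlinarith [Real.sin_sq_add_cos_sq φ, sq_nonneg (x * Real.sin φ - y * Real.cos φ)]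

theorem four_lt_of_abscissa {x y : ℝ} (h : 2 < x) : 4 < x ^ 2 + y ^ 2 := by
  nlinarith [sq_nonneg y]

theorem four_lt_of_ordinate {x y : ℝ} (h : 2 < y) : 4 < x ^ 2 + y ^ 2 := by
  nlinarith [sq_nonneg x]

variable {N : ℕ} {d : ℕ → ℕ}

theorem tick_pos (hN : 2 ≤ N) : 0 < tick N := by
  have : (0 : ℝ) < N := by exact_mod_cast (by omega : 0 < N)
  unfold tick; positivity

theorem bend_pos (hN : 2 ≤ N) : 0 < bend N := by
  have : (0 : ℝ) < N := by exact_mod_cast (by omega : 0 < N)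
  have := tick_pos hN
  unfold bend; positivity

theorem mul_bend (hN : 2 ≤ N) : N * bend N = 1 / 500 := by
  have : (0 : ℝ) < N := by exact_mod_cast (by omega : 0 < N)
  unfold bend tick
  field_simp
  norm_num

theorem bend_le (hN : 2 ≤ N) : bend N ≤ 1 / 1000 := by
  have h2 : (2 : ℝ) ≤ N := by exact_mod_cast hN
  have := mul_bend hN
  have := bend_pos hN
  nlinarith

theorem add_mul_tick_lt (hN : 2 ≤ N) {i : ℕ} (hi : i ≤ N) :
    ((i : ℝ) + 3 / 2) * tick N < bend N := by
  have h2 : (2 : ℝ) ≤ N := by exact_mod_cast hN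
  have h3 : (i : ℝ) ≤ N := by exact_mod_cast hi
  unfold bend
  exact mul_lt_mul_of_pos_right (by linarith) (tick_pos hN)

theorem dir_succ_le (hN : 2 ≤ N) (i : ℕ) : dir N d (i + 1) ≤ dir N d i := by
  have := bend_pos hN
  rw [dir]
  split_ifs <;> linarith

theorem dir_nonpos (hN : 2 ≤ N) (i : ℕ) : dir N d i ≤ 0 := by
  induction i with
  | zero => simp [dir]
  | succ i ih => exact (dir_succ_le hN i).trans ih

theorem neg_le_dir (hN : 2 ≤ N) {i : ℕ} (hi : i ≤ N) : -(1 / 500) ≤ dir N d i := by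
  have hb := bend_pos hN
  have key : ∀ j : ℕ, -(j * bend N) ≤ dir N d j := by
    intro j
    induction j with
    | zero => simp [dir]
    | succ j ih =>
      rw [dir]
      push_cast
      split_ifs <;> linarith
  have h3 : (i : ℝ) ≤ N := by exact_mod_cast hi
  have := mul_le_mul_of_nonneg_right h3 hb.le
  linarith [key i, mul_bend hN]

theorem le_cos_dir (hN : 2 ≤ N) {i : ℕ} (hi : i ≤ N) : 1999 / 2000 ≤ Real.cos (dir N d i) := by
  have h := Real.one_sub_sq_div_two_le_cos (x := dir N d i)
  have h1 := neg_le_dir (d := d) hN hi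
  have h2 := dir_nonpos (d := d) hN i
  nlinarith

theorem le_spineX_sub (hN : 2 ≤ N) (i m : ℕ) (h : i + m ≤ N) :
    (m : ℝ) * (1999 / 1000) ≤ spineX N d (i + m) - spineX N d i := by
  induction m with
  | zero => simp
  | succ m ih =>
    have h1 := ih (by omega)
    have h2 := le_cos_dir (d := d) hN (i := i + m + 1) (by omega)
    rw [← add_assoc, spineX]
    push_cast
    linarith

/-- A vertex of degree five occurs only where the flag `armed` is not set. -/
def Admissible (d : ℕ → ℕ) : Prop := ∀ i, d i = 5 → armed d i = false

/-- The leaf directions above the spine keep the angle `π / 3` from both spine edges. -/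
theorem upper_angle_bounds (hN : 2 ≤ N) (hd : Admissible d) {i κ : ℕ} (hi : i < N) (h2 : 2 ≤ κ)
    (h3 : κ ≤ 3) (hκ : κ + 2 ≤ d i) (h5 : d i ≤ 5) :
    dir N d (i + 1) + Real.pi / 3 < leafAngle N d i κ ∧
      leafAngle N d i κ < dir N d i + 2 * Real.pi / 3 := by
  have hp := Real.pi_gt_three
  have ht := tick_pos hN
  have hb := bend_pos hN
  have hb' := bend_le hN
  have h := add_mul_tick_lt hN hi.le
  have hs := dir_succ_le (d := d) hN i
  have hi0 : (0 : ℝ) ≤ i * tick N := by positivity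
  have hd5 := hd i
  rcases (by omega : κ = 2 ∨ κ = 3) with rfl | rfl
  · simp only [leafAngle, OfNat.ofNat_ne_one, if_false, if_true]
    split_ifs with hf
    · have : d i ≠ 5 := fun e => by simp [hd5 e] at hf
      rw [dir, if_neg this]
      constructor <;> linarith
    · constructor <;> linarith
  · simp only [leafAngle, OfNat.ofNat_ne_one, if_false, Nat.reduceEqDiff]
    have : d i = 5 := by omega
    rw [dir, if_pos this]
    constructor <;> linarith

/-- From left to right, the leaf directions above the spine rotate clockwise. Admissibility
enters because a vertex of degree five has a leaf in both upper directions, so that no lean to the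
right may have been handed on to it. -/
theorem upper_angle_lt (hN : 2 ≤ N) (hd : Admissible d) {i κ κ' : ℕ} (hi : i + 1 < N)
    (h2 : 2 ≤ κ) (h3 : κ ≤ 3) (hκ : κ + 2 ≤ d i) (h5 : d i ≤ 5) (h2' : 2 ≤ κ') (h3' : κ' ≤ 3)
    (hκ' : κ' + 2 ≤ d (i + 1)) (h5' : d (i + 1) ≤ 5) :
    leafAngle N d (i + 1) κ' < leafAngle N d i κ := by
  have hp := Real.pi_gt_three
  have ht := tick_pos hN
  have hb := bend_pos hN
  have hb' := bend_le hN
  have h := add_mul_tick_lt hN hi.le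
  push_cast at h
  have hi0 : (0 : ℝ) ≤ i * tick N := by positivity
  have a1 : leafAngle N d (i + 1) κ' ≤ leafAngle N d (i + 1) 2 := by
    rcases (by omega : κ' = 2 ∨ κ' = 3) with rfl | rfl
    · exact le_rfl
    · have := hd (i + 1) (by omega)
      simp only [leafAngle, OfNat.ofNat_ne_one, if_false, Nat.reduceEqDiff, if_true, this,
        Bool.false_eq_true]
      linarith
  refine a1.trans_lt ?_
  by_cases e5 : d i = 5
  · have e : leafAngle N d (i + 1) 2 = (dir N d i - (i + 2) * tick N) + Real.pi / 3 := by
      simp only [leafAngle, OfNat.ofNat_ne_one, if_false, if_true, armed, e5, dir]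
      push_cast; ring
    rw [e]
    have := hd i e5
    rcases (by omega : κ = 2 ∨ κ = 3) with rfl | rfl
    · simp only [leafAngle, OfNat.ofNat_ne_one, if_false, if_true, this, Bool.false_eq_true]
      linarith
    · simp only [leafAngle, OfNat.ofNat_ne_one, if_false, Nat.reduceEqDiff]
      linarith
  · obtain rfl : κ = 2 := by omega
    have e4 : d i = 4 := by omega
    have e : armed d (i + 1) = armed d i := by simp [armed, e4]
    simp only [leafAngle, OfNat.ofNat_ne_one, if_false, if_true, e, dir, e5]
    push_cast
    split_ifs <;> linarith

theorem upper_coords (hN : 2 ≤ N) (hd : Admissible d) {i κ : ℕ} (hi : i < N) (h2 : 2 ≤ κ)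
    (h3 : κ ≤ 3) (hκ : κ + 2 ≤ d i) (h5 : d i ≤ 5) :
    -(51 / 100) ≤ Real.cos (leafAngle N d i κ) ∧ Real.cos (leafAngle N d i κ) ≤ 51 / 100 ∧
      4 / 5 ≤ Real.sin (leafAngle N d i κ) := by
  obtain ⟨h1, h1'⟩ := upper_angle_bounds hN hd hi h2 h3 hκ h5
  have hp := Real.pi_gt_three
  have b1 := neg_le_dir (d := d) hN (i := i + 1) (by omega)
  have b2 := dir_nonpos (d := d) hN i
  set θ := leafAngle N d i κ
  have l1 := abs_le.1 (Real.abs_cos_sub_cos_le (Real.pi / 3 - 1 / 500) (Real.pi / 3))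
  rw [show Real.pi / 3 - 1 / 500 - Real.pi / 3 = -(1 / 500) by ring, abs_neg,
    Real.cos_pi_div_three, abs_of_pos (by norm_num)] at l1
  have l2 := Real.cos_le_cos_of_nonneg_of_le_pi (x := Real.pi / 3 - 1 / 500) (y := θ)
    (by linarith) (by linarith) (by linarith)
  have l3 := Real.cos_le_cos_of_nonneg_of_le_pi (x := θ) (y := Real.pi - Real.pi / 3)
    (by linarith) (by linarith) (by linarith)
  rw [Real.cos_pi_sub, Real.cos_pi_div_three] at l3
  refine ⟨by linarith, by linarith, ?_⟩
  have l4 : 0 ≤ Real.sin θ := Real.sin_nonneg_of_nonneg_of_le_pi (by linarith) (by linarith)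
  nlinarith [Real.sin_sq_add_cos_sq θ]

theorem lower_angle_bounds (hN : 2 ≤ N) {i : ℕ} (hi : i ≤ N) :
    -(Real.pi / 2) ≤ leafAngle N d i 1 ∧ leafAngle N d i 1 ≤ -(Real.pi / 2) + 1 / 1000 := by
  have ht := tick_pos hN
  have h := add_mul_tick_lt hN hi
  have hb' := bend_le hN
  have hi0 : (0 : ℝ) ≤ i * tick N := by positivity
  simp only [leafAngle, if_true]
  constructor <;> linarith

theorem lower_coords (hN : 2 ≤ N) {i : ℕ} (hi : i ≤ N) :
    0 ≤ Real.cos (leafAngle N d i 1) ∧ Real.cos (leafAngle N d i 1) ≤ 1 / 1000 ∧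
      Real.sin (leafAngle N d i 1) ≤ -(9 / 10) := by
  obtain ⟨h1, h2⟩ := lower_angle_bounds (d := d) hN hi
  have hp := Real.pi_gt_three
  set θ := leafAngle N d i 1
  have c0 : 0 ≤ Real.cos θ := Real.cos_nonneg_of_mem_Icc ⟨h1, by linarith⟩
  have l1 := abs_le.1 (Real.abs_cos_sub_cos_le θ (-(Real.pi / 2)))
  rw [Real.cos_neg, Real.cos_pi_div_two, abs_of_nonneg (by linarith : 0 ≤ θ - -(Real.pi / 2))] at l1
  refine ⟨c0, by linarith, ?_⟩
  have l4 : Real.sin θ ≤ 0 := Real.sin_nonpos_of_nonpos_of_neg_pi_le (by linarith) (by linarith)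
  nlinarith [Real.sin_sq_add_cos_sq θ]

theorem abs_cos_leafAngle_le (hN : 2 ≤ N) (hd : Admissible d) {i κ : ℕ}
    (h : IsPlace N d (i, κ)) (h5 : d i ≤ 5) (h0 : κ ≠ 0) :
    -(51 / 100) ≤ Real.cos (leafAngle N d i κ) ∧ Real.cos (leafAngle N d i κ) ≤ 51 / 100 := by
  obtain ⟨h1, h2, h3⟩ := h
  have h3 := h3 h0
  dsimp only at *
  rcases (by omega : κ = 1 ∨ 2 ≤ κ) with rfl | hκ
  · have := lower_coords (d := d) hN h1
    constructor <;> linarith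
  · have := upper_coords hN hd h3.1 hκ h2 h3.2 h5
    exact ⟨this.1, this.2.1⟩

theorem sqDist_comm (a b : ℕ × ℕ) : sqDist N d a b = sqDist N d b a := by
  unfold sqDist; ring

theorem four_lt_sqDist_same (hN : 2 ≤ N) (hd : Admissible d) (h5 : ∀ i, d i ≤ 5) {i κ κ' : ℕ}
    (h : IsPlace N d (i, κ)) (h' : IsPlace N d (i, κ')) (h0 : κ ≠ 0) (hlt : κ < κ') :
    4 < sqDist N d (i, κ) (i, κ') := by
  rw [sqDist_comm]
  obtain ⟨h1, h2, h3⟩ := h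
  obtain ⟨h1', h2', h3'⟩ := h'
  have h3 := h3 h0
  have h3' := h3' (by dsimp only; omega)
  dsimp only at *
  have hκ'0 : κ' ≠ 0 := by omega
  simp only [sqDist, ptX, ptY, h0, hκ'0, if_false]
  rcases (by omega : κ = 1 ∨ (κ = 2 ∧ κ' = 3)) with rfl | ⟨rfl, rfl⟩
  · have := lower_coords (d := d) hN h1
    have := upper_coords hN hd h3.1 (by omega) h2' h3'.2 (h5 i)
    exact four_lt_of_ordinate (by linarith)
  · have hf := hd i (by have := h5 i; omega)
    have ht := tick_pos hN
    have hb := add_mul_tick_lt hN h1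
    have hb' := bend_le hN
    have hi0 : (0 : ℝ) ≤ i * tick N := by positivity
    have hp := Real.pi_gt_three
    have e : leafAngle N d i 2 - leafAngle N d i 3 = Real.pi / 3 + tick N / 2 := by
      simp only [leafAngle, OfNat.ofNat_ne_one, if_false, if_true, hf, Bool.false_eq_true,
        Nat.reduceEqDiff]
      ring
    have hc := Real.cos_lt_cos_of_nonneg_of_le_pi (x := Real.pi / 3)
      (y := leafAngle N d i 2 - leafAngle N d i 3) (by linarith) (by linarith) (by linarith)
    rw [Real.cos_pi_div_three, Real.cos_sub] at hc
    nlinarith [Real.sin_sq_add_cos_sq (leafAngle N d i 2),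
      Real.sin_sq_add_cos_sq (leafAngle N d i 3)]

theorem four_lt_sqDist_next (hN : 2 ≤ N) (hd : Admissible d) (h5 : ∀ i, d i ≤ 5) {i κ κ' : ℕ}
    (h : IsPlace N d (i, κ)) (h' : IsPlace N d (i + 1, κ')) (hne : κ ≠ 0 ∨ κ' ≠ 0) :
    4 < sqDist N d (i, κ) (i + 1, κ') := by
  rw [sqDist_comm]
  obtain ⟨h1, h2, h3⟩ := h
  obtain ⟨h1', h2', h3'⟩ := h'
  dsimp only at *
  have hp := Real.pi_gt_three
  have s1 := Real.sin_sq_add_cos_sq (dir N d (i + 1))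
  have b1 := neg_le_dir (d := d) hN h1'
  have b2 := dir_nonpos (d := d) hN (i + 1)
  have ys : |Real.sin (dir N d (i + 1))| ≤ 1 / 500 :=
    Real.abs_sin_le_abs.trans (abs_le.2 ⟨b1, by linarith⟩)
  rw [abs_le] at ys
  -- a spine vertex and a leaf of the next or of the preceding one
  have hQ : ∀ θ, Real.cos (θ - dir N d (i + 1)) < 1 / 2 →
      4 < (2 * Real.cos (dir N d (i + 1)) - 2 * Real.cos θ) ^ 2 +
        (2 * Real.sin (dir N d (i + 1)) - 2 * Real.sin θ) ^ 2 := by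
    intro θ hθ
    rw [Real.cos_sub] at hθ
    nlinarith [Real.sin_sq_add_cos_sq θ]
  have hQ' : ∀ θ, -(1 / 2) < Real.cos (θ - dir N d (i + 1)) →
      4 < (2 * Real.cos (dir N d (i + 1)) + 2 * Real.cos θ) ^ 2 +
        (2 * Real.sin (dir N d (i + 1)) + 2 * Real.sin θ) ^ 2 := by
    intro θ hθ
    rw [Real.cos_sub] at hθ
    nlinarith [Real.sin_sq_add_cos_sq θ]
  -- two leaves on the same side: project onto the spine edge between their neighbours
  have hP : ∀ θ θ', Real.cos (θ - dir N d (i + 1)) < Real.cos (θ' - dir N d (i + 1)) →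
      4 < (2 * Real.cos (dir N d (i + 1)) + 2 * Real.cos θ' - 2 * Real.cos θ) ^ 2 +
        (2 * Real.sin (dir N d (i + 1)) + 2 * Real.sin θ' - 2 * Real.sin θ) ^ 2 := by
    intro θ θ' hθ
    rw [Real.cos_sub, Real.cos_sub] at hθ
    refine four_lt_of_projection (φ := dir N d (i + 1)) ?_
    nlinarith
  have lo : ∀ j ≤ N, -(Real.pi / 2) ≤ leafAngle N d j 1 - dir N d (i + 1) ∧
      leafAngle N d j 1 - dir N d (i + 1) ≤ -(Real.pi / 2) + 3 / 1000 := by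
    intro j hj
    have := lower_angle_bounds (d := d) hN hj
    constructor <;> linarith
  rcases Nat.eq_zero_or_pos κ with rfl | hκ
  · have hκ' : κ' ≠ 0 := by omega
    have h3' := h3' hκ'
    simp only [sqDist, ptX, ptY, hκ', if_false, if_true, spineX, spineY]
    have := hQ' (leafAngle N d (i + 1) κ') ?_
    · convert this using 2 <;> ring
    rcases (by omega : κ' = 1 ∨ 2 ≤ κ') with rfl | hκ2
    · have := lo (i + 1) h1'
      have := Real.cos_nonneg_of_mem_Icc
        (x := leafAngle N d (i + 1) 1 - dir N d (i + 1)) ⟨by linarith, by linarith⟩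
      linarith
    · have hu := upper_angle_bounds hN hd h3'.1 hκ2 h2' h3'.2 (h5 _)
      have := neg_le_dir (d := d) hN (i := i + 2) (by omega)
      have c := Real.cos_lt_cos_of_nonneg_of_le_pi
        (x := leafAngle N d (i + 1) κ' - dir N d (i + 1)) (y := Real.pi - Real.pi / 3)
        (by linarith [hu.1]) (by linarith) (by linarith)
      rw [Real.cos_pi_sub, Real.cos_pi_div_three] at c
      exact c
  have hκ0 : κ ≠ 0 := by omega
  have h3 := h3 hκ0
  have up : 2 ≤ κ → Real.pi / 3 < leafAngle N d i κ - dir N d (i + 1) ∧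
      leafAngle N d i κ - dir N d (i + 1) < Real.pi := by
    intro hκ2
    have hu := upper_angle_bounds hN hd h3.1 hκ2 h2 h3.2 (h5 _)
    have := dir_nonpos (d := d) hN i
    constructor <;> linarith
  rcases Nat.eq_zero_or_pos κ' with rfl | hκ'
  · simp only [sqDist, ptX, ptY, hκ0, if_false, if_true, spineX, spineY]
    have := hQ (leafAngle N d i κ) ?_
    · convert this using 2 <;> ring
    rcases (by omega : κ = 1 ∨ 2 ≤ κ) with rfl | hκ2
    · have := lo i h1
      have c := abs_le.1 (Real.abs_cos_sub_cos_le (leafAngle N d i 1 - dir N d (i + 1))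
        (-(Real.pi / 2)))
      rw [Real.cos_neg, Real.cos_pi_div_two, abs_of_nonneg (by linarith)] at c
      linarith
    · have := up hκ2
      have c := Real.cos_lt_cos_of_nonneg_of_le_pi (x := Real.pi / 3)
        (y := leafAngle N d i κ - dir N d (i + 1)) (by linarith) (by linarith) (by linarith)
      rwa [Real.cos_pi_div_three] at c
  have hκ'0 : κ' ≠ 0 := by omega
  have h3' := h3' hκ'0
  simp only [sqDist, ptX, ptY, hκ0, hκ'0, if_false, spineX, spineY]
  rcases (by omega : κ = 1 ∨ 2 ≤ κ) with rfl | hκ2 <;>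
    rcases (by omega : κ' = 1 ∨ 2 ≤ κ') with rfl | hκ2'
  · have := hP (leafAngle N d i 1) (leafAngle N d (i + 1) 1) ?_
    · convert this using 2 <;> ring
    have l1 := lo i h1
    have l2 := lo (i + 1) h1'
    have ht := tick_pos hN
    rw [← Real.cos_neg, ← Real.cos_neg (leafAngle N d (i + 1) 1 - _)]
    refine Real.cos_lt_cos_of_nonneg_of_le_pi (by linarith) (by linarith) ?_
    simp only [leafAngle, if_true]
    push_cast
    linarith
  · have := lower_coords (d := d) hN h1
    have := upper_coords hN hd h3'.1 hκ2' h2' h3'.2 (h5 _)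
    exact four_lt_of_ordinate (by linarith)
  · have := lower_coords (d := d) hN h1'
    have := upper_coords hN hd h3.1 hκ2 h2 h3.2 (h5 _)
    rw [← neg_sq (_ - (spineY N d i + _))]
    exact four_lt_of_ordinate (by linarith)
  · have := hP (leafAngle N d i κ) (leafAngle N d (i + 1) κ') ?_
    · convert this using 2 <;> ring
    have hu := upper_angle_bounds hN hd h3'.1 hκ2' h2' h3'.2 (h5 _)
    have := neg_le_dir (d := d) hN (i := i + 2) (by omega)
    have hlt := upper_angle_lt hN hd h3'.1 hκ2 h2 h3.2 (h5 _) hκ2' h2' h3'.2 (h5 _)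
    exact Real.cos_lt_cos_of_nonneg_of_le_pi (by linarith [hu.1]) (up hκ2).2.le (by linarith)

theorem four_lt_sqDist_next_next (hN : 2 ≤ N) (hd : Admissible d) (h5 : ∀ i, d i ≤ 5)
    {i κ κ' : ℕ} (h : IsPlace N d (i, κ)) (h' : IsPlace N d (i + 2, κ')) :
    4 < sqDist N d (i, κ) (i + 2, κ') := by
  rw [sqDist_comm]
  have hsx := le_spineX_sub (d := d) hN i 2 h'.1
  push_cast at hsx
  have c := abs_cos_leafAngle_le hN hd h (h5 _)
  have c' := abs_cos_leafAngle_le hN hd h' (h5 _)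
  obtain ⟨h1, h2, h3⟩ := h
  obtain ⟨h1', h2', h3'⟩ := h'
  dsimp only at *
  have hp := Real.pi_gt_three
  simp only [sqDist, ptX, ptY]
  by_cases hκ0 : κ = 0
  · refine four_lt_of_abscissa ?_
    rw [if_pos hκ0]
    split_ifs with hκ'0
    · linarith
    · linarith [c' hκ'0]
  by_cases hκ'0 : κ' = 0
  · refine four_lt_of_abscissa ?_
    rw [if_pos hκ'0, if_neg hκ0]
    linarith [c hκ0]
  have c := c hκ0
  have c' := c' hκ'0
  have h3 := h3 hκ0
  have h3' := h3' hκ'0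
  simp only [hκ0, hκ'0, if_false]
  rcases (by omega : κ = 1 ∨ 2 ≤ κ) with rfl | hκ2
  · have := lower_coords (d := d) hN h1
    exact four_lt_of_abscissa (by linarith)
  rcases (by omega : κ' = 1 ∨ 2 ≤ κ') with rfl | hκ2'
  · have := lower_coords (d := d) hN h1'
    exact four_lt_of_abscissa (by linarith)
  have hu := upper_angle_bounds hN hd h3.1 hκ2 h2 h3.2 (h5 _)
  have hu' := upper_angle_bounds hN hd h3'.1 hκ2' h2' h3'.2 (h5 _)
  have n0 := dir_nonpos (d := d) hN i
  have n1 := neg_le_dir (d := d) hN (i := i + 3) (by omega)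
  have n2 := dir_nonpos (d := d) hN (i + 2)
  rcases le_or_gt (d (i + 1)) 3 with hd1 | hd1
  · -- the spine is straight in between, and both leaves lean away from the middle vertex
    have e : dir N d (i + 2) = dir N d (i + 1) := by
      rw [dir, if_neg (by omega)]
    have hc := Real.cos_lt_cos_of_nonneg_of_le_pi (x := Real.pi / 3)
      (y := leafAngle N d i κ - dir N d (i + 1)) (by linarith)
      (by linarith [neg_le_dir (d := d) hN (i := i + 1) (by omega)]) (by linarith)
    have hc' := Real.cos_lt_cos_of_nonneg_of_le_pi
      (x := leafAngle N d (i + 2) κ' - dir N d (i + 1)) (y := Real.pi - Real.pi / 3)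
      (by linarith [hu'.1]) (by linarith) (by linarith)
    rw [Real.cos_pi_sub, Real.cos_pi_div_three, Real.cos_sub] at hc'
    rw [Real.cos_pi_div_three, Real.cos_sub] at hc
    refine four_lt_of_projection (φ := dir N d (i + 1)) ?_
    rw [show spineX N d (i + 2) = spineX N d i + 2 * Real.cos (dir N d (i + 1))
        + 2 * Real.cos (dir N d (i + 2)) from rfl, e,
      show spineY N d (i + 2) = spineY N d i + 2 * Real.sin (dir N d (i + 1))
        + 2 * Real.sin (dir N d (i + 2)) from rfl, e]
    nlinarith [Real.sin_sq_add_cos_sq (dir N d (i + 1))]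
  · -- compare both directions with that of a leaf of the middle vertex
    have l1 := upper_angle_lt hN hd (i := i) (κ' := 2) (by omega) hκ2 h2 h3.2 (h5 _) le_rfl
      (by norm_num) (by omega) (h5 _)
    have l2 := upper_angle_lt hN hd (i := i + 1) (κ := 2) h3'.1 le_rfl (by norm_num) (by omega)
      (h5 _) hκ2' h2' h3'.2 (h5 _)
    have hc := Real.cos_le_cos_of_nonneg_of_le_pi (x := leafAngle N d (i + 2) κ')
      (y := leafAngle N d i κ) (by linarith [hu'.1]) (by linarith) (by linarith)
    exact four_lt_of_abscissa (by linarith)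

/-- Three spine edges are so long that the leaves at their ends cannot reach each other. -/
theorem four_lt_sqDist_far (hN : 2 ≤ N) (hd : Admissible d) (h5 : ∀ i, d i ≤ 5)
    {i m κ κ' : ℕ} (hm : 3 ≤ m) (h : IsPlace N d (i, κ)) (h' : IsPlace N d (i + m, κ')) :
    4 < sqDist N d (i, κ) (i + m, κ') := by
  rw [sqDist_comm]
  have hsx := le_spineX_sub (d := d) hN i m h'.1
  have hm' : (3 : ℝ) ≤ m := by exact_mod_cast hm
  have c := abs_cos_leafAngle_le hN hd h (h5 _)
  have c' := abs_cos_leafAngle_le hN hd h' (h5 _)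
  refine four_lt_of_abscissa ?_
  simp only [ptX]
  split_ifs with h1 h2 h2
  · linarith
  · linarith [c h2]
  · linarith [c' h1]
  · linarith [c h2, c' h1]

theorem sqDist_of_placeAdj {a b : ℕ × ℕ} (h : PlaceAdj a b) : sqDist N d a b = 4 := by
  have key : ∀ i, sqDist N d (i, 0) (i + 1, 0) = 4 := fun i => by
    simp only [sqDist, ptX, ptY, if_true, spineX, spineY]
    nlinarith [Real.sin_sq_add_cos_sq (dir N d (i + 1))]
  have key' : ∀ i κ, κ ≠ 0 → sqDist N d (i, 0) (i, κ) = 4 := fun i κ hκ => by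
    simp only [sqDist, ptX, ptY, if_true, hκ, if_false]
    nlinarith [Real.sin_sq_add_cos_sq (leafAngle N d i κ)]
  obtain ⟨i, κ⟩ := a
  obtain ⟨j, κ'⟩ := b
  rcases h with ⟨h1, h2, h | h⟩ | ⟨h1, ⟨h2, h3⟩ | ⟨h2, h3⟩⟩
  · dsimp only at *; subst h1 h2 h; exact key i
  · dsimp only at *; subst h1 h2 h; rw [sqDist_comm]; exact key j
  · dsimp only at *; subst h1 h2; exact key' i κ' h3
  · dsimp only at *; subst h1 h3; rw [sqDist_comm]; exact key' i κ h2

/-- In the placement, distinct places that are not adjacent are farther apart than two. -/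
theorem four_lt_sqDist (hN : 2 ≤ N) (hd : Admissible d) (h5 : ∀ i, d i ≤ 5) {a b : ℕ × ℕ}
    (ha : IsPlace N d a) (hb : IsPlace N d b) (hne : a ≠ b) (hadj : ¬ PlaceAdj a b) :
    4 < sqDist N d a b := by
  wlog hle : a.1 < b.1 ∨ (a.1 = b.1 ∧ a.2 < b.2) generalizing a b
  · rw [sqDist_comm]
    refine this hb ha hne.symm (fun h => hadj ?_) ?_
    · simp only [PlaceAdj] at *; omega
    · have : ¬ (a.1 = b.1 ∧ a.2 = b.2) := fun h => hne (Prod.ext h.1 h.2)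
      omega
  obtain ⟨i, κ⟩ := a
  obtain ⟨j, κ'⟩ := b
  simp only [PlaceAdj] at hadj
  dsimp only at *
  rcases hle with h | ⟨rfl, h⟩
  · obtain ⟨m, rfl⟩ := Nat.exists_eq_add_of_lt h
    match m with
    | 0 => exact four_lt_sqDist_next hN hd h5 ha hb (by omega)
    | 1 => exact four_lt_sqDist_next_next hN hd h5 ha hb
    | m + 2 => exact four_lt_sqDist_far (m := m + 2 + 1) hN hd h5 (by omega) ha hb
  · exact four_lt_sqDist_same hN hd h5 ha hb (by omega) h

end Placement

/-! ### Placing a caterpillar -/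

namespace Placement

variable {d : ℕ → ℕ}

theorem exists_five_of_armed {i : ℕ} (h : armed d i = true) :
    ∃ j < i, d j = 5 ∧ ∀ l, j < l → l < i → 3 < d l := by
  induction i with
  | zero => simp [armed] at h
  | succ i ih =>
    rw [armed] at h
    split_ifs at h with h5 h3
    · exact ⟨i, by omega, h5, fun l h1 h2 => by omega⟩
    · obtain ⟨j, hj, hj5, hl⟩ := ih h
      refine ⟨j, by omega, hj5, fun l h1 h2 => ?_⟩
      rcases Nat.lt_succ_iff_lt_or_eq.1 h2 with h2 | rfl
      · exact hl l h1 h2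
      · omega

theorem armed_of_five {i j : ℕ} (hij : i < j) (hi : d i = 5) (h : ∀ l, i < l → l < j → 3 < d l) :
    armed d j = true := by
  induction j with
  | zero => omega
  | succ j ih =>
    rw [armed]
    rcases Nat.lt_succ_iff_lt_or_eq.1 hij with hij | rfl
    · have := h j hij (by omega)
      rw [ih hij fun l h1 h2 => h l h1 (by omega), if_neg (by omega : ¬ d j ≤ 3)]
      simp
    · simp [hi]

/-- `Admissible` is the condition on degrees in the form in which it can be checked from left to
right. -/
theorem admissible_iff : Admissible d ↔
    ∀ i j, i < j → d i = 5 → d j = 5 → ∃ l, i < l ∧ l < j ∧ d l ≤ 3 := by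
  constructor
  · intro h i j hij hi hj
    by_contra hc
    push Not at hc
    have := armed_of_five hij hi hc
    rw [h j hj] at this
    exact Bool.false_ne_true this
  · intro h j hj
    by_contra hc
    obtain ⟨i, hij, hi, hl⟩ := exists_five_of_armed (Bool.eq_true_of_not_eq_false hc)
    obtain ⟨l, h1, h2, h3⟩ := h i j hij hi hj
    exact absurd (hl l h1 h2) (by omega)

theorem dist_eq_sqrt_sqDist (N : ℕ) (a b : ℕ × ℕ) :
    dist !₂[ptX N d a.1 a.2, ptY N d a.1 a.2] !₂[ptX N d b.1 b.2, ptY N d b.1 b.2] =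
      Real.sqrt (sqDist N d a b) := by
  rw [EuclideanSpace.dist_eq, Fin.sum_univ_two, Real.dist_eq, Real.dist_eq, sq_abs, sq_abs]
  rfl

/-- An assignment of places to the vertices of a graph that respects adjacency is a unit disk
contact representation. -/
theorem isUDCRepresentation_of_places {V : Type*} {G : SimpleGraph V} {N : ℕ} (hN : 2 ≤ N)
    (hd : Admissible d) (h5 : ∀ i, d i ≤ 5) {p : V → EuclideanSpace ℝ (Fin 2)}
    (a : V → ℕ × ℕ) (hp : ∀ x, p x = !₂[ptX N d (a x).1 (a x).2, ptY N d (a x).1 (a x).2])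
    (ha : ∀ x, IsPlace N d (a x)) (hinj : Function.Injective a)
    (hadj : ∀ x y, x ≠ y → (PlaceAdj (a x) (a y) ↔ G.Adj x y)) : IsUDCRepresentation G p := by
  rw [isUDCRepresentation_iff]
  intro x y hxy
  rw [hp, hp, dist_eq_sqrt_sqDist]
  have h2 : Real.sqrt 4 = 2 := by
    rw [show (4 : ℝ) = 2 ^ 2 by norm_num, Real.sqrt_sq (by norm_num)]
  by_cases h : G.Adj x y
  · rw [sqDist_of_placeAdj ((hadj x y hxy).2 h), h2]
    simp [h]
  · have h4 := four_lt_sqDist hN hd h5 (ha x) (ha y) (hinj.ne hxy) (mt (hadj x y hxy).1 h)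
    have := Real.sqrt_lt_sqrt (by norm_num) h4
    rw [h2] at this
    exact ⟨this.le, fun h' => absurd h' (not_le.2 this), fun h' => absurd h' h⟩

/-- The place that belongs to slot `s` of the spine vertex number `i`. The first two slots stand for
the spine neighbours, and belong to leaves only at the two ends of the spine. -/
def slotPlace (k i s : ℕ) : ℕ × ℕ :=
  if 2 ≤ s then (i + 1, s - 1)
  else if s = 1 then (if i = 0 ∧ 1 < k then (0, 0) else (i + 2, 0))
  else (0, 0)

end Placement

section

variable {V : Type*} [Fintype V] {G : SimpleGraph V} [DecidableRel G.Adj] {k : ℕ}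

/-- The degrees along the spine, which is extended by one leaf at either end. -/
def degSeq (v : InnerPath G k) (j : ℕ) : ℕ :=
  if h : 1 ≤ j ∧ j ≤ k then G.degree (v ⟨j - 1, by omega⟩) else 1

theorem degSeq_succ (v : InnerPath G k) (i : Fin k) : degSeq v (i.val + 1) = G.degree (v i) := by
  have : 1 ≤ i.val + 1 ∧ i.val + 1 ≤ k := by omega
  simp [degSeq, this]

/-- The number of neighbours that are not leaves. -/
def innerDegree (G : SimpleGraph V) [DecidableRel G.Adj] (x : V) : ℕ :=
  ((G.neighborFinset x).filter fun y => G.degree y ≠ 1).card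

/-- Sums over the neighbours on the spine. -/
theorem sum_inner_neighbors (v : InnerPath G k) (i : Fin k) (f : V → ℕ) :
    (∑ y ∈ G.neighborFinset (v i), if G.degree y ≠ 1 then f y else 0) =
      (if h : 0 < i.val then f (v ⟨i.val - 1, by omega⟩) else 0) +
        if h : i.val + 1 < k then f (v ⟨i.val + 1, h⟩) else 0 := by
  classical
  have e : ((G.neighborFinset (v i)).filter fun y => G.degree y ≠ 1) =
      ((Finset.univ : Finset (Fin k)).filter
        (fun j => j.val + 1 = i.val ∨ i.val + 1 = j.val)).image fun j => (v j : V) := by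
    ext y
    simp only [Finset.mem_filter, SimpleGraph.mem_neighborFinset, Finset.mem_image,
      Finset.mem_univ, true_and]
    constructor
    · rintro ⟨h1, h2⟩
      obtain ⟨j, rfl⟩ := exists_spine_eq v h2
      exact ⟨j, ((spine_adj_iff v i j).1 h1).symm, rfl⟩
    · rintro ⟨j, hj, rfl⟩
      exact ⟨(spine_adj_iff v i j).2 hj.symm, spine_degree_ne_one v j⟩
  rw [← Finset.sum_filter, e, Finset.sum_image fun a _ b _ h => spine_injective v h,
    Finset.filter_or, Finset.sum_union]
  · congr 1
    · split_ifs with h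
      · refine Finset.sum_eq_single_of_mem (a := (⟨i.val - 1, by omega⟩ : Fin k)) ?_ ?_
        · simp; omega
        · intro j hj hne
          simp only [Finset.mem_filter, Finset.mem_univ, true_and] at hj
          exact absurd (Fin.ext (by simp; omega)) hne
      · refine Finset.sum_eq_zero fun j hj => ?_
        simp only [Finset.mem_filter, Finset.mem_univ, true_and] at hj
        omega
    · split_ifs with h
      · refine Finset.sum_eq_single_of_mem (a := (⟨i.val + 1, h⟩ : Fin k)) ?_ ?_
        · simp
        · intro j hj hne
          simp only [Finset.mem_filter, Finset.mem_univ, true_and] at hj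
          exact absurd (Fin.ext (by simp; omega)) hne
      · refine Finset.sum_eq_zero fun j hj => ?_
        simp only [Finset.mem_filter, Finset.mem_univ, true_and] at hj
        have := j.2
        omega
  · rw [Finset.disjoint_filter]
    intro j _ h1 h2
    omega

theorem innerDegree_eq (v : InnerPath G k) (i : Fin k) :
    innerDegree G (v i) = (if 0 < i.val then 1 else 0) + (if i.val + 1 < k then 1 else 0) := by
  rw [innerDegree, Finset.card_filter, sum_inner_neighbors v i fun _ => 1]
  simp

theorem card_leaves_add_innerDegree (x : V) :
    ((G.neighborFinset x).filter fun y => G.degree y = 1).card + innerDegree G x = G.degree x := by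
  classical
  rw [innerDegree, ← SimpleGraph.card_neighborFinset_eq_degree]
  exact Finset.card_filter_add_card_filter_not _

theorem length_spine_le_card (v : InnerPath G k) : k ≤ Fintype.card V := by
  simpa using Fintype.card_le_of_injective _ (spine_injective v)

/-- An edge between two leaves is a connected component. -/
theorem eq_or_eq_of_adj_leaves (hG : G.Connected) {x y : V} (hx : G.degree x = 1)
    (hy : G.degree y = 1) (hxy : G.Adj x y) (z : V) : z = x ∨ z = y := by
  have key : ∀ a b, G.Walk a b → a = x ∨ a = y → b = x ∨ b = y := by
    intro a b w
    induction w with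
    | nil => exact id
    | cons hab _ ih =>
      rintro (rfl | rfl)
      · exact ih (Or.inr (eq_of_degree_eq_one hx hab hxy))
      · exact ih (Or.inl (eq_of_degree_eq_one hy hab hxy.symm))
  obtain ⟨w⟩ := hG.preconnected x z
  exact key x z w (Or.inl rfl)

theorem exists_spine_adj_of_leaf (hG : G.Connected) (v : InnerPath G k) (hk : 0 < k) {x : V}
    (hx : G.degree x = 1) : ∃ i, G.Adj (v i) x := by
  obtain ⟨y, hy⟩ := (G.degree_pos_iff_exists_adj x).1 (by omega)
  by_cases h1 : G.degree y = 1
  · exfalso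
    rcases eq_or_eq_of_adj_leaves hG hx h1 hy (v ⟨0, hk⟩) with h | h
    · exact spine_degree_ne_one v ⟨0, hk⟩ (h ▸ hx)
    · exact spine_degree_ne_one v ⟨0, hk⟩ (h ▸ h1)
  · obtain ⟨i, rfl⟩ := exists_spine_eq v h1
    exact ⟨i, hy.symm⟩

open Placement

/-- A distribution of slots to the leaves: the leaves at a spine vertex `c` get different slots from
the interval `[innerDegree G c, degree c)`. -/
def IsSlotting (v : InnerPath G k) (σ : V → ℕ) : Prop :=
  (∀ i x, G.degree x = 1 → G.Adj (v i) x → innerDegree G (v i) ≤ σ x ∧ σ x < G.degree (v i)) ∧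
    ∀ i x y, G.degree x = 1 → G.degree y = 1 → G.Adj (v i) x → G.Adj (v i) y → σ x = σ y → x = y

/-- A leaf in one of the first two slots is at an end of the extended spine. -/
theorem slotPlace_cases (v : InnerPath G k) {σ : V → ℕ} (hσ : IsSlotting v σ) {i : Fin k} {x : V}
    (hx : G.degree x = 1) (hi : G.Adj (v i) x) :
    (2 ≤ σ x ∧ slotPlace k i (σ x) = (i.val + 1, σ x - 1)) ∨
      (i.val = 0 ∧ slotPlace k i (σ x) = (0, 0) ∧ σ x + 1 = min k 2) ∨
      (i.val + 1 = k ∧ slotPlace k i (σ x) = (k + 1, 0) ∧ σ x = 1) := by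
  have h := (hσ.1 i x hx hi).1
  rw [innerDegree_eq] at h
  have hi := i.2
  unfold slotPlace
  split_ifs at * <;> simp <;> omega

/-- The placement at the places given by a slotting is a unit disk contact representation. -/
theorem isUDCRepresentation_of_slotting (hG : G.Connected) (v : InnerPath G k) (hk : 0 < k)
    (hd : Admissible (degSeq v)) (h5 : ∀ i, G.degree (v i) ≤ 5) {σ : V → ℕ}
    (hσ : IsSlotting v σ) {N : ℕ} (hN : Fintype.card V < N) {p : V → EuclideanSpace ℝ (Fin 2)}
    (hspine : ∀ i, p (v i) = !₂[ptX N (degSeq v) (i.val + 1) 0, ptY N (degSeq v) (i.val + 1) 0])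
    (hleaf : ∀ i x, G.degree x = 1 → G.Adj (v i) x →
      p x = !₂[ptX N (degSeq v) (slotPlace k i (σ x)).1 (slotPlace k i (σ x)).2,
        ptY N (degSeq v) (slotPlace k i (σ x)).1 (slotPlace k i (σ x)).2]) :
    IsUDCRepresentation G p := by
  have hkN : k < N := (length_spine_le_card v).trans_lt hN
  have ex : ∀ x : V, ∃ a : ℕ × ℕ, (∃ i, x = (v i : V) ∧ a = (i.val + 1, 0)) ∨
      (G.degree x = 1 ∧ ∃ i, G.Adj (v i) x ∧ a = slotPlace k i (σ x)) := by
    intro x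
    by_cases hx : G.degree x = 1
    · obtain ⟨i, hi⟩ := exists_spine_adj_of_leaf hG v hk hx
      exact ⟨_, Or.inr ⟨hx, i, hi, rfl⟩⟩
    · obtain ⟨i, rfl⟩ := exists_spine_eq v hx
      exact ⟨_, Or.inl ⟨i, rfl, rfl⟩⟩
  choose a ha using ex
  have hleafadj : ∀ i j x, G.degree x = 1 → G.Adj (v i) x → G.Adj (v j) x → i = j :=
    fun i j x hx h1 h2 => spine_injective v (eq_of_degree_eq_one hx h1.symm h2.symm)
  have hll : ∀ i j x y, G.degree x = 1 → G.degree y = 1 → G.Adj (v i) x → G.Adj (v j) y →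
      ¬ G.Adj x y := by
    intro i j x y hx hy hi hj h
    have := eq_of_degree_eq_one hx hi.symm h
    exact spine_degree_ne_one v i (this ▸ hy)
  refine isUDCRepresentation_of_places (by omega) hd (d := degSeq v) (N := N) ?_ a ?_ ?_ ?_ ?_
  · intro i
    unfold degSeq
    split_ifs
    · exact h5 _
    · norm_num
  · intro x
    rcases ha x with ⟨i, rfl, h⟩ | ⟨hx, i, hi, h⟩
    · rw [h, hspine]
    · rw [h, hleaf i x hx hi]
  · intro x
    rcases ha x with ⟨i, rfl, h⟩ | ⟨hx, i, hi, h⟩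
    · rw [h]
      exact ⟨by dsimp only; omega, by simp, fun h => absurd rfl h⟩
    · rw [h]
      have h1 := (hσ.1 i x hx hi).2
      have h2 := h5 i
      have h3 := i.2
      rcases slotPlace_cases v hσ hx hi with ⟨h4, e⟩ | ⟨-, e, -⟩ | ⟨-, e, -⟩
      · rw [e]
        refine ⟨by dsimp only; omega, by dsimp only; omega, fun _ => ⟨by dsimp only; omega, ?_⟩⟩
        dsimp only
        rw [degSeq_succ]
        omega
      · rw [e]; exact ⟨by simp, by simp, fun h => absurd rfl h⟩
      · rw [e]; exact ⟨by dsimp only; omega, by simp, fun h => absurd rfl h⟩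
  · intro x y hxy
    rcases ha x with ⟨i, rfl, h⟩ | ⟨hx, i, hi, h⟩ <;>
      rcases ha y with ⟨j, rfl, h'⟩ | ⟨hy, j, hj, h'⟩
    · rw [h, h', Prod.mk.injEq] at hxy
      rw [show i = j from Fin.ext (by omega)]
    · exfalso
      rw [h, h'] at hxy
      have h3 := i.2
      rcases slotPlace_cases v hσ hy hj with ⟨h4, e⟩ | ⟨-, e, -⟩ | ⟨-, e, -⟩ <;>
      · rw [e, Prod.mk.injEq] at hxy
        omega
    · exfalso
      rw [h, h'] at hxy
      have h3 := j.2
      rcases slotPlace_cases v hσ hx hi with ⟨h4, e⟩ | ⟨-, e, -⟩ | ⟨-, e, -⟩ <;>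
      · rw [e, Prod.mk.injEq] at hxy
        omega
    · rw [h, h'] at hxy
      have h3 := i.2
      have h4 := j.2
      have : i.val = j.val ∧ σ x = σ y := by
        rcases slotPlace_cases v hσ hx hi with ⟨_, e⟩ | ⟨_, e, _⟩ | ⟨_, e, _⟩ <;>
          rcases slotPlace_cases v hσ hy hj with ⟨_, e'⟩ | ⟨_, e', _⟩ | ⟨_, e', _⟩ <;>
          rw [e, e', Prod.mk.injEq] at hxy <;> omega
      obtain rfl : i = j := Fin.ext this.1
      exact hσ.2 i x y hx hy hi hj this.2
  · have mixed : ∀ i y, G.degree y = 1 → ∀ j, G.Adj (v j) y →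
        (PlaceAdj (i.val + 1, 0) (slotPlace k j (σ y)) ↔ G.Adj (v i) y) := by
      intro i y hy j hj
      have e : G.Adj (v i) y ↔ i.val = j.val :=
        ⟨fun h => by rw [hleafadj i j y hy h hj], fun h => by rwa [Fin.ext h]⟩
      rw [e]
      have h3 := i.2
      rcases slotPlace_cases v hσ hy hj with ⟨_, e⟩ | ⟨_, e, _⟩ | ⟨_, e, _⟩ <;>
      · rw [e]; unfold PlaceAdj; dsimp only; omega
    have symm : ∀ a b : ℕ × ℕ, PlaceAdj a b ↔ PlaceAdj b a := by
      intro a b; simp only [PlaceAdj]; omega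
    intro x y hxy
    rcases ha x with ⟨i, rfl, h⟩ | ⟨hx, i, hi, h⟩ <;>
      rcases ha y with ⟨j, rfl, h'⟩ | ⟨hy, j, hj, h'⟩
    · rw [h, h', spine_adj_iff]
      unfold PlaceAdj
      dsimp only
      omega
    · rw [h, h']
      exact mixed i y hy j hj
    · rw [h, h', symm, G.adj_comm]
      exact mixed j x hx i hi
    · rw [h, h', iff_false_right (hll i j x y hx hy hi hj)]
      have h3 := i.2
      have h4 := j.2
      rcases slotPlace_cases v hσ hx hi with ⟨_, e⟩ | ⟨_, e, _⟩ | ⟨_, e, _⟩ <;>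
        rcases slotPlace_cases v hσ hy hj with ⟨_, e'⟩ | ⟨_, e', _⟩ | ⟨_, e', _⟩ <;>
        rw [e, e'] <;> simp only [PlaceAdj] <;> omega

theorem exists_slotting (v : InnerPath G k) : ∃ σ : V → ℕ, IsSlotting v σ := by
  classical
  let r := Fintype.equivFin V
  let before : V → V → Finset V := fun c x =>
    (G.neighborFinset c).filter fun y => G.degree y = 1 ∧ r y < r x
  -- count the leaves that come earlier in some enumeration
  let σ : V → ℕ := fun x => ∑ c ∈ G.neighborFinset x, (innerDegree G c + (before c x).card)
  have hσ : ∀ i x, G.degree x = 1 → G.Adj (v i) x →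
      σ x = innerDegree G (v i) + (before (v i) x).card := by
    intro i x hx hi
    have : G.neighborFinset x = {(v i : V)} := by
      ext c
      simp only [SimpleGraph.mem_neighborFinset, Finset.mem_singleton]
      exact ⟨fun h => eq_of_degree_eq_one hx h hi.symm, fun h => h ▸ hi.symm⟩
    simp [σ, this]
  have hlt : ∀ c x y, G.degree x = 1 → G.Adj c x → r x < r y →
      (before c x).card < (before c y).card := by
    intro c x y hx hc hxy
    refine Finset.card_lt_card ?_
    rw [Finset.ssubset_iff_of_subset
      (fun z => by simp [before]; intros; exact ⟨‹_›, ‹_›, lt_trans ‹_› hxy⟩)]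
    exact ⟨x, by simp [before, hx, hc, hxy], by simp [before]⟩
  refine ⟨σ, fun i x hx hi => ?_, fun i x y hx hy hi hj he => ?_⟩
  · rw [hσ i x hx hi, ← card_leaves_add_innerDegree (v i : V)]
    refine ⟨by omega, ?_⟩
    rw [add_comm]
    refine Nat.add_lt_add_right (Finset.card_lt_card ?_) _
    rw [Finset.ssubset_iff_of_subset (fun z => by simp [before]; intros; exact ⟨‹_›, ‹_›⟩)]
    exact ⟨x, by simp [hx, hi], by simp [before]⟩
  · rw [hσ i x hx hi, hσ i y hy hj] at he
    rcases lt_trichotomy (r x) (r y) with h | h | h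
    · have := hlt (v i) x y hx hi h
      omega
    · exact r.injective h
    · have := hlt (v i) y x hy hj h
      omega

/-! ### The characterization by degrees -/

theorem adj_of_spine_empty (hG : G.Connected) (v : InnerPath G 0) {x y : V} (hxy : x ≠ y) :
    G.Adj x y := by
  have hdeg : ∀ z, G.degree z = 1 := fun z => by
    by_contra h
    exact (exists_spine_eq v h).elim fun i _ => i.elim0
  obtain ⟨b, hb⟩ := (G.degree_pos_iff_exists_adj x).1 (by rw [hdeg]; exact one_pos)
  rcases eq_or_eq_of_adj_leaves hG (hdeg x) (hdeg b) hb y with h | h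
  · exact absurd h.symm hxy
  · exact h ▸ hb

theorem isUDCRepresentation_of_adj {V : Type*} {G : SimpleGraph V}
    {p : V → EuclideanSpace ℝ (Fin 2)} (h : ∀ x y, x ≠ y → G.Adj x y ∧ dist (p x) (p y) = 2) :
    IsUDCRepresentation G p := by
  rw [isUDCRepresentation_iff]
  intro x y hxy
  simp [(h x y hxy).2, (h x y hxy).1]

/-- The condition on the degrees along the spine that characterizes unit disk contact graphs. -/
def SpineCondition (v : InnerPath G k) : Prop :=
  (∀ i, G.degree (v i) ≤ 5) ∧ ∀ i j, i < j → G.degree (v i) = 5 → G.degree (v j) = 5 →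
    ∃ l, i < l ∧ l < j ∧ G.degree (v l) ≤ 3

theorem SpineCondition.of_isUDCGraph (v : InnerPath G k) (h : IsUDCGraph G) :
    SpineCondition v := by
  obtain ⟨p, hp⟩ := h
  have hq := hp.isUnitRealization
  exact ⟨fun i => degree_le_five hq fun _ _ => not_adj_of_adj_spine v,
    fun i j hij hi hj => exists_degree_le_three_between hq hij hi.ge hj.ge⟩

theorem SpineCondition.admissible {v : InnerPath G k} (h : SpineCondition v) :
    Admissible (degSeq v) := by
  rw [admissible_iff]
  intro i j hij hi hj
  have pos : ∀ i, degSeq v i = 5 → ∃ a : Fin k, i = a.val + 1 := by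
    intro i hi
    unfold degSeq at hi
    split_ifs at hi with h'
    · exact ⟨⟨i - 1, by omega⟩, by simp; omega⟩
    · omega
  obtain ⟨a, rfl⟩ := pos i hi
  obtain ⟨b, rfl⟩ := pos j hj
  rw [degSeq_succ] at hi hj
  obtain ⟨l, h1, h2, h3⟩ := h.2 a b (Fin.lt_def.2 (by omega)) hi hj
  rw [Fin.lt_def] at h1 h2
  exact ⟨l.val + 1, by omega, by omega, by rwa [degSeq_succ]⟩

theorem spineCondition_iff_admissible {v : InnerPath G k} :
    SpineCondition v ↔ (∀ i, G.degree (v i) ≤ 5) ∧ Admissible (degSeq v) := by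
  refine ⟨fun h => ⟨h.1, h.admissible⟩, fun h => ⟨h.1, fun i j hij hi hj => ?_⟩⟩
  rw [Fin.lt_def] at hij
  obtain ⟨l, h1, h2, h3⟩ := admissible_iff.1 h.2 (i.val + 1) (j.val + 1) (by omega)
    (by rwa [degSeq_succ]) (by rwa [degSeq_succ])
  refine ⟨⟨l - 1, by omega⟩, Fin.lt_def.2 (by simp; omega), Fin.lt_def.2 (by simp; omega), ?_⟩
  rw [← degSeq_succ]
  rwa [show l - 1 + 1 = l by omega]

theorem SpineCondition.isUDCGraph (hG : G.Connected) {v : InnerPath G k}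
    (h : SpineCondition v) : IsUDCGraph G := by
  classical
  rcases Nat.eq_zero_or_pos k with rfl | hk
  · obtain ⟨x⟩ := hG.nonempty
    refine ⟨fun y => if y = x then !₂[0, 0] else !₂[2, 0], isUDCRepresentation_of_adj ?_⟩
    have hdeg : ∀ z, G.degree z = 1 := fun z => by
      by_contra h
      exact (exists_spine_eq v h).elim fun i _ => i.elim0
    have h2 : dist !₂[(0 : ℝ), 0] !₂[(2 : ℝ), 0] = 2 := by
      simp [EuclideanSpace.dist_eq]
    intro y z hyz
    refine ⟨adj_of_spine_empty hG v hyz, ?_⟩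
    by_cases hy : y = x
    · subst hy
      simp [hyz.symm, h2]
    · have hz : z = x := by
        by_contra hz
        refine hyz (eq_of_degree_eq_one (hdeg x) ?_ ?_)
        · exact adj_of_spine_empty hG v (Ne.symm hy)
        · exact adj_of_spine_empty hG v (Ne.symm hz)
      simp [hy, hz, dist_comm, h2]
  · obtain ⟨σ, hσ⟩ := exists_slotting v
    let N := Fintype.card V + 1
    let pt : ℕ × ℕ → EuclideanSpace ℝ (Fin 2) := fun a =>
      !₂[ptX N (degSeq v) a.1 a.2, ptY N (degSeq v) a.1 a.2]
    have ex : ∀ x : V, ∃ y, (∀ i, x = v i → y = pt (i.val + 1, 0)) ∧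
        ∀ i, G.degree x = 1 → G.Adj (v i) x → y = pt (slotPlace k i (σ x)) := by
      intro x
      by_cases hx : G.degree x = 1
      · obtain ⟨i, hi⟩ := exists_spine_adj_of_leaf hG v hk hx
        refine ⟨pt (slotPlace k i (σ x)), fun j hj => ?_, fun j _ hj => ?_⟩
        · exact absurd (hj ▸ hx) (spine_degree_ne_one v j)
        · rw [spine_injective v (eq_of_degree_eq_one hx hj.symm hi.symm)]
      · obtain ⟨i, rfl⟩ := exists_spine_eq v hx
        refine ⟨pt (i.val + 1, 0), fun j hj => ?_, fun j h' _ => absurd h' hx⟩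
        rw [spine_injective v hj]
    choose p hp1 hp2 using ex
    exact ⟨p, isUDCRepresentation_of_slotting hG v hk h.admissible h.1 hσ
      (Nat.lt_succ_self _) (fun i => hp1 _ i rfl) (fun i x hx hi => hp2 x i hx hi)⟩

theorem isUDCGraph_iff_spineCondition (hG : G.Connected) (v : InnerPath G k) :
    IsUDCGraph G ↔ SpineCondition v :=
  ⟨SpineCondition.of_isUDCGraph v, SpineCondition.isUDCGraph hG⟩

theorem isUDCGraph_of_maxDegree_le_four (hG : IsCaterpillar G) (h : G.maxDegree ≤ 4) :
    IsUDCGraph G := by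
  obtain ⟨hT, k, ⟨v⟩⟩ := hG
  refine SpineCondition.isUDCGraph hT.connected (v := v) ⟨fun i => ?_, fun i j _ hi => ?_⟩
  · have := G.degree_le_maxDegree (v i)
    omega
  · have := G.degree_le_maxDegree (v i)
    omega

theorem not_isUDCGraph_of_six_le_maxDegree (hG : IsCaterpillar G) (h : 6 ≤ G.maxDegree) :
    ¬ IsUDCGraph G := by
  obtain ⟨hT, k, ⟨v⟩⟩ := hG
  have := hT.connected.nonempty
  obtain ⟨x, hx⟩ := G.exists_maximal_degree_vertex
  intro hU
  obtain ⟨i, rfl⟩ := exists_spine_eq v (x := x) (by omega)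
  have := (SpineCondition.of_isUDCGraph v hU).1 i
  omega

theorem isUDCGraph_iff_of_maxDegree_eq_five (hG : IsCaterpillar G) (h : G.maxDegree = 5)
    (v : InnerPath G k) :
    IsUDCGraph G ↔ ∀ i j : Fin k, i < j → G.degree (v i) = 5 → G.degree (v j) = 5 →
      ∃ l : Fin k, i < l ∧ l < j ∧ G.degree (v l) ≤ 3 := by
  rw [isUDCGraph_iff_spineCondition hG.1.connected v]
  exact ⟨fun h => h.2, fun h' => ⟨fun i => h ▸ G.degree_le_maxDegree (v i), h'⟩⟩

end

/-! ### Verification of programs -/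

namespace RealRAM

section StateLemmas

variable (s : State) (x y a i k b j : ℕ) (r : ℝ)

@[simp] theorem State.setReg_reg : (s.setReg x k).reg y = if y = x then k else s.reg y := by
  simp [State.setReg, Function.update_apply]

@[simp] theorem State.setReg_mem : (s.setReg x k).mem = s.mem := rfl

@[simp] theorem State.setReg_rreg : (s.setReg x k).rreg = s.rreg := rfl

@[simp] theorem State.setReg_rmem : (s.setReg x k).rmem = s.rmem := rfl

@[simp] theorem State.setMem_reg : (s.setMem a i k).reg = s.reg := rfl

@[simp] theorem State.setMem_mem :
    (s.setMem a i k).mem b j = if b = a ∧ j = i then k else s.mem b j := by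
  by_cases h : b = a
  · subst h
    simp [State.setMem, Function.update_apply]
  · simp [State.setMem, h]

@[simp] theorem State.setMem_rreg : (s.setMem a i k).rreg = s.rreg := rfl

@[simp] theorem State.setMem_rmem : (s.setMem a i k).rmem = s.rmem := rfl

@[simp] theorem State.setRReg_reg : (s.setRReg x r).reg = s.reg := rfl

@[simp] theorem State.setRReg_mem : (s.setRReg x r).mem = s.mem := rfl

@[simp] theorem State.setRReg_rreg : (s.setRReg x r).rreg y = if y = x then r else s.rreg y := by
  simp [State.setRReg, Function.update_apply]

@[simp] theorem State.setRReg_rmem : (s.setRReg x r).rmem = s.rmem := rfl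

@[simp] theorem State.setRMem_reg : (s.setRMem a i r).reg = s.reg := rfl

@[simp] theorem State.setRMem_mem : (s.setRMem a i r).mem = s.mem := rfl

@[simp] theorem State.setRMem_rreg : (s.setRMem a i r).rreg = s.rreg := rfl

@[simp] theorem State.setRMem_rmem :
    (s.setRMem a i r).rmem b j = if b = a ∧ j = i then r else s.rmem b j := by
  by_cases h : b = a
  · subst h
    simp [State.setRMem, Function.update_apply]
  · simp [State.setRMem, h]

end StateLemmas

/-- With word bound `w`, the program `p` started in `s` halts within `T` steps in a state that
satisfies `Q`. -/
def Runs (w : ℕ) (p : Prog) (s : State) (T : ℕ) (Q : State → Prop) : Prop :=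
  ∃ (s' : State) (t : ℕ), Exec w p s s' t ∧ t ≤ T ∧ Q s'

theorem Runs.mono {w : ℕ} {p : Prog} {s : State} {T T' : ℕ} {Q Q' : State → Prop}
    (h : Runs w p s T Q) (hT : T ≤ T') (hQ : ∀ s, Q s → Q' s) : Runs w p s T' Q' := by
  obtain ⟨s', t, h1, h2, h3⟩ := h
  exact ⟨s', t, h1, h2.trans hT, hQ _ h3⟩

theorem Runs.seq {w : ℕ} {p q : Prog} {s : State} {T T' : ℕ} {Q R : State → Prop}
    (h : Runs w p s T R) (h' : ∀ s, R s → Runs w q s T' Q) :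
    Runs w (.seq p q) s (T + T') Q := by
  obtain ⟨s₁, t₁, h1, h2, h3⟩ := h
  obtain ⟨s₂, t₂, h4, h5, h6⟩ := h' _ h3
  exact ⟨s₂, t₁ + t₂, .seq _ _ _ _ _ _ _ h1 h4, by omega, h6⟩

theorem Runs.ite {w : ℕ} {b : Test} {p q : Prog} {s : State} {T : ℕ} {Q : State → Prop}
    (h : b.Holds s → Runs w p s T Q) (h' : ¬ b.Holds s → Runs w q s T Q) :
    Runs w (.ite b p q) s (T + 1) Q := by
  by_cases hb : b.Holds s
  · obtain ⟨s', t, h1, h2, h3⟩ := h hb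
    exact ⟨s', t + 1, .iteTrue _ _ _ _ _ _ hb h1, by omega, h3⟩
  · obtain ⟨s', t, h1, h2, h3⟩ := h' hb
    exact ⟨s', t + 1, .iteFalse _ _ _ _ _ _ hb h1, by omega, h3⟩

/-- A loop that counts register `x` up to the content `M` of register `y`. -/
theorem Runs.forLoop {w : ℕ} {p : Prog} {x y M B : ℕ} (I : ℕ → State → Prop)
    (hI : ∀ i s, I i s → s.reg x = i ∧ s.reg y = M)
    (hp : ∀ i < M, ∀ s, I i s → Runs w p s B (I (i + 1))) {s : State} (h0 : I 0 s) :
    Runs w (.loop (.lt x y) p) s (M * (B + 1) + 1) (I M) := by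
  suffices ∀ m i, i + m = M → ∀ s, I i s →
      Runs w (.loop (.lt x y) p) s (m * (B + 1) + 1) (I M) from this M 0 (zero_add M) s h0
  intro m
  induction m with
  | zero =>
    intro i hi s hs
    obtain ⟨h1, h2⟩ := hI i s hs
    obtain rfl : i = M := hi
    exact ⟨s, 1, .loopFalse _ _ _ (by simp [Test.Holds, h1, h2]), by omega, hs⟩
  | succ m ih =>
    intro i hi s hs
    obtain ⟨h1, h2⟩ := hI i s hs
    obtain ⟨s₁, t₁, e1, l1, hs₁⟩ := hp i (by omega) s hs
    obtain ⟨s₂, t₂, e2, l2, hs₂⟩ := ih (i + 1) (by omega) s₁ hs₁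
    refine ⟨s₂, t₁ + t₂ + 1, .loopTrue _ _ _ _ _ _ _ ?_ e1 e2, ?_, hs₂⟩
    · simp only [Test.Holds, h1, h2]; omega
    · rw [Nat.succ_mul]; omega

/-- Sequential composition of a list of programs. -/
def Prog.ofList : List Prog → Prog
  | [] => .skip
  | p :: l => .seq p (ofList l)

/-- A list of instructions as a program. -/
def Prog.block (l : List Instr) : Prog := .ofList (l.map .instr)

/-- A bound for the running time of a program without loops. -/
def Prog.cost : Prog → ℕ
  | .skip => 1
  | .instr _ => 1
  | .seq p q => p.cost + q.cost
  | .ite _ p q => p.cost + q.cost + 1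
  | .loop _ _ => 0

/-- Weakest precondition of a program without loops. -/
def wp (w : ℕ) : Prog → (State → Prop) → State → Prop
  | .skip, Q, s => Q s
  | .instr i, Q, s => ∃ s', i.exec w s = some s' ∧ Q s'
  | .seq p q, Q, s => wp w p (wp w q Q) s
  | .ite b p q, Q, s => (b.Holds s → wp w p Q s) ∧ (¬ b.Holds s → wp w q Q s)
  | .loop _ _, _, _ => False

theorem runs_of_wp {w : ℕ} {p : Prog} {Q : State → Prop} {s : State} (h : wp w p Q s) :
    Runs w p s p.cost Q := by
  induction p generalizing Q s with
  | skip => exact ⟨s, 1, .skip s, le_rfl, h⟩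
  | instr i =>
    obtain ⟨s', h1, h2⟩ := h
    exact ⟨s', 1, .instr i s s' h1, le_rfl, h2⟩
  | seq p q ihp ihq => exact (ihp h).seq fun s hs => ihq hs
  | ite b p q ihp ihq =>
    exact Runs.ite (fun hb => (ihp (h.1 hb)).mono (by omega) fun _ => id)
      (fun hb => (ihq (h.2 hb)).mono (by omega) fun _ => id)
  | loop b p => exact h.elim

theorem wp_mono {w : ℕ} {p : Prog} {Q Q' : State → Prop} {s : State} (h : wp w p Q s)
    (hQ : ∀ s, Q s → Q' s) : wp w p Q' s := by
  induction p generalizing Q Q' s with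
  | skip => exact hQ _ h
  | instr i =>
    obtain ⟨s', h1, h2⟩ := h
    exact ⟨s', h1, hQ _ h2⟩
  | seq p q ihp ihq => exact ihp h fun s hs => ihq hs hQ
  | ite b p q ihp ihq => exact ⟨fun hb => ihp (h.1 hb) hQ, fun hb => ihq (h.2 hb) hQ⟩
  | loop b p => exact h.elim

theorem Runs.nil {w : ℕ} {s : State} {Q : State → Prop} (h : Q s) : Runs w (.ofList []) s 1 Q :=
  ⟨s, 1, .skip s, le_rfl, h⟩

theorem Runs.cons {w : ℕ} {p : Prog} {l : List Prog} {s : State} {T T' : ℕ}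
    {Q R : State → Prop} (h : Runs w p s T R) (h' : ∀ s, R s → Runs w (.ofList l) s T' Q) :
    Runs w (.ofList (p :: l)) s (T + T') Q :=
  h.seq h'

section WpLemmas

variable (w : ℕ) (Q : State → Prop) (s : State) (x y z a i k : ℕ)

@[simp] theorem wp_skip : wp w .skip Q s ↔ Q s := Iff.rfl

@[simp] theorem wp_nil : wp w (.ofList []) Q s ↔ Q s := Iff.rfl

@[simp] theorem wp_cons (p : Prog) (l : List Prog) :
    wp w (.ofList (p :: l)) Q s ↔ wp w p (wp w (.ofList l) Q) s := Iff.rfl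

@[simp] theorem wp_block_nil : wp w (.block []) Q s ↔ Q s := Iff.rfl

@[simp] theorem wp_block_cons (c : Instr) (l : List Instr) :
    wp w (.block (c :: l)) Q s ↔ wp w (.instr c) (wp w (.block l) Q) s := Iff.rfl

@[simp] theorem wp_ite (b : Test) (p q : Prog) :
    wp w (.ite b p q) Q s ↔ (b.Holds s → wp w p Q s) ∧ (¬ b.Holds s → wp w q Q s) := Iff.rfl

@[simp] theorem wp_const : wp w (.instr (.const x k)) Q s ↔ Q (s.setReg x k) := by
  simp [wp, Instr.exec]

@[simp] theorem wp_copy : wp w (.instr (.copy x y)) Q s ↔ Q (s.setReg x (s.reg y)) := by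
  simp [wp, Instr.exec]

@[simp] theorem wp_add : wp w (.instr (.add x y z)) Q s ↔
    s.reg y + s.reg z ≤ w ∧ Q (s.setReg x (s.reg y + s.reg z)) := by
  simp [wp, Instr.exec]

@[simp] theorem wp_sub : wp w (.instr (.sub x y z)) Q s ↔
    Q (s.setReg x (s.reg y - s.reg z)) := by
  simp [wp, Instr.exec]

@[simp] theorem wp_load : wp w (.instr (.load x a i)) Q s ↔
    Q (s.setReg x (s.mem a (s.reg i))) := by
  simp [wp, Instr.exec]

@[simp] theorem wp_store : wp w (.instr (.store a i x)) Q s ↔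
    Q (s.setMem a (s.reg i) (s.reg x)) := by
  simp [wp, Instr.exec]

@[simp] theorem wp_rconst (q : ℚ) : wp w (.instr (.rconst x q)) Q s ↔ Q (s.setRReg x q) := by
  simp [wp, Instr.exec]

@[simp] theorem wp_rofNat : wp w (.instr (.rofNat x y)) Q s ↔ Q (s.setRReg x (s.reg y)) := by
  simp [wp, Instr.exec]

@[simp] theorem wp_rcopy : wp w (.instr (.rcopy x y)) Q s ↔ Q (s.setRReg x (s.rreg y)) := by
  simp [wp, Instr.exec]

@[simp] theorem wp_radd : wp w (.instr (.radd x y z)) Q s ↔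
    Q (s.setRReg x (s.rreg y + s.rreg z)) := by
  simp [wp, Instr.exec]

@[simp] theorem wp_rsub : wp w (.instr (.rsub x y z)) Q s ↔
    Q (s.setRReg x (s.rreg y - s.rreg z)) := by
  simp [wp, Instr.exec]

@[simp] theorem wp_rmul : wp w (.instr (.rmul x y z)) Q s ↔
    Q (s.setRReg x (s.rreg y * s.rreg z)) := by
  simp [wp, Instr.exec]

@[simp] theorem wp_rdiv : wp w (.instr (.rdiv x y z)) Q s ↔
    s.rreg z ≠ 0 ∧ Q (s.setRReg x (s.rreg y / s.rreg z)) := by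
  simp [wp, Instr.exec]

@[simp] theorem wp_rsqrt : wp w (.instr (.rsqrt x y)) Q s ↔
    0 ≤ s.rreg y ∧ Q (s.setRReg x (Real.sqrt (s.rreg y))) := by
  simp [wp, Instr.exec]

@[simp] theorem wp_rsin : wp w (.instr (.rsin x y)) Q s ↔
    Q (s.setRReg x (Real.sin (s.rreg y))) := by
  simp [wp, Instr.exec]

@[simp] theorem wp_rcos : wp w (.instr (.rcos x y)) Q s ↔
    Q (s.setRReg x (Real.cos (s.rreg y))) := by
  simp [wp, Instr.exec]

@[simp] theorem wp_rload : wp w (.instr (.rload x a i)) Q s ↔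
    Q (s.setRReg x (s.rmem a (s.reg i))) := by
  simp [wp, Instr.exec]

@[simp] theorem wp_rstore : wp w (.instr (.rstore a i x)) Q s ↔
    Q (s.setRMem a (s.reg i) (s.rreg x)) := by
  simp [wp, Instr.exec]

@[simp] theorem holds_lt : (Test.lt x y).Holds s ↔ s.reg x < s.reg y := Iff.rfl

@[simp] theorem holds_eq : (Test.eq x y).Holds s ↔ s.reg x = s.reg y := Iff.rfl

end WpLemmas

/-! ### Sums over an edge list -/

/-- The sum of `f` over the neighbours of `x`, according to the list `E` of edges. -/
def edgeSum {n : ℕ} (f : Fin n → ℕ) (E : List (Fin n × Fin n)) (x : Fin n) : ℕ :=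
  (E.map fun e => (if e.1 = x then f e.2 else 0) + if e.2 = x then f e.1 else 0).sum

section EdgeSum

variable {n : ℕ} {G : SimpleGraph (Fin n)} {E : List (Fin n × Fin n)}

theorem IsEdgeList.adj (hE : IsEdgeList G E) {e : Fin n × Fin n} (he : e ∈ E) :
    G.Adj e.1 e.2 :=
  (hE.2 _ _).2 (List.mem_map.2 ⟨e, he, rfl⟩)

theorem edgeSum_take_succ (f : Fin n → ℕ) (x : Fin n) {i : ℕ} (hi : i < E.length) :
    edgeSum f (E.take (i + 1)) x = edgeSum f (E.take i) x +
      ((if E[i].1 = x then f E[i].2 else 0) + if E[i].2 = x then f E[i].1 else 0) := by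
  rw [edgeSum, edgeSum, List.take_add_one, List.getElem?_eq_getElem hi, List.map_append,
    List.sum_append]
  simp only [Option.toList_some, List.map_cons, List.map_nil, List.sum_cons, List.sum_nil,
    add_zero]

theorem edgeSum_take_le (f : Fin n → ℕ) (x : Fin n) (i : ℕ) :
    edgeSum f (E.take i) x ≤ edgeSum f E x := by
  conv_rhs => rw [← List.take_append_drop i E]
  rw [edgeSum, edgeSum, List.map_append, List.sum_append]
  exact Nat.le_add_right _ _

variable [DecidableRel G.Adj]

theorem edgeSum_eq (hE : IsEdgeList G E) (f : Fin n → ℕ) (x : Fin n) :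
    edgeSum f E x = ∑ y ∈ G.neighborFinset x, f y := by
  let g : Sym2 (Fin n) → ℕ := Sym2.lift ⟨fun a b => (if a = x then f b else 0) +
    if b = x then f a else 0, fun a b => add_comm _ _⟩
  have h1 : edgeSum f E x = ((E.map fun e => s(e.1, e.2)).map g).sum := by
    rw [List.map_map]; rfl
  have h2 : (E.map fun e => s(e.1, e.2)).toFinset = G.edgeFinset := by
    ext e
    induction e with
    | h a b => simp only [List.mem_toFinset, SimpleGraph.mem_edgeFinset,
        SimpleGraph.mem_edgeSet, hE.2]
  rw [h1, ← List.sum_toFinset g hE.1, h2]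
  have h3 : ∑ y ∈ G.neighborFinset x, f y = ∑ e ∈ (G.neighborFinset x).image (s(x, ·)), g e := by
    rw [Finset.sum_image fun a _ b _ h => Sym2.congr_right.1 h]
    refine Finset.sum_congr rfl fun y hy => ?_
    have : y ≠ x := (G.mem_neighborFinset x y |>.1 hy).ne'
    simp [g, this]
  rw [h3]
  symm
  refine Finset.sum_subset ?_ ?_
  · intro e he
    simp only [Finset.mem_image, SimpleGraph.mem_neighborFinset] at he
    obtain ⟨y, hy, rfl⟩ := he
    simpa using hy
  · intro e he hne
    induction e with
    | h a b =>
      simp only [SimpleGraph.mem_edgeFinset, SimpleGraph.mem_edgeSet] at he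
      simp only [Finset.mem_image, SimpleGraph.mem_neighborFinset, not_exists, not_and] at hne
      have ha : a ≠ x := by
        rintro rfl; exact hne b he rfl
      have hb : b ≠ x := by
        rintro rfl; exact hne a he.symm Sym2.eq_swap
      simp [g, ha, hb]

theorem edgeSum_one (hE : IsEdgeList G E) (x : Fin n) :
    edgeSum (fun _ => 1) E x = G.degree x := by
  rw [edgeSum_eq hE]; simp

theorem edgeSum_inner (hE : IsEdgeList G E) (x : Fin n) :
    edgeSum (fun y => if G.degree y ≠ 1 then 1 else 0) E x = innerDegree G x := by
  rw [edgeSum_eq hE, innerDegree, Finset.card_filter]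

theorem edgeSum_leaf (hE : IsEdgeList G E) (x : Fin n) :
    edgeSum (fun y => if G.degree y = 1 then 1 else 0) E x + innerDegree G x = G.degree x := by
  rw [edgeSum_eq hE, ← card_leaves_add_innerDegree (G := G) x, Finset.card_filter]

theorem length_edgeList (hE : IsEdgeList G E) (hG : G.IsTree) : E.length + 1 = n := by
  have h2 : (E.map fun e => s(e.1, e.2)).toFinset = G.edgeFinset := by
    ext e
    induction e with
    | h a b => simp only [List.mem_toFinset, SimpleGraph.mem_edgeFinset,
        SimpleGraph.mem_edgeSet, hE.2]
  have h3 := hG.card_edgeFinset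
  rw [← h2, List.toFinset_card_of_nodup hE.1, List.length_map, Fintype.card_fin] at h3
  exact h3

end EdgeSum

end RealRAM

/-! ### Degrees, sums over spine neighbours and an end of the spine in linear time -/

namespace RealRAM

open Instr Test

/-- Count the edge in register `2` at both endpoints. -/
def degreeBody : Prog :=
  .block [load 3 0 2, load 4 1 2, load 5 2 3, add 5 5 7, store 2 3 5, load 5 2 4, add 5 5 7,
    store 2 4 5, add 2 2 7]

/-- If the edge in register `2` joins two spine vertices, count it at both endpoints and add each
endpoint to the sum kept for the other one. -/
def innerBody : Prog :=
  .ofList [.block [load 3 0 2, load 4 1 2, load 5 2 3, load 6 2 4],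
    .ite (.eq 5 7) .skip (.ite (.eq 6 7) .skip
      (.block [load 5 3 3, add 5 5 7, store 3 3 5, load 5 4 3, add 5 5 4, store 4 3 5,
        load 5 3 4, add 5 5 7, store 3 4 5, load 5 4 4, add 5 5 3, store 4 4 5])),
    .block [add 2 2 7]]

/-- If the vertex in register `2` is not a leaf, count it, and remember it if it has at most one
neighbour that is not a leaf. -/
def startBody : Prog :=
  .ofList [.block [load 5 2 2],
    .ite (.eq 5 7) .skip (.ofList [.block [add 8 8 7, load 5 3 2],
      .ite (.lt 5 10) (.block [copy 9 2]) .skip]),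
    .block [add 2 2 7]]

/-- The common first part of both programs. Array `2` receives the degrees, array `3` the numbers
of spine neighbours, array `4` the sums of the spine neighbours; register `8` receives the
length of the spine and register `3` an end of it. -/
def prep : Prog :=
  .ofList [.block [const 7 1, const 10 2], .loop (.lt 2 1) degreeBody, .block [const 2 0],
    .loop (.lt 2 1) innerBody, .block [const 2 0], .loop (.lt 2 0) startBody,
    .block [const 2 0, copy 3 9, const 4 0]]

variable {n : ℕ}

/-- The input is still in place, and registers `7` and `10` hold the constants one and two. -/
structure HasInput (E : List (Fin n × Fin n)) (s : State) : Prop where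
  reg0 : s.reg 0 = n
  reg1 : s.reg 1 = E.length
  reg7 : s.reg 7 = 1
  reg10 : s.reg 10 = 2
  mem0 : ∀ i (h : i < E.length), s.mem 0 i = E[i].1
  mem1 : ∀ i (h : i < E.length), s.mem 1 i = E[i].2

/-- Array `2` holds the degrees. -/
structure HasDegrees (G : SimpleGraph (Fin n)) [DecidableRel G.Adj] (E : List (Fin n × Fin n))
    (s : State) : Prop extends HasInput E s where
  deg : ∀ x : Fin n, s.mem 2 x = G.degree x

/-- The numbers and the sums of spine neighbours are in the arrays `3` and `4`. -/
structure HasInner (G : SimpleGraph (Fin n)) [DecidableRel G.Adj] (E : List (Fin n × Fin n))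
    (s : State) : Prop extends HasDegrees G E s where
  cnt : ∀ x : Fin n, G.degree x ≠ 1 → s.mem 3 x = innerDegree G x
  sum : ∀ x : Fin n, G.degree x ≠ 1 →
    s.mem 4 x = ∑ y ∈ G.neighborFinset x, if G.degree y ≠ 1 then (y : ℕ) else 0

variable {G : SimpleGraph (Fin n)} [DecidableRel G.Adj] {E : List (Fin n × Fin n)} {w k : ℕ}

theorem runs_degree_loop (hE : IsEdgeList G E) (hn : E.length + 1 = n) (hw : 10 * n ≤ w)
    {s : State} (hs : HasInput E s) (h2 : s.reg 2 = 0) (h8 : s.reg 8 = 0)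
    (hm : ∀ a j, 2 ≤ a → s.mem a j = 0) :
    Runs w (.loop (.lt 2 1) degreeBody) s (E.length * (degreeBody.cost + 1) + 1) fun s =>
      HasDegrees G E s ∧ s.reg 8 = 0 ∧ ∀ a j, 3 ≤ a → s.mem a j = 0 := by
  refine (Runs.forLoop (fun i s => HasInput E s ∧ s.reg 2 = i ∧ s.reg 8 = 0 ∧
    (∀ a j, 3 ≤ a → s.mem a j = 0) ∧
    ∀ x : Fin n, s.mem 2 x = edgeSum (fun _ => 1) (E.take i) x) ?_ ?_ ?_).mono le_rfl ?_
  · rintro i s ⟨h, h2, -⟩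
    exact ⟨h2, h.reg1⟩
  · rintro i hi s ⟨h, h2, h8, h3, hdeg⟩
    have hadj := (hE.adj (List.getElem_mem hi)).ne
    have e1 := h.mem0 i hi
    have e2 := h.mem1 i hi
    have hb : ∀ x : Fin n, edgeSum (fun _ => 1) (E.take i) x + 2 ≤ w := fun x => by
      have := edgeSum_take_le (E := E) (fun _ => 1) x i
      rw [edgeSum_one hE] at this
      have := G.degree_lt_card_verts x
      rw [Fintype.card_fin] at this
      omega
    have hne : ((E[i].1 : Fin n) : ℕ) ≠ E[i].2 := fun e => hadj (Fin.ext e)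
    refine runs_of_wp ?_
    have hb1 := hb E[i].1
    have hb2 := hb E[i].2
    simp [degreeBody, h2, e1, e2, h.reg7, hdeg, hne.symm]
    refine ⟨by omega, by omega, by omega, ?_, h8, ?_, ?_⟩
    · refine ⟨?_, ?_, ?_, ?_, ?_, ?_⟩ <;> simp [h.reg0, h.reg1, h.reg7, h.reg10]
      · exact h.mem0
      · exact h.mem1
    · intro a j ha
      rw [if_neg (by omega), if_neg (by omega)]
      exact h3 a j ha
    · intro x
      rw [edgeSum_take_succ _ _ hi]
      by_cases hx1 : E[i].1 = x <;> by_cases hx2 : E[i].2 = x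
      · exact absurd (hx1.trans hx2.symm) hadj
      · subst hx1; simp [hne, hx2]
      · subst hx2; simp [hx1]
      · have a1 : (x : ℕ) ≠ E[i].1 := fun e => hx1 (Fin.ext e.symm)
        have a2 : (x : ℕ) ≠ E[i].2 := fun e => hx2 (Fin.ext e.symm)
        simp [a1, a2, hx1, hx2]
  · exact ⟨hs, h2, h8, fun a j ha => hm a j (by omega), fun x => by simp [edgeSum, hm]⟩
  · rintro s ⟨h, -, h8, h3, hdeg⟩
    exact ⟨⟨h, fun x => by rw [hdeg, List.take_length, edgeSum_one hE]⟩, h8, h3⟩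

theorem sum_inner_neighbors_le (v : InnerPath G k) (i : Fin k) :
    (∑ y ∈ G.neighborFinset (v i), if G.degree y ≠ 1 then (y : ℕ) else 0) ≤ 2 * n := by
  rw [sum_inner_neighbors v i fun y => (y : ℕ)]
  split_ifs <;> omega

theorem innerDegree_le_two (v : InnerPath G k) (i : Fin k) : innerDegree G (v i) ≤ 2 := by
  rw [innerDegree_eq]
  split_ifs <;> omega

theorem runs_inner_loop (v : InnerPath G k) (hE : IsEdgeList G E) (hn : E.length + 1 = n)
    (hw : 10 * n ≤ w) {s : State} (hs : HasDegrees G E s) (h2 : s.reg 2 = 0) (h8 : s.reg 8 = 0)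
    (hm : ∀ a j, 3 ≤ a → s.mem a j = 0) :
    Runs w (.loop (.lt 2 1) innerBody) s (E.length * (innerBody.cost + 1) + 1) fun s =>
      HasInner G E s ∧ s.reg 8 = 0 := by
  refine (Runs.forLoop (fun i s => HasDegrees G E s ∧ s.reg 2 = i ∧ s.reg 8 = 0 ∧
    (∀ x : Fin n, G.degree x ≠ 1 →
      s.mem 3 x = edgeSum (fun y => if G.degree y ≠ 1 then 1 else 0) (E.take i) x) ∧
    ∀ x : Fin n, G.degree x ≠ 1 →
      s.mem 4 x = edgeSum (fun y => if G.degree y ≠ 1 then (y : ℕ) else 0) (E.take i) x)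
    ?_ ?_ ?_).mono le_rfl ?_
  · rintro i s ⟨h, h2, -⟩
    exact ⟨h2, h.reg1⟩
  · rintro i hi s ⟨h, h2, h8, hcnt, hsum⟩
    have hadj := (hE.adj (List.getElem_mem hi)).ne
    have e1 := h.mem0 i hi
    have e2 := h.mem1 i hi
    have hb3 : ∀ x : Fin n, G.degree x ≠ 1 → edgeSum (fun y => if G.degree y ≠ 1 then 1 else 0)
        (E.take i) x ≤ 2 := fun x hx => by
      obtain ⟨j, rfl⟩ := exists_spine_eq v hx
      exact (edgeSum_take_le _ _ i).trans ((edgeSum_inner hE _).trans_le (innerDegree_le_two v j))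
    have hb4 : ∀ x : Fin n, G.degree x ≠ 1 → edgeSum (fun y => if G.degree y ≠ 1 then (y : ℕ)
        else 0) (E.take i) x ≤ 2 * n := fun x hx => by
      obtain ⟨j, rfl⟩ := exists_spine_eq v hx
      exact (edgeSum_take_le _ _ i).trans ((edgeSum_eq hE _ _).trans_le
        (sum_inner_neighbors_le v j))
    have hne : ((E[i].1 : Fin n) : ℕ) ≠ E[i].2 := fun e => hadj (Fin.ext e)
    have l1 := E[i].1.2
    have l2 := E[i].2.2
    refine runs_of_wp ?_
    simp [innerBody, h2, e1, e2, h.reg7, h.deg]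
    refine ⟨fun hd1 => ?_, fun hd1 => ⟨fun hd2 => ?_, fun hd2 => ?_⟩⟩
    · refine ⟨by omega, ⟨⟨?_, ?_, ?_, ?_, ?_, ?_⟩, ?_⟩, h8, ?_, ?_⟩
      · simp [h.reg0]
      · simp [h.reg1]
      · simp [h.reg7]
      · simp [h.reg10]
      · simpa using h.mem0
      · simpa using h.mem1
      · simpa using h.deg
      · intro x hx
        rw [hcnt x hx, edgeSum_take_succ _ _ hi]
        have : E[i].1 ≠ x := fun e => hx (e ▸ hd1)
        simp [this, hd1]
      · intro x hx
        rw [hsum x hx, edgeSum_take_succ _ _ hi]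
        have : E[i].1 ≠ x := fun e => hx (e ▸ hd1)
        simp [this, hd1]
    · refine ⟨by omega, ⟨⟨?_, ?_, ?_, ?_, ?_, ?_⟩, ?_⟩, h8, ?_, ?_⟩
      · simp [h.reg0]
      · simp [h.reg1]
      · simp [h.reg7]
      · simp [h.reg10]
      · simpa using h.mem0
      · simpa using h.mem1
      · simpa using h.deg
      · intro x hx
        rw [hcnt x hx, edgeSum_take_succ _ _ hi]
        have : E[i].2 ≠ x := fun e => hx (e ▸ hd2)
        simp [this, hd2]
      · intro x hx
        rw [hsum x hx, edgeSum_take_succ _ _ hi]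
        have : E[i].2 ≠ x := fun e => hx (e ▸ hd2)
        simp [this, hd2]
    · have b1 := hb3 _ hd1
      have b2 := hb3 _ hd2
      have b3 := hb4 _ hd1
      have b4 := hb4 _ hd2
      simp only [hcnt _ hd1, hcnt _ hd2, hsum _ hd1, hsum _ hd2, hne.symm, if_false]
      refine ⟨by omega, by omega, by omega, by omega, by omega,
        ⟨⟨?_, ?_, ?_, ?_, ?_, ?_⟩, ?_⟩, h8, ?_, ?_⟩
      · simp [h.reg0]
      · simp [h.reg1]
      · simp [h.reg7]
      · simp [h.reg10]
      · simpa using h.mem0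
      · simpa using h.mem1
      · simpa using h.deg
      · intro x hx
        rw [edgeSum_take_succ _ _ hi]
        by_cases hx1 : E[i].1 = x <;> by_cases hx2 : E[i].2 = x
        · exact absurd (hx1.trans hx2.symm) hadj
        · subst hx1; simp [hne, hx2, hd2]
        · subst hx2; simp [hx1, hd1]
        · have a1 : (x : ℕ) ≠ E[i].1 := fun e => hx1 (Fin.ext e.symm)
          have a2 : (x : ℕ) ≠ E[i].2 := fun e => hx2 (Fin.ext e.symm)
          simp [a1, a2, hx1, hx2, hcnt x hx]
      · intro x hx
        rw [edgeSum_take_succ _ _ hi]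
        by_cases hx1 : E[i].1 = x <;> by_cases hx2 : E[i].2 = x
        · exact absurd (hx1.trans hx2.symm) hadj
        · subst hx1; simp [hne, hx2, hd2]
        · subst hx2; simp [hx1, hd1]
        · have a1 : (x : ℕ) ≠ E[i].1 := fun e => hx1 (Fin.ext e.symm)
          have a2 : (x : ℕ) ≠ E[i].2 := fun e => hx2 (Fin.ext e.symm)
          simp [a1, a2, hx1, hx2, hsum x hx]
  · exact ⟨hs, h2, h8, fun x _ => by simp [edgeSum, hm], fun x _ => by simp [edgeSum, hm]⟩
  · rintro s ⟨h, -, h8, hcnt, hsum⟩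
    exact ⟨⟨h, fun x hx => by rw [hcnt x hx, List.take_length, edgeSum_inner hE],
      fun x hx => by rw [hsum x hx, List.take_length, edgeSum_eq hE]⟩, h8⟩

/-- Register `8` counts the spine vertices below `i`, and register `9` holds an end of the spine
as soon as there is one below `i`. -/
structure HasStart (G : SimpleGraph (Fin n)) [DecidableRel G.Adj] (i : ℕ) (s : State) : Prop where
  count : s.reg 8 = (Finset.univ.filter fun x : Fin n => G.degree x ≠ 1 ∧ (x : ℕ) < i).card
  found : ∀ x : Fin n, (x : ℕ) < i → G.degree x ≠ 1 → innerDegree G x < 2 →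
    ∃ y, G.degree y ≠ 1 ∧ innerDegree G y < 2 ∧ s.reg 9 = y

theorem HasStart.skip {z : Fin n} {s t : State} (h : HasStart G z s) (hz : G.degree z = 1)
    (h8 : t.reg 8 = s.reg 8) (h9 : t.reg 9 = s.reg 9) : HasStart G (z + 1) t := by
  refine ⟨?_, fun x hx hd hi => ?_⟩
  · rw [h8, h.count]
    congr 1
    ext x
    simp only [Finset.mem_filter, Finset.mem_univ, true_and]
    refine and_congr_right fun hx => ⟨fun _ => by omega, fun h' => ?_⟩
    rcases eq_or_ne x z with rfl | hne
    · exact absurd hz hx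
    · have := Fin.val_ne_of_ne hne; omega
  · rw [h9]
    refine h.found x ?_ hd hi
    rcases eq_or_ne x z with rfl | hne
    · exact absurd hz hd
    · have := Fin.val_ne_of_ne hne; omega

theorem HasStart.step {z : Fin n} {s t : State} (h : HasStart G z s) (hz : G.degree z ≠ 1)
    (h8 : t.reg 8 = s.reg 8 + 1)
    (h9 : t.reg 9 = if innerDegree G z < 2 then (z : ℕ) else s.reg 9) :
    HasStart G (z + 1) t := by
  refine ⟨?_, fun x hx hd hi => ?_⟩
  · rw [h8, h.count]
    have : (Finset.univ.filter fun x : Fin n => G.degree x ≠ 1 ∧ (x : ℕ) < z + 1) =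
        insert z (Finset.univ.filter fun x : Fin n => G.degree x ≠ 1 ∧ (x : ℕ) < z) := by
      ext x
      simp only [Finset.mem_filter, Finset.mem_univ, true_and, Finset.mem_insert]
      rcases eq_or_ne x z with rfl | hne
      · simp [hz]
      · have := Fin.val_ne_of_ne hne
        simp only [hne, false_or]
        refine and_congr_right fun _ => by omega
    rw [this, Finset.card_insert_of_notMem (by simp)]
  · split_ifs at h9 with hc
    · exact ⟨z, hz, hc, h9⟩
    · rw [h9]
      refine h.found x ?_ hd hi
      rcases eq_or_ne x z with rfl | hne
      · exact absurd hi hc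
      · have := Fin.val_ne_of_ne hne; omega

theorem runs_start_loop (hw : 10 * n ≤ w) {s : State} (hs : HasInner G E s)
    (h2 : s.reg 2 = 0) (h8 : s.reg 8 = 0) :
    Runs w (.loop (.lt 2 0) startBody) s (n * (startBody.cost + 1) + 1) fun s =>
      HasInner G E s ∧ HasStart G n s := by
  refine (Runs.forLoop (fun i s => HasInner G E s ∧ s.reg 2 = i ∧ HasStart G i s)
    ?_ ?_ ?_).mono le_rfl ?_
  · rintro i s ⟨h, h2, -⟩
    exact ⟨h2, h.reg0⟩
  · rintro i hi s ⟨h, h2, hst⟩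
    obtain ⟨z, rfl⟩ : ∃ z : Fin n, (z : ℕ) = i := ⟨⟨i, hi⟩, rfl⟩
    have hcard : s.reg 8 ≤ n :=
      hst.count.trans_le ((Finset.card_le_univ _).trans_eq (Fintype.card_fin n))
    have hrest : ∀ t : State, (∀ r, r ≠ 2 → r ≠ 5 → r ≠ 8 → r ≠ 9 → t.reg r = s.reg r) →
        t.mem = s.mem → HasInner G E t := by
      intro t ht hm
      exact ⟨⟨⟨by simp [ht, h.reg0], by simp [ht, h.reg1], by simp [ht, h.reg7],
        by simp [ht, h.reg10], by rw [hm]; exact h.mem0, by rw [hm]; exact h.mem1⟩,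
        by rw [hm]; exact h.deg⟩, by rw [hm]; exact h.cnt, by rw [hm]; exact h.sum⟩
    refine runs_of_wp ?_
    simp only [startBody, wp_cons, wp_block_cons, wp_load, h2, wp_block_nil, wp_ite, holds_eq,
      State.setReg_reg, if_true, Nat.reduceEqDiff, if_false, h.reg7, h.deg z, wp_skip, wp_nil,
      wp_add, holds_lt, h.reg10, wp_copy, State.setReg_mem]
    refine ⟨fun hd => ⟨by omega, hrest _ (by intros; simp [*]) rfl, by simp, ?_⟩,
      fun hd => ⟨by omega, fun hc => ⟨by omega, hrest _ (by intros; simp [*]) rfl, by simp, ?_⟩,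
        fun hc => ⟨by omega, hrest _ (by intros; simp [*]) rfl, by simp, ?_⟩⟩⟩
    · exact hst.skip hd (by simp) (by simp)
    · rw [h.cnt z hd] at hc
      exact hst.step hd (by simp) (by simp [hc])
    · rw [h.cnt z hd] at hc
      exact hst.step hd (by simp) (by simp [hc])
  · exact ⟨hs, h2, by simp [h8], fun x hx => absurd hx (Nat.not_lt_zero _)⟩
  · rintro s ⟨h, -, hst⟩
    exact ⟨h, hst⟩

/-- The inner path read backwards. -/
def reversePath (v : InnerPath G k) : InnerPath G k :=
  ({ toEquiv := Fin.revPerm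
     map_rel_iff' := by
      intro a b
      simp only [SimpleGraph.pathGraph_adj, Fin.revPerm_apply, Fin.val_rev]
      omega } : SimpleGraph.pathGraph k ≃g SimpleGraph.pathGraph k).trans v

/-- A spine vertex with at most one neighbour on the spine can be made the first one. -/
theorem exists_innerPath_starting_at (v : InnerPath G k) {y : Fin n} (hy : G.degree y ≠ 1)
    (hi : innerDegree G y < 2) : ∃ v' : InnerPath G k, ∀ h : 0 < k, y = v' ⟨0, h⟩ := by
  obtain ⟨j, rfl⟩ := exists_spine_eq v hy
  have hj := j.2
  rw [innerDegree_eq] at hi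
  by_cases h0 : j.val = 0
  · exact ⟨v, fun h => congrArg (fun j => (v j : Fin n)) (Fin.ext h0)⟩
  · have h1 : j.val + 1 = k := by
      split_ifs at hi <;> omega
    refine ⟨reversePath v, fun h => congrArg (fun j => (v j : Fin n)) (Fin.ext ?_)⟩
    change j.val = (Fin.rev ⟨0, h⟩ : Fin k).val
    rw [Fin.val_rev]
    simp only
    omega

/-- Position `i` of a walk along the spine: register `2` holds `i`, register `3` the vertex at this
position and register `4` the preceding vertex, or zero at the start. -/
structure AtSpine (E : List (Fin n × Fin n)) (v : InnerPath G k) (i : ℕ) (s : State) : Prop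
    extends HasInner G E s where
  reg2 : s.reg 2 = i
  reg8 : s.reg 8 = k
  reg3 : ∀ h : i < k, s.reg 3 = v ⟨i, h⟩
  reg4 : ∀ h : i < k, s.reg 4 = if 0 < i then ((v ⟨i - 1, by omega⟩ : Fin n) : ℕ) else 0

theorem card_filter_degree_ne_one (v : InnerPath G k) :
    (Finset.univ.filter fun x => G.degree x ≠ 1).card = k := by
  have h := Fintype.card_congr v.toEquiv
  rw [Fintype.card_fin] at h
  rw [h, Fintype.card_subtype]
  rfl

/-- The end of the spine that is found becomes its first vertex, whatever enumeration is given. -/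
theorem runs_prep (hG : G.IsTree) (v : InnerPath G k) (hE : IsEdgeList G E) (hw : 10 * n ≤ w) :
    Runs w prep (input E) (100 * n) fun s => ∃ v' : InnerPath G k, AtSpine E v' 0 s := by
  have hn := length_edgeList hE hG
  have h0 : Runs w (.block [const 7 1, const 10 2]) (input E) 3 fun s => HasInput E s ∧
      s.reg 2 = 0 ∧ s.reg 8 = 0 ∧ ∀ a j, 2 ≤ a → s.mem a j = 0 := by
    refine runs_of_wp (p := .block [const 7 1, const 10 2]) ?_
    simp only [wp_block_cons, wp_const, wp_block_nil]
    refine ⟨⟨by simp [input], by simp [input], by simp, by simp, fun i hi => ?_, fun i hi => ?_⟩,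
      by simp [input], by simp [input], fun a j ha => ?_⟩
    · simp [input, hi]
    · simp [input, hi]
    · have h0 : a ≠ 0 := by omega
      have h1 : a ≠ 1 := by omega
      simp [input, h0, h1]
  have c1 : degreeBody.cost = 10 := rfl
  have c2 : innerBody.cost = 25 := rfl
  have c3 : startBody.cost = 15 := rfl
  have hin : ∀ s : State, HasInput E s → HasInput E (s.setReg 2 0) := fun s h =>
    ⟨by simp [h.reg0], by simp [h.reg1], by simp [h.reg7], by simp [h.reg10],
      by simpa using h.mem0, by simpa using h.mem1⟩
  refine Runs.mono (T := 3 + ((E.length * (degreeBody.cost + 1) + 1) + (2 +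
    ((E.length * (innerBody.cost + 1) + 1) + (2 + ((n * (startBody.cost + 1) + 1) +
    (4 + 1)))))))
    (Runs.cons h0 fun s hs => ?_) (by rw [c1, c2, c3]; omega) fun _ => id
  refine Runs.cons (runs_degree_loop hE hn hw hs.1 hs.2.1 hs.2.2.1 hs.2.2.2) fun s hs => ?_
  refine Runs.cons (R := fun s => HasDegrees G E s ∧ s.reg 2 = 0 ∧ s.reg 8 = 0 ∧
    ∀ a j, 3 ≤ a → s.mem a j = 0) (runs_of_wp ?_) fun s hs => ?_
  · simp only [wp_block_cons, wp_const, wp_block_nil]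
    exact ⟨⟨hin s hs.1.1, hs.1.deg⟩, by simp, by simp [hs.2.1], hs.2.2⟩
  refine Runs.cons (runs_inner_loop v hE hn hw hs.1 hs.2.1 hs.2.2.1 hs.2.2.2) fun s hs => ?_
  refine Runs.cons (R := fun s => HasInner G E s ∧ s.reg 2 = 0 ∧ s.reg 8 = 0)
    (runs_of_wp ?_) fun s hs => ?_
  · simp only [wp_block_cons, wp_const, wp_block_nil]
    exact ⟨⟨⟨hin s hs.1.1.1, hs.1.deg⟩, hs.1.cnt, hs.1.sum⟩, by simp, by simp [hs.2]⟩
  refine Runs.cons (runs_start_loop hw hs.1 hs.2.1 hs.2.2) fun s hs => ?_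
  refine Runs.cons (R := fun s => ∃ v' : InnerPath G k, AtSpine E v' 0 s)
    (runs_of_wp ?_) fun s hs => Runs.nil hs
  obtain ⟨h, hst⟩ := hs
  have h8 : s.reg 8 = k := by
    rw [hst.count, ← card_filter_degree_ne_one v]
    simp
  obtain ⟨v', hv'⟩ : ∃ v' : InnerPath G k, ∀ h : 0 < k, s.reg 9 = v' ⟨0, h⟩ := by
    rcases Nat.eq_zero_or_pos k with h0 | hk
    · exact ⟨v, fun h => by omega⟩
    · obtain ⟨y, hy, hi, h9⟩ := hst.found (v ⟨0, hk⟩) (v ⟨0, hk⟩ : Fin n).2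
        (spine_degree_ne_one v _) (by rw [innerDegree_eq]; simp; split_ifs <;> omega)
      obtain ⟨v', hv'⟩ := exists_innerPath_starting_at v hy hi
      exact ⟨v', fun h => by rw [h9, hv' h]⟩
  simp only [wp_block_cons, wp_const, wp_copy, wp_block_nil]
  exact ⟨v', ⟨⟨⟨by simp [h.reg0], by simp [h.reg1], by simp [h.reg7], by simp [h.reg10], h.mem0,
    h.mem1⟩, h.deg⟩, h.cnt, h.sum⟩, by simp, by simp [h8], fun hk => by simp [hv' hk], by simp⟩

/-- Visit every spine vertex in turn. The next vertex is found by subtracting the preceding one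
from the sum of both. -/
def walk (visit : Prog) : Prog :=
  .loop (.lt 2 8) (.ofList [visit, .block [load 5 4 3, sub 5 5 4, copy 4 3, copy 3 5, add 2 2 7]])

/-- A walk along the spine. The part of the program that visits a vertex leaves the arrays and
the registers below `11` alone; the condition that it maintains does not depend on them. -/
theorem runs_walk {v : InnerPath G k} {visit : Prog} {B : ℕ} (hw : 10 * n ≤ w)
    (J : ℕ → State → Prop)
    (hJ : ∀ i s t, (∀ r, 11 ≤ r → t.reg r = s.reg r) → t.rreg = s.rreg → t.rmem = s.rmem →
      J i s → J i t)
    (hvisit : ∀ i (_ : i < k) s, AtSpine E v i s → J i s → Runs w visit s B fun t =>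
      (∀ r, r ≤ 10 → t.reg r = s.reg r) ∧ t.mem = s.mem ∧ J (i + 1) t)
    {s : State} (h : AtSpine E v 0 s) (h0 : J 0 s) :
    Runs w (walk visit) s (k * (B + 8) + 1) fun t => AtSpine E v k t ∧ J k t := by
  have hcopy : ∀ s t : State, (∀ r, r ≤ 10 → t.reg r = s.reg r) → t.mem = s.mem →
      ∀ i, AtSpine E v i s → AtSpine E v i t := by
    intro s t hr hm i h
    exact ⟨⟨⟨⟨by simp [hr, h.reg0], by simp [hr, h.reg1], by simp [hr, h.reg7],
      by simp [hr, h.reg10], by rw [hm]; exact h.mem0, by rw [hm]; exact h.mem1⟩,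
      by rw [hm]; exact h.deg⟩, by rw [hm]; exact h.cnt, by rw [hm]; exact h.sum⟩,
      by simp [hr, h.reg2], by simp [hr, h.reg8], by simpa [hr] using h.reg3,
      by simpa [hr] using h.reg4⟩
  refine Runs.forLoop (B := B + 7) (fun i s => AtSpine E v i s ∧ J i s)
    (fun i s h => ⟨h.1.reg2, h.1.reg8⟩) ?_ ⟨h, h0⟩
  rintro i hi s ⟨h, hj⟩
  refine Runs.cons (T' := 6 + 1) (hvisit i hi s h hj) ?_
  rintro t ⟨hr, hm, ht⟩
  refine Runs.cons (R := fun s => AtSpine E v (i + 1) s ∧ J (i + 1) s) (runs_of_wp ?_)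
    fun s hs => Runs.nil hs
  have h := hcopy _ _ hr hm _ h
  have hkn := length_spine_le_card v
  rw [Fintype.card_fin] at hkn
  simp only [wp_block_cons, wp_load, wp_sub, wp_copy, wp_add, wp_block_nil]
  refine ⟨by simp [h.reg2, h.reg7]; omega, ⟨⟨⟨⟨by simp [h.reg0], by simp [h.reg1],
    by simp [h.reg7], by simp [h.reg10], h.mem0, h.mem1⟩, h.deg⟩, h.cnt, h.sum⟩,
    by simp [h.reg2, h.reg7], by simp [h.reg8], fun h' => ?_, fun h' => ?_⟩, ?_⟩
  · have hsum := h.sum _ (spine_degree_ne_one v ⟨i, hi⟩)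
    rw [sum_inner_neighbors v ⟨i, hi⟩ fun y => (y : ℕ), dif_pos h'] at hsum
    simp [h.reg3 hi, h.reg4 hi, hsum]
    split_ifs <;> omega
  · simp [h.reg3 hi]
  · exact hJ _ _ _ (fun r hr => by simp; split_ifs <;> omega) (by simp) (by simp) ht

end RealRAM

/-! ### The decision program -/

namespace RealRAM

open Instr Test Placement

/-- Update the flag in register `11`, which tells whether a vertex of degree five has been seen
after which no degree was at most three, and raise register `12` at an obstruction. -/
def inspect : Prog :=
  .ofList [.block [load 13 2 3],
    .ite (.lt 13 14) (.block [const 11 0]) (.ite (.lt 13 15) .skip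
      (.ite (.lt 15 13) (.block [const 12 1])
        (.ite (.eq 11 7) (.block [const 12 1]) (.block [const 11 1]))))]

/-- Decides whether a caterpillar is a unit disk contact graph. -/
def decision : Prog :=
  .ofList [prep, .block [const 14 4, const 15 5, const 11 0, const 12 0], walk inspect,
    .block [sub 0 7 12]]

theorem isDiscrete_decision : decision.IsDiscrete := by
  simp [decision, prep, degreeBody, innerBody, startBody, walk, inspect, Prog.ofList, Prog.block,
    Prog.IsDiscrete, Instr.IsDiscrete, Test.IsDiscrete]

variable {n : ℕ} {G : SimpleGraph (Fin n)} [DecidableRel G.Adj] {E : List (Fin n × Fin n)} {k : ℕ}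

/-- The spine satisfies the degree condition up to its first `i` vertices. -/
def GoodUpTo (v : InnerPath G k) (i : ℕ) : Prop :=
  ∀ j < i, degSeq v (j + 1) ≤ 5 ∧ (degSeq v (j + 1) = 5 → armed (degSeq v) (j + 1) = false)

theorem goodUpTo_succ (v : InnerPath G k) (i : ℕ) : GoodUpTo v (i + 1) ↔ GoodUpTo v i ∧
    degSeq v (i + 1) ≤ 5 ∧ (degSeq v (i + 1) = 5 → armed (degSeq v) (i + 1) = false) := by
  refine ⟨fun h => ⟨fun j hj => h j (by omega), h i (by omega)⟩, fun h j hj => ?_⟩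
  rcases Nat.lt_succ_iff_lt_or_eq.1 hj with h' | rfl
  · exact h.1 j h'
  · exact h.2

theorem goodUpTo_iff_spineCondition (v : InnerPath G k) : GoodUpTo v k ↔ SpineCondition v := by
  rw [spineCondition_iff_admissible]
  refine ⟨fun h => ⟨fun i => ?_, fun i hi => ?_⟩, fun h j hj => ⟨?_, h.2 _⟩⟩
  · rw [← degSeq_succ]
    exact (h i i.2).1
  · have hik : 1 ≤ i ∧ i ≤ k := by
      by_contra hne
      simp [degSeq, hne] at hi
    obtain ⟨j, rfl⟩ : ∃ j, i = j + 1 := ⟨i - 1, by omega⟩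
    exact (h j (by omega)).2 hi
  · rw [degSeq_succ v ⟨j, hj⟩]
    exact h.1 _

/-- What the walk of the decision program maintains. -/
structure Inspected (v : InnerPath G k) (i : ℕ) (s : State) : Prop where
  reg14 : s.reg 14 = 4
  reg15 : s.reg 15 = 5
  flag : s.reg 11 = (armed (degSeq v) (i + 1)).toNat
  good : GoodUpTo v i → s.reg 12 = 0
  bad : ¬ GoodUpTo v i → s.reg 12 = 1

theorem runs_decision {w : ℕ} (hG : G.IsTree) (v : InnerPath G k) (hE : IsEdgeList G E)
    (hw : 10 * n ≤ w) : Runs w decision (input E) (200 * n) fun s =>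
      (SpineCondition v → s.reg 0 = 1) ∧ (¬ SpineCondition v → s.reg 0 = 0) := by
  have hn := length_edgeList hE hG
  have hkn := length_spine_le_card v
  rw [Fintype.card_fin] at hkn
  rw [← isUDCGraph_iff_spineCondition hG.connected v]
  have hc : inspect.cost = 16 := rfl
  refine Runs.mono (T := 100 * n + (5 + (k * (inspect.cost + 8) + 1 + (2 + 1))))
    (Runs.cons (runs_prep hG v hE hw) ?_) (by rw [hc]; omega) fun _ => id
  rintro s ⟨v, h⟩
  rw [isUDCGraph_iff_spineCondition hG.connected v]
  refine Runs.cons (R := fun s => AtSpine E v 0 s ∧ Inspected v 0 s) (runs_of_wp ?_) fun s hs => ?_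
  · simp only [wp_block_cons, wp_const, wp_block_nil]
    have ha : armed (degSeq v) 1 = false := by simp [armed, degSeq]
    exact ⟨⟨⟨⟨⟨by simp [h.reg0], by simp [h.reg1], by simp [h.reg7], by simp [h.reg10], h.mem0,
      h.mem1⟩, h.deg⟩, h.cnt, h.sum⟩, by simp [h.reg2], by simp [h.reg8],
      by simpa using h.reg3, by simpa using h.reg4⟩, ⟨by simp, by simp, by simp [ha], by simp,
      fun hbad => absurd (fun j hj => absurd hj (Nat.not_lt_zero j)) hbad⟩⟩
  refine Runs.cons (runs_walk hw (Inspected v) ?_ ?_ hs.1 hs.2) fun s hs => ?_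
  · rintro i s t hr - - h
    exact ⟨by simp [hr, h.reg14], by simp [hr, h.reg15], by simp [hr, h.flag],
      by simpa [hr] using h.good, by simpa [hr] using h.bad⟩
  · intro i hi s h hj
    -- `simp` must not look inside the postcondition
    obtain ⟨Q, hQ⟩ : ∃ Q : State → Prop, ∀ t, Q t ↔ (∀ r, r ≤ 10 → t.reg r = s.reg r) ∧
        t.mem = s.mem ∧ Inspected v (i + 1) t := ⟨_, fun _ => Iff.rfl⟩
    refine (runs_of_wp (Q := Q) ?_).mono le_rfl fun t => (hQ t).1
    have hdeg : s.mem 2 (s.reg 3) = degSeq v (i + 1) := by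
      rw [h.reg3 hi, h.deg, degSeq_succ v ⟨i, hi⟩]
    have h14 := hj.reg14
    have h15 := hj.reg15
    have hflag := hj.flag
    have hgood := hj.good
    have hbad := hj.bad
    have harm : armed (degSeq v) (i + 1 + 1) = if degSeq v (i + 1) = 5 then true else
      if degSeq v (i + 1) ≤ 3 then false else armed (degSeq v) (i + 1) := rfl
    have frame : ∀ t : State, (∀ r, r ≠ 11 → r ≠ 12 → r ≠ 13 → t.reg r = s.reg r) →
        t.mem = s.mem → t.reg 11 = (armed (degSeq v) (i + 1 + 1)).toNat →
        (GoodUpTo v (i + 1) → t.reg 12 = 0) → (¬ GoodUpTo v (i + 1) → t.reg 12 = 1) →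
        Q t :=
      fun t hr hm h1 h2 h3 => (hQ t).2 ⟨fun r hr' => hr r (by omega) (by omega) (by omega), hm,
        ⟨by simp [hr, h14], by simp [hr, h15], h1, h2, h3⟩⟩
    simp only [inspect, wp_cons, wp_block_cons, wp_load, wp_block_nil, wp_ite, holds_lt, holds_eq,
      wp_const, wp_skip, wp_nil, State.setReg_reg, hdeg, Nat.reduceEqDiff, if_true, if_false, h14,
      h15, h.reg7]
    rw [goodUpTo_succ] at frame
    refine ⟨fun h1 => frame _ (by intros; simp [*]) rfl ?_ ?_ ?_, fun h1 =>
      ⟨fun h2 => frame _ (by intros; simp [*]) rfl ?_ ?_ ?_, fun h2 =>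
      ⟨fun h3 => frame _ (by intros; simp [*]) rfl ?_ ?_ ?_, fun h3 =>
      ⟨fun h4 => frame _ (by intros; simp [*]) rfl ?_ ?_ ?_, fun h4 =>
        frame _ (by intros; simp [*]) rfl ?_ ?_ ?_⟩⟩⟩⟩
    all_goals
      clear frame
      generalize armed (degSeq v) (i + 1 + 1) = b at *
      generalize armed (degSeq v) (i + 1) = a at *
      generalize degSeq v (i + 1) = d at *
      cases a <;> simp at hflag <;> simp <;> grind
  · refine Runs.cons (R := fun s => (SpineCondition v → s.reg 0 = 1) ∧
      (¬ SpineCondition v → s.reg 0 = 0)) (runs_of_wp ?_) fun s hs => Runs.nil hs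
    simp only [wp_block_cons, wp_sub, wp_block_nil, ← goodUpTo_iff_spineCondition]
    exact ⟨fun hg => by simp [hs.1.reg7, hs.2.good hg], fun hb => by simp [hs.1.reg7, hs.2.bad hb]⟩

end RealRAM

/-! ### Points for the spine and its leaves -/

namespace RealRAM

open Instr Test Placement

/-- Store, in the arrays `2` and `3` at the address in register `20`, the point at distance two
from the point in the real registers `11` and `12`, in the direction that arises from the angle in
register `21` by the rotation whose cosine and sine are in the registers `20` and `22`. -/
def emit : Prog :=
  .block [rcos 25 21, rsin 26 21, rmul 27 20 25, rmul 28 22 26, rsub 27 27 28, rmul 27 27 9,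
    radd 27 11 27, rstore 2 20 27, rmul 27 20 26, rmul 28 22 25, radd 27 27 28, rmul 27 27 9,
    radd 27 12 27, rstore 3 20 27]

/-- Write the current spine vertex, and the slots zero, two, three and four of its table, which
starts at the address `5 * c` for the spine vertex `c`. The real registers `20` and `22` receive
the cosine and the sine of `-π / 2`, of `π / 3` or `2 * π / 3`, and of `π / 3`, respectively. -/
def fill : Prog :=
  .ofList [.block [add 20 3 3, add 20 20 20, add 20 20 3, rstore 0 3 11, rstore 1 3 12,
      rstore 2 20 5, rstore 3 20 5, add 20 20 7, copy 21 20, add 20 20 7,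
      rofNat 23 2, radd 23 23 6, rmul 21 23 3, rcopy 20 5, rsub 22 5 6],
    emit,
    .ite (.eq 11 7) (.block [rcopy 20 8, radd 21 10 4]) (.block [rsub 20 5 8, rcopy 21 10]),
    .block [add 20 20 7, rcopy 22 7, radd 23 23 6, rmul 24 23 3, rsub 21 21 24],
    emit,
    .block [add 20 20 7, rcopy 20 8, radd 23 23 8, rmul 24 23 3, rsub 21 10 24],
    emit]

/-- Update the flag, the direction and the point for the next spine vertex. -/
def advance : Prog :=
  .ofList [.block [load 13 2 3],
    .ite (.lt 13 14) (.block [const 11 0])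
      (.ite (.eq 13 15) (.block [const 11 1, rsub 10 10 4]) .skip),
    .block [rcos 24 10, rmul 24 24 9, radd 11 11 24, rsin 24 10, rmul 24 24 9, radd 12 12 24]]

/-- Fill slot one, which is the end of the extended spine that is still free. -/
def close : Prog :=
  .ite (.eq 2 16) (.ite (.lt 7 8) (.block [rstore 2 21 5, rstore 3 21 5])
    (.block [rstore 2 21 11, rstore 3 21 12])) (.block [rstore 2 21 11, rstore 3 21 12])

/-- The machine needs the angle `φ` only through its cosine and sine. -/
theorem wp_emit {w : ℕ} {Q : State → Prop} {s : State} (φ : ℝ) (h9 : s.rreg 9 = 2)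
    (h20 : s.rreg 20 = Real.cos φ) (h22 : s.rreg 22 = Real.sin φ)
    (h : ∀ t : State, t.reg = s.reg → t.mem = s.mem → (∀ r < 25, t.rreg r = s.rreg r) →
      (∀ a j, t.rmem a j =
        if a = 3 ∧ j = s.reg 20 then s.rreg 12 + 2 * Real.sin (s.rreg 21 + φ)
        else if a = 2 ∧ j = s.reg 20 then s.rreg 11 + 2 * Real.cos (s.rreg 21 + φ)
        else s.rmem a j) → Q t) : wp w emit Q s := by
  simp only [emit, wp_block_cons, wp_rcos, wp_rsin, wp_rmul, wp_rsub, wp_radd, wp_rstore,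
    wp_block_nil]
  refine h _ (by simp) (by simp) (fun r hr => ?_) fun a j => ?_
  · have h1 : r ≠ 25 := by omega
    have h2 : r ≠ 26 := by omega
    have h3 : r ≠ 27 := by omega
    have h4 : r ≠ 28 := by omega
    simp [h1, h2, h3, h4]
  · simp only [State.setRMem_rmem, State.setRReg_rmem, State.setRReg_rreg, State.setRMem_rreg,
      State.setRReg_reg, State.setRMem_reg, Nat.reduceEqDiff, if_true, if_false, h9, h20, h22]
    rw [Real.sin_add, Real.cos_add]
    split_ifs <;> first | rfl | ring

/-- The constants of the construction. -/
structure HasConstants (N : ℕ) (s : State) : Prop where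
  reg14 : s.reg 14 = 4
  reg15 : s.reg 15 = 5
  reg16 : s.reg 16 = 0
  rreg3 : s.rreg 3 = tick N
  rreg4 : s.rreg 4 = bend N
  rreg5 : s.rreg 5 = 0
  rreg6 : s.rreg 6 = 1
  rreg7 : s.rreg 7 = Real.sqrt 3 / 2
  rreg8 : s.rreg 8 = 1 / 2
  rreg9 : s.rreg 9 = 2

/-- The flag, the direction and the point for the spine vertex at position `j`. -/
structure HasFrame (N : ℕ) (d : ℕ → ℕ) (j : ℕ) (s : State) : Prop where
  flag : s.reg 11 = (armed d j).toNat
  dir : s.rreg 10 = dir N d j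
  x : s.rreg 11 = spineX N d j
  y : s.rreg 12 = spineY N d j

theorem HasConstants.congr {N : ℕ} {s t : State} (h : HasConstants N s)
    (h1 : ∀ r, 14 ≤ r → r ≤ 16 → t.reg r = s.reg r) (h2 : ∀ r, r ≤ 9 → t.rreg r = s.rreg r) :
    HasConstants N t :=
  ⟨by simp [h1, h.reg14], by simp [h1, h.reg15], by simp [h1, h.reg16], by simp [h2, h.rreg3],
    by simp [h2, h.rreg4], by simp [h2, h.rreg5], by simp [h2, h.rreg6], by simp [h2, h.rreg7],
    by simp [h2, h.rreg8], by simp [h2, h.rreg9]⟩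

theorem ptX_one {N : ℕ} (d : ℕ → ℕ) (i : ℕ) :
    ptX N d (i + 1) 1 = spineX N d (i + 1) + 2 * Real.cos ((i + 1) * tick N + -(Real.pi / 2)) := by
  simp [ptX, leafAngle, sub_eq_add_neg]

theorem ptY_one {N : ℕ} (d : ℕ → ℕ) (i : ℕ) :
    ptY N d (i + 1) 1 = spineY N d (i + 1) + 2 * Real.sin ((i + 1) * tick N + -(Real.pi / 2)) := by
  simp [ptY, leafAngle, sub_eq_add_neg]

/-- The effect of `fill` at position `i + 1` of the spine, with the spine vertex `c`. -/
structure Filled (N : ℕ) (d : ℕ → ℕ) (i c : ℕ) (s t : State) : Prop where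
  reg : ∀ r, r ≤ 19 → t.reg r = s.reg r
  mem : t.mem = s.mem
  rreg : ∀ r, r ≤ 19 → t.rreg r = s.rreg r
  reg21 : t.reg 21 = 5 * c + 1
  x : t.rmem 0 c = spineX N d (i + 1)
  y : t.rmem 1 c = spineY N d (i + 1)
  x_zero : t.rmem 2 (5 * c) = 0
  y_zero : t.rmem 3 (5 * c) = 0
  x_leaf : ∀ κ, 1 ≤ κ → κ ≤ 3 → t.rmem 2 (5 * c + (κ + 1)) = ptX N d (i + 1) κ
  y_leaf : ∀ κ, 1 ≤ κ → κ ≤ 3 → t.rmem 3 (5 * c + (κ + 1)) = ptY N d (i + 1) κ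
  other_points : ∀ a j, a < 2 → j ≠ c → t.rmem a j = s.rmem a j
  other_slots : ∀ a j, 2 ≤ a → (j < 5 * c ∨ 5 * c + 5 ≤ j) → t.rmem a j = s.rmem a j

theorem wp_fill {w N : ℕ} {d : ℕ → ℕ} {i c : ℕ} {s : State} (hw : 5 * c + 4 ≤ w)
    (h2 : s.reg 2 = i) (h3 : s.reg 3 = c) (h7 : s.reg 7 = 1) (hc : HasConstants N s)
    (hf : HasFrame N d (i + 1) s) : wp w fill (Filled N d i c s) s := by
  have cos0 : Real.cos (-(Real.pi / 2)) = 0 := by simp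
  have sin0 : Real.sin (-(Real.pi / 2)) = -1 := by simp
  have cos2 : Real.cos (2 * Real.pi / 3) = -(1 / 2) := by
    rw [show 2 * Real.pi / 3 = Real.pi - Real.pi / 3 by ring, Real.cos_pi_sub,
      Real.cos_pi_div_three]
  have sin2 : Real.sin (2 * Real.pi / 3) = Real.sqrt 3 / 2 := by
    rw [show 2 * Real.pi / 3 = Real.pi - Real.pi / 3 by ring, Real.sin_pi_sub,
      Real.sin_pi_div_three]
  simp only [fill, wp_cons, wp_block_cons, wp_block_nil, wp_add, wp_rstore, wp_copy, wp_rofNat,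
    wp_radd, wp_rmul, wp_rcopy, wp_rsub, State.setReg_reg, State.setRMem_reg, State.setReg_rreg,
    State.setRMem_rreg,
    State.setRReg_rreg, Nat.reduceEqDiff, if_true, if_false, h2, h3, h7, hc.rreg3, hc.rreg5,
    hc.rreg6]
  refine ⟨by omega, by omega, by omega, by omega, by omega, ?_⟩
  refine wp_emit (-(Real.pi / 2)) (by simp [hc.rreg9]) (by simp [cos0]) (by simp [sin0]) ?_
  have e5 : c + c + (c + c) + c = 5 * c := by omega
  intro t₁ r₁ m₁ f₁ e₁
  replace r₁ : ∀ r, t₁.reg r = if r = 20 then 5 * c + 2 else if r = 21 then 5 * c + 1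
      else s.reg r := by
    intro r; rw [r₁]; simp [e5]; split_ifs <;> simp
  replace m₁ : t₁.mem = s.mem := m₁
  have f₁' : ∀ r, r ≤ 19 → t₁.rreg r = s.rreg r := by
    intro r hr
    rw [f₁ r (by omega)]
    simp [show r ≠ 20 by omega, show r ≠ 21 by omega, show r ≠ 22 by omega, show r ≠ 23 by omega]
  have g₁ : t₁.rreg 23 = i + 1 := by simp [f₁]
  clear f₁
  simp only [State.setRReg_rmem, State.setReg_rmem, State.setRMem_rmem, State.setReg_reg,
    State.setRReg_reg, State.setRMem_reg, State.setRReg_rreg, State.setReg_rreg,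
    State.setRMem_rreg, Nat.reduceEqDiff, if_true, if_false, e5, hf.x, hf.y, ← ptX_one,
    ← ptY_one] at e₁
  -- the two ways to choose the rotation for the second leaf continue in the same manner
  suffices tail : ∀ (t : State) (φ : ℝ), t.reg = t₁.reg → t.mem = t₁.mem → t.rmem = t₁.rmem →
      (∀ r, r ≤ 19 → t.rreg r = s.rreg r) → t.rreg 23 = i + 1 → t.rreg 20 = Real.cos φ →
      Real.sin φ = Real.sqrt 3 / 2 →
      t.rreg 21 - (i + 1 + 1) * tick N + φ = leafAngle N d (i + 1) 2 →
      wp w (.ofList [.block [add 20 20 7, rcopy 22 7, radd 23 23 6, rmul 24 23 3, rsub 21 21 24],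
        emit, .block [add 20 20 7, rcopy 20 8, radd 23 23 8, rmul 24 23 3, rsub 21 10 24], emit])
        (Filled N d i c s) t by
    have h11 : s.reg 11 = 1 ↔ armed d (i + 1) = true := by
      rw [hf.flag]; cases armed d (i + 1) <;> simp
    simp only [wp_cons _ _ _ (.ite _ _ _), wp_ite, holds_eq, wp_block_cons, wp_block_nil, wp_rcopy,
      wp_radd, wp_rsub, r₁, Nat.reduceEqDiff, if_false, h7, h11]
    refine ⟨fun ha => tail _ (Real.pi / 3) rfl rfl rfl (fun r hr => ?_) ?_ ?_ ?_ ?_,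
      fun ha => tail _ (2 * Real.pi / 3) rfl rfl rfl (fun r hr => ?_) ?_ ?_ ?_ ?_⟩
    · simp [show r ≠ 20 by omega, show r ≠ 21 by omega, f₁' r hr]
    · simp [g₁]
    · simp [f₁', hc.rreg8]
    · exact Real.sin_pi_div_three
    · simp [f₁', hf.dir, hc.rreg4, leafAngle, ha]
    · simp [show r ≠ 20 by omega, show r ≠ 21 by omega, f₁' r hr]
    · simp [g₁]
    · simp [f₁', hc.rreg5, hc.rreg8, cos2]
    · exact sin2
    · simp [f₁', hf.dir, leafAngle, ha]
  clear f₁' g₁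
  intro t φ rt mt wt ft gt hcos hsin hφ
  simp only [wp_cons, wp_block_cons, wp_block_nil, wp_add, wp_radd, wp_rmul, wp_rcopy, wp_rsub,
    State.setReg_rreg, State.setRReg_rreg, Nat.reduceEqDiff, if_true, if_false, rt, r₁, h7, gt,
    ft 3 (by norm_num), ft 6 (by norm_num), hc.rreg3, hc.rreg6]
  refine ⟨by omega, wp_emit φ (by simp [ft, hc.rreg9]) (by simp [hcos])
    (by simp [ft, hc.rreg7, hsin]) ?_⟩
  intro t₂ r₂ m₂ f₂ e₂
  replace r₂ : ∀ r, t₂.reg r = if r = 20 then 5 * c + 3 else if r = 21 then 5 * c + 1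
      else s.reg r := by
    intro r; rw [r₂]; simp [rt, r₁]; split_ifs <;> simp
  replace m₂ : t₂.mem = s.mem := m₂.trans (mt.trans m₁)
  have f₂' : ∀ r, r ≤ 19 → t₂.rreg r = s.rreg r := by
    intro r hr
    rw [f₂ r (by omega)]
    simp [show r ≠ 21 by omega, show r ≠ 22 by omega, show r ≠ 23 by omega,
      show r ≠ 24 by omega, ft r hr]
  have g₂ : t₂.rreg 23 = i + 1 + 1 := by simp [f₂]
  have q₂ : t₂.rreg 22 = Real.sqrt 3 / 2 := by simp [f₂, ft, hc.rreg7]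
  clear f₂
  simp only [State.setRReg_rmem, State.setReg_rmem, State.setReg_reg,
    State.setRReg_reg, State.setRReg_rreg, State.setReg_rreg, Nat.reduceEqDiff, if_true, if_false,
    hφ, wt, e₁, ft 11 (by norm_num), ft 12 (by norm_num), hf.x, hf.y] at e₂
  clear ft gt
  simp only [wp_cons, wp_block_cons, wp_block_nil, wp_add, wp_radd, wp_rmul, wp_rcopy, wp_rsub,
    State.setReg_rreg, State.setRReg_rreg, Nat.reduceEqDiff, if_true, if_false, r₂, h7, g₂,
    f₂' 3 (by norm_num), f₂' 8 (by norm_num), f₂' 10 (by norm_num), hc.rreg3, hc.rreg8, hf.dir]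
  refine ⟨by omega, wp_emit (Real.pi / 3) (by simp [f₂', hc.rreg9]) (by simp)
    (by simp [q₂]) ?_⟩
  intro t₃ r₃ m₃ f₃ e₃
  replace r₃ : ∀ r, t₃.reg r = if r = 20 then 5 * c + 4 else if r = 21 then 5 * c + 1
      else s.reg r := by
    intro r; rw [r₃]; simp [r₂]; split_ifs <;> simp
  have f₃' : ∀ r, r ≤ 19 → t₃.rreg r = s.rreg r := by
    intro r hr
    rw [f₃ r (by omega)]
    simp [show r ≠ 20 by omega, show r ≠ 21 by omega, show r ≠ 23 by omega,
      show r ≠ 24 by omega, f₂' r hr]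
  clear f₃
  simp only [State.setRReg_rmem, State.setReg_rmem, State.setReg_reg,
    State.setRReg_reg, State.setRReg_rreg, State.setReg_rreg, Nat.reduceEqDiff, if_true, if_false,
    e₂, f₂' 11 (by norm_num), f₂' 12 (by norm_num), hf.x, hf.y] at e₃
  have hφ' : dir N d (i + 1) - (i + 1 + 1 + 1 / 2) * tick N + Real.pi / 3 =
      leafAngle N d (i + 1) 3 := by
    simp only [leafAngle]
    push_cast
    ring
  rw [hφ'] at e₃
  rw [wp_nil]
  have n₁ : 5 * c ≠ 5 * c + 1 + 1 := by omega
  have n₂ : 5 * c ≠ 5 * c + 2 + 1 := by omega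
  have n₃ : 5 * c ≠ 5 * c + 3 + 1 := by omega
  refine ⟨fun r hr => ?_, m₃.trans m₂, f₃', by simp [r₃], by simp [e₃], by simp [e₃],
    by simp [e₃, n₁, n₂, n₃], by simp [e₃, n₁, n₂, n₃], fun κ h1 h3 => ?_, fun κ h1 h3 => ?_,
    fun a j ha hj => ?_, fun a j ha hj => ?_⟩
  · simp [r₃, show r ≠ 20 by omega, show r ≠ 21 by omega]
  · obtain rfl | rfl | rfl : κ = 1 ∨ κ = 2 ∨ κ = 3 := by omega
    · simp [e₃]
    · simp [e₃, ptX]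
    · simp [e₃, ptX]
  · obtain rfl | rfl | rfl : κ = 1 ∨ κ = 2 ∨ κ = 3 := by omega
    · simp [e₃]
    · simp [e₃, ptY]
    · simp [e₃, ptY]
  · simp [e₃, hj, show a ≠ 3 by omega, show a ≠ 2 by omega]
  · simp [e₃, show a ≠ 0 by omega, show a ≠ 1 by omega, show j ≠ 5 * c + 1 + 1 by omega,
      show j ≠ 5 * c + 2 + 1 by omega, show j ≠ 5 * c + 3 + 1 by omega, show j ≠ 5 * c by omega]

theorem wp_advance {w N : ℕ} {d : ℕ → ℕ} {j c : ℕ} {s : State} (h3 : s.reg 3 = c)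
    (hd : s.mem 2 c = d j) (hc : HasConstants N s) (hf : HasFrame N d j s) :
    wp w advance (fun t => (∀ r, r ≠ 11 → r ≠ 13 → t.reg r = s.reg r) ∧ t.mem = s.mem ∧
      t.rmem = s.rmem ∧ (∀ r, r ≤ 9 → t.rreg r = s.rreg r) ∧ HasFrame N d (j + 1) t) s := by
  -- `simp` must not look inside the postcondition
  obtain ⟨Q, hQ⟩ : ∃ Q : State → Prop, ∀ t, Q t ↔
    (∀ r, r ≠ 11 → r ≠ 13 → t.reg r = s.reg r) ∧ t.mem = s.mem ∧
      t.rmem = s.rmem ∧ (∀ r, r ≤ 9 → t.rreg r = s.rreg r) ∧ HasFrame N d (j + 1) t :=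
    ⟨_, fun _ => Iff.rfl⟩
  refine wp_mono (Q := Q) ?_ fun t => (hQ t).1
  have ha : armed d (j + 1) = if d j = 5 then true else if d j ≤ 3 then false else armed d j := rfl
  have hdir : dir N d (j + 1) = if d j = 5 then dir N d j - bend N else dir N d j := rfl
  have hx : spineX N d (j + 1) = spineX N d j + 2 * Real.cos (dir N d (j + 1)) := rfl
  have hy : spineY N d (j + 1) = spineY N d j + 2 * Real.sin (dir N d (j + 1)) := rfl
  simp only [advance, wp_cons, wp_block_cons, wp_block_nil, wp_load, wp_ite, holds_lt, holds_eq,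
    wp_const, wp_rsub, wp_skip, wp_rcos, wp_rsin, wp_rmul, wp_radd, wp_nil, State.setReg_reg,
    Nat.reduceEqDiff, if_true, if_false, h3, hd, hc.reg14, hc.reg15, hQ]
  have frame : ∀ r, r ≤ 9 → r ≠ 10 ∧ r ≠ 11 ∧ r ≠ 12 ∧ r ≠ 24 := fun r hr => by omega
  refine ⟨fun h1 => ?_, fun h1 => ⟨fun h2 => ?_, fun h2 => ?_⟩⟩
  · have n5 : d j ≠ 5 := by omega
    have l3 : d j ≤ 3 := by omega
    rw [if_neg n5] at ha hdir
    rw [if_pos l3] at ha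
    exact ⟨fun r h11 h13 => by simp [h11, h13], rfl, rfl, fun r hr => by simp [frame r hr],
      ⟨by simp [ha], by simp [hf.dir, hdir], by simp [hf.dir, hf.x, hc.rreg9, hx, hdir, mul_comm],
      by simp [hf.dir, hf.y, hc.rreg9, hy, hdir, mul_comm]⟩⟩
  · rw [if_pos h2] at ha hdir
    exact ⟨fun r h11 h13 => by simp [h11, h13], rfl, rfl, fun r hr => by simp [frame r hr],
      ⟨by simp [ha], by simp [hf.dir, hc.rreg4, hdir],
      by simp [hf.dir, hf.x, hc.rreg9, hc.rreg4, hx, hdir, mul_comm],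
      by simp [hf.dir, hf.y, hc.rreg9, hc.rreg4, hy, hdir, mul_comm]⟩⟩
  · have l3 : ¬ d j ≤ 3 := by omega
    rw [if_neg h2] at ha hdir
    rw [if_neg l3] at ha
    exact ⟨fun r h11 h13 => by simp [h13], rfl, rfl, fun r hr => by simp [frame r hr],
      ⟨by simp [ha, hf.flag], by simp [hf.dir, hdir],
      by simp [hf.dir, hf.x, hc.rreg9, hx, hdir, mul_comm],
      by simp [hf.dir, hf.y, hc.rreg9, hy, hdir, mul_comm]⟩⟩

theorem wp_close {w : ℕ} {s : State} {i k b : ℕ} {x y : ℝ} (h2 : s.reg 2 = i) (h7 : s.reg 7 = 1)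
    (h8 : s.reg 8 = k) (h16 : s.reg 16 = 0) (h21 : s.reg 21 = b) (h5 : s.rreg 5 = 0)
    (h11 : s.rreg 11 = x) (h12 : s.rreg 12 = y) :
    wp w close (fun t => t.reg = s.reg ∧ t.mem = s.mem ∧ t.rreg = s.rreg ∧ ∀ a j, t.rmem a j =
      if a = 2 ∧ j = b then if i = 0 ∧ 1 < k then 0 else x
      else if a = 3 ∧ j = b then if i = 0 ∧ 1 < k then 0 else y else s.rmem a j) s := by
  simp only [close, wp_ite, holds_eq, holds_lt, wp_block_cons, wp_block_nil, wp_rstore, h2, h7, h8,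
    h16, h21, h5, h11, h12, State.setRMem_rmem, State.setRMem_reg, State.setRMem_rreg,
    State.setRMem_mem, true_and]
  refine ⟨fun h0 => ⟨fun h1 a j => ?_, fun h1 a j => ?_⟩, fun h0 a j => ?_⟩ <;>
    · split_ifs <;> first | rfl | omega

/-- Compute the points for the current spine vertex and its leaves, and move on. -/
def draw : Prog := .ofList [fill, advance, close]

variable {n : ℕ} {G : SimpleGraph (Fin n)} [DecidableRel G.Adj] {E : List (Fin n × Fin n)} {k : ℕ}

/-- The points for the first `i` spine vertices are in the real arrays `0` and `1`, the points for
their leaves in the arrays `2` and `3`. -/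
structure HasPoints (N : ℕ) (v : InnerPath G k) (i : ℕ) (s : State) : Prop where
  spine_x : ∀ j : Fin k, j.val < i → s.rmem 0 (v j : Fin n) = ptX N (degSeq v) (j.val + 1) 0
  spine_y : ∀ j : Fin k, j.val < i → s.rmem 1 (v j : Fin n) = ptY N (degSeq v) (j.val + 1) 0
  slot_x : ∀ j : Fin k, j.val < i → ∀ m < 5, s.rmem 2 (5 * (v j : Fin n) + m) =
    ptX N (degSeq v) (slotPlace k j m).1 (slotPlace k j m).2
  slot_y : ∀ j : Fin k, j.val < i → ∀ m < 5, s.rmem 3 (5 * (v j : Fin n) + m) =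
    ptY N (degSeq v) (slotPlace k j m).1 (slotPlace k j m).2

/-- What the walk of the construction maintains. -/
structure Drawn (N : ℕ) (v : InnerPath G k) (i : ℕ) (s : State) : Prop
    extends HasConstants N s, HasFrame N (degSeq v) (i + 1) s, HasPoints N v i s

theorem wp_draw {w N : ℕ} {v : InnerPath G k} (hw : 10 * n ≤ w) {i : ℕ} (hi : i < k)
    {s : State} (h : AtSpine E v i s) (hs : Drawn N v i s) :
    wp w draw (fun t => (∀ r, r ≤ 10 → t.reg r = s.reg r) ∧ t.mem = s.mem ∧
      Drawn N v (i + 1) t) s := by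
  obtain ⟨c, hc⟩ : ∃ c : Fin n, c = v ⟨i, hi⟩ := ⟨_, rfl⟩
  have hcn := c.2
  have h3 : s.reg 3 = c := by rw [h.reg3 hi, hc]
  have hne : ∀ j : Fin k, j.val < i → (v j : Fin n) ≠ c := fun j hj e => by
    rw [hc] at e
    have := congrArg Fin.val (spine_injective v e)
    simp at this
    omega
  rw [draw, wp_cons]
  refine wp_mono (wp_fill (by omega) h.reg2 h3 h.reg7 hs.toHasConstants hs.toHasFrame)
    fun t ht => ?_
  have tc := hs.toHasConstants.congr (fun r _ hr => ht.reg r (by omega))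
    fun r hr => ht.rreg r (by omega)
  have tf : HasFrame N (degSeq v) (i + 1) t :=
    ⟨by simp [ht.reg, hs.flag], by simp [ht.rreg, hs.dir],
      by rw [ht.rreg _ (by norm_num), hs.x],
      by rw [ht.rreg _ (by norm_num), hs.y]⟩
  rw [wp_cons]
  refine wp_mono (wp_advance (c := c) (by simp [ht.reg, h3])
    (by rw [ht.mem, h.deg, hc, degSeq_succ v ⟨i, hi⟩]) tc tf) fun u hu => ?_
  obtain ⟨ur, um, uw, ux, uf⟩ := hu
  have uc := tc.congr (fun r _ hr => ur r (by omega) (by omega)) ux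
  rw [wp_cons]
  refine wp_mono (wp_close (i := i) (k := k) (b := 5 * c + 1)
    (by simp [ur, ht.reg, h.reg2]) (by simp [ur, ht.reg, h.reg7]) (by simp [ur, ht.reg, h.reg8])
    uc.reg16 (by simp [ur, ht.reg21]) uc.rreg5 uf.x uf.y)
    fun z hz => ?_
  obtain ⟨zr, zm, zx, zw⟩ := hz
  rw [wp_nil]
  have zc := uc.congr (fun r _ _ => by rw [zr]) fun r _ => by rw [zx]
  refine ⟨fun r hr => ?_, zm.trans (um.trans ht.mem), ⟨zc, ?_, ?_⟩⟩
  · rw [zr, ur r (by omega) (by omega), ht.reg r (by omega)]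
  · exact ⟨by rw [zr, uf.flag], by rw [zx, uf.dir], by rw [zx, uf.x], by rw [zx, uf.y]⟩
  · have low : ∀ a j, a < 2 → z.rmem a j = t.rmem a j := fun a j ha => by
      rw [zw, uw]; simp [show a ≠ 2 by omega, show a ≠ 3 by omega]
    have high : ∀ a m, m ≠ 1 → z.rmem a (5 * c + m) = t.rmem a (5 * c + m) := fun a m hm => by
      rw [zw, uw]; simp [hm]
    have away : ∀ a j : ℕ, 2 ≤ a → (j < 5 * (c : ℕ) ∨ 5 * (c : ℕ) + 5 ≤ j) →
        z.rmem a j = s.rmem a j := fun a j ha hj => by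
      rw [zw, uw, if_neg (by omega), if_neg (by omega), ht.other_slots a j ha hj]
    have cases : ∀ j : Fin k, j.val < i + 1 → j.val < i ∨ j = ⟨i, hi⟩ := fun j hj => by
      rcases Nat.lt_succ_iff_lt_or_eq.1 hj with h' | h'
      · exact Or.inl h'
      · exact Or.inr (Fin.ext h')
    have apart : ∀ j : Fin k, j.val < i → ∀ m < 5, 5 * ((v j : Fin n) : ℕ) + m < 5 * (c : ℕ) ∨
        5 * (c : ℕ) + 5 ≤ 5 * ((v j : Fin n) : ℕ) + m := fun j hj m hm => by
      have := Fin.val_ne_of_ne (hne j hj)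
      omega
    have p0 : ∀ i', ptX N (degSeq v) i' 0 = spineX N (degSeq v) i' ∧
        ptY N (degSeq v) i' 0 = spineY N (degSeq v) i' := fun i' => by simp [ptX, ptY]
    refine ⟨fun j hj => ?_, fun j hj => ?_, fun j hj m hm => ?_, fun j hj m hm => ?_⟩
    · rcases cases j hj with hj | rfl
      · rw [low _ _ (by norm_num), ht.other_points _ _ (by norm_num)
          (Fin.val_ne_of_ne (hne j hj)), hs.spine_x j hj]
      · rw [← hc, low _ _ (by norm_num), ht.x, (p0 _).1]
    · rcases cases j hj with hj | rfl
      · rw [low _ _ (by norm_num), ht.other_points _ _ (by norm_num)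
          (Fin.val_ne_of_ne (hne j hj)), hs.spine_y j hj]
      · rw [← hc, low _ _ (by norm_num), ht.y, (p0 _).2]
    · rcases cases j hj with hj | rfl
      · rw [away _ _ le_rfl (apart j hj m hm), hs.slot_x j hj m hm]
      · rw [← hc]
        obtain rfl | rfl | h2 : m = 0 ∨ m = 1 ∨ 2 ≤ m := by omega
        · rw [high _ _ (by norm_num), add_zero, ht.x_zero]
          simp [slotPlace, ptX, spineX]
        · rw [zw]
          simp only [slotPlace]
          by_cases h01 : i = 0 ∧ 1 < k <;> simp [h01, ptX, spineX]
        · rw [high _ _ (by omega)]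
          have := ht.x_leaf (m - 1) (by omega) (by omega)
          rw [show m - 1 + 1 = m by omega] at this
          simp [slotPlace, h2, this]
    · rcases cases j hj with hj | rfl
      · rw [away _ _ (by norm_num) (apart j hj m hm), hs.slot_y j hj m hm]
      · rw [← hc]
        obtain rfl | rfl | h2 : m = 0 ∨ m = 1 ∨ 2 ≤ m := by omega
        · rw [high _ _ (by norm_num), add_zero, ht.y_zero]
          simp [slotPlace, ptY, spineY]
        · rw [zw]
          simp only [slotPlace]
          by_cases h01 : i = 0 ∧ 1 < k <;> simp [h01, ptY, spineY]
        · rw [high _ _ (by omega)]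
          have := ht.y_leaf (m - 1) (by omega) (by omega)
          rw [show m - 1 + 1 = m by omega] at this
          simp [slotPlace, h2, this]

end RealRAM

/-! ### The construction program -/

namespace RealRAM

open Instr Test Placement

/-- Give the leaf in register `y` the first free slot of the spine vertex in register `c`. -/
def placeLeaf (y c : ℕ) : Prog :=
  .block [load 13 3 c, add 20 c c, add 20 20 20, add 20 20 c, add 20 20 13, rload 20 2 20,
    rstore 0 y 20, rload 20 3 20, rstore 1 y 20, add 13 13 7, store 3 c 13]

/-- Place the leaf, if there is one, of the edge in register `2`. -/
def leafBody : Prog :=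
  .ofList [.block [load 3 0 2, load 4 1 2, load 5 2 3, load 6 2 4],
    .ite (.eq 5 7) (placeLeaf 3 4) (.ite (.eq 6 7) (placeLeaf 4 3) .skip),
    .block [add 2 2 7]]

/-- Compute the constants of the construction, and the frame for the first spine vertex. -/
def setup : Prog :=
  .block [const 14 4, const 15 5, const 16 0, const 11 0, add 17 0 7, rofNat 25 17, rconst 5 0,
    rconst 6 1, rconst 9 2, rdiv 8 6 9, rconst 7 3, rsqrt 7 7, rmul 7 7 8, rconst 26 1000,
    rmul 26 26 25, rmul 26 26 25, rdiv 3 6 26, rmul 4 9 25, rmul 4 4 3, rconst 10 0, rconst 11 2,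
    rconst 12 0]

/-- Computes the disk centres of a unit disk contact representation of a caterpillar. -/
def construction : Prog :=
  .ofList [prep, setup, .ite (.eq 8 16)
    (.block [rstore 0 16 5, rstore 1 16 5, rstore 0 7 9, rstore 1 7 5])
    (.ofList [walk draw, .block [const 2 0], .loop (.lt 2 1) leafBody])]

/-- The effect of placing the leaf `y` next to the spine vertex `c`. -/
structure Placed (y c : ℕ) (s t : State) : Prop where
  reg : ∀ r, r ≤ 10 → t.reg r = s.reg r
  mem : ∀ a j, t.mem a j = if a = 3 ∧ j = c then s.mem 3 c + 1 else s.mem a j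
  rmem : ∀ a j, t.rmem a j = if a = 1 ∧ j = y then s.rmem 3 (5 * c + s.mem 3 c)
    else if a = 0 ∧ j = y then s.rmem 2 (5 * c + s.mem 3 c) else s.rmem a j

theorem wp_placeLeaf {w x z y c : ℕ} {s : State} (hx : x ≤ 10) (hz : z ≤ 10) (hy : s.reg x = y)
    (hc : s.reg z = c) (h7 : s.reg 7 = 1) (hw : 5 * c + s.mem 3 c + 1 ≤ w) :
    wp w (placeLeaf x z) (Placed y c s) s := by
  have e5 : c + c + (c + c) + c = 5 * c := by omega
  simp only [placeLeaf, wp_block_cons, wp_block_nil, wp_load, wp_add, wp_rload, wp_rstore, wp_store,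
    State.setReg_reg, State.setRReg_reg, State.setRMem_reg, State.setReg_rmem, State.setRReg_rreg,
    State.setRReg_rmem, State.setRMem_rmem, Nat.reduceEqDiff, if_true, if_false,
    show x ≠ 13 by omega, show x ≠ 20 by omega, show z ≠ 13 by omega, show z ≠ 20 by omega, hy,
    hc, h7, e5, false_and]
  refine ⟨by omega, by omega, by omega, by omega, by omega, fun r hr => ?_, fun a j => ?_,
    fun a j => ?_⟩
  · simp [show r ≠ 13 by omega, show r ≠ 20 by omega]
  · simp
  · simp

variable {n : ℕ} {G : SimpleGraph (Fin n)} [DecidableRel G.Adj] {E : List (Fin n × Fin n)} {k : ℕ}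

/-- Slots for the leaves on the first `i` edges, which are the leaves `x` for which the sum of ones
over these edges at `x` does not vanish. The slots are distinct for leaves with a common
neighbour, and the leaf is at the point of its slot. -/
structure SlotsUpTo (G : SimpleGraph (Fin n)) [DecidableRel G.Adj] (E : List (Fin n × Fin n))
    (i : ℕ) (s : State) (σ : Fin n → ℕ) : Prop where
  bounds : ∀ c x, G.degree c ≠ 1 → G.degree x = 1 → G.Adj c x →
    edgeSum (fun _ => 1) (E.take i) x ≠ 0 → innerDegree G c ≤ σ x ∧ σ x < s.mem 3 c
  injective : ∀ c x y, G.degree c ≠ 1 → G.degree x = 1 → G.degree y = 1 → G.Adj c x → G.Adj c y →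
    edgeSum (fun _ => 1) (E.take i) x ≠ 0 → edgeSum (fun _ => 1) (E.take i) y ≠ 0 →
    σ x = σ y → x = y
  point : ∀ c x : Fin n, G.degree c ≠ 1 → G.degree x = 1 → G.Adj c x →
    edgeSum (fun _ => 1) (E.take i) x ≠ 0 →
    s.rmem 0 x = s.rmem 2 (5 * c + σ x) ∧ s.rmem 1 x = s.rmem 3 (5 * c + σ x)

/-- The leaves on the first `i` edges have been placed. -/
structure LeavesPlaced (N : ℕ) (v : InnerPath G k) (E : List (Fin n × Fin n)) (i : ℕ)
    (s : State) : Prop extends HasDegrees G E s, HasPoints N v k s where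
  count : ∀ x : Fin n, G.degree x ≠ 1 → s.mem 3 x = innerDegree G x +
    edgeSum (fun y => if G.degree y = 1 then 1 else 0) (E.take i) x
  slots : ∃ σ, SlotsUpTo G E i s σ

/-- As long as a leaf of `c` is still to come, `c` has a free slot. -/
theorem LeavesPlaced.count_lt {N : ℕ} {v : InnerPath G k} {i : ℕ} {s : State}
    (h : LeavesPlaced N v E i s) (hE : IsEdgeList G E) {y c : Fin n} (hy : G.degree y = 1)
    (hc : G.degree c ≠ 1)
    (hsum : ∀ f x, edgeSum f (E.take (i + 1)) x = edgeSum f (E.take i) x +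
      ((if y = x then f c else 0) + if c = x then f y else 0)) : s.mem 3 c < G.degree c := by
  have h1 := edgeSum_leaf hE c
  have h2 := edgeSum_take_le (E := E) (fun y => if G.degree y = 1 then 1 else 0) c (i + 1)
  rw [hsum] at h2
  rw [h.count c hc]
  simp only [if_true, hy] at h2
  omega

theorem LeavesPlaced.place {N : ℕ} {v : InnerPath G k} {i : ℕ} {s t : State}
    (h : LeavesPlaced N v E i s) {y c : Fin n} (hy : G.degree y = 1) (hc : G.degree c ≠ 1)
    (hyc : G.Adj y c)
    (hsum : ∀ f x, edgeSum f (E.take (i + 1)) x = edgeSum f (E.take i) x +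
      ((if y = x then f c else 0) + if c = x then f y else 0))
    (ht : HasInput E t)
    (hmem : ∀ a j, t.mem a j = if a = 3 ∧ j = (c : ℕ) then s.mem 3 c + 1 else s.mem a j)
    (hrmem : ∀ a j, t.rmem a j = if a = 1 ∧ j = (y : ℕ) then s.rmem 3 (5 * c + s.mem 3 c)
      else if a = 0 ∧ j = (y : ℕ) then s.rmem 2 (5 * c + s.mem 3 c) else s.rmem a j) :
    LeavesPlaced N v E (i + 1) t := by
  have hne : c ≠ y := fun e => hc (e ▸ hy)
  have htable : ∀ a j, 2 ≤ a → t.rmem a j = s.rmem a j := fun a j ha => by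
    rw [hrmem, if_neg (by omega), if_neg (by omega)]
  have hpoint : ∀ a (x : Fin n), x ≠ y → t.rmem a x = s.rmem a x := fun a x hx => by
    have := Fin.val_ne_of_ne hx
    rw [hrmem, if_neg (by omega), if_neg (by omega)]
  have hspine : ∀ j, (v j : Fin n) ≠ y := fun j e => spine_degree_ne_one v j (e ▸ hy)
  have hold : ∀ x, G.degree x = 1 → x ≠ y → edgeSum (fun _ => 1) (E.take (i + 1)) x ≠ 0 →
      edgeSum (fun _ => 1) (E.take i) x ≠ 0 := fun x hx hxy h' => by
    have hcx : c ≠ x := fun e => hc (e ▸ hx)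
    rw [hsum, if_neg hxy.symm, if_neg hcx] at h'
    exact h'
  have hmono : ∀ x : Fin n, s.mem 3 x ≤ t.mem 3 x := fun x => by
    rw [hmem]
    split_ifs with h'
    · rw [h'.2]; omega
    · exact le_rfl
  have hcen : ∀ b, G.Adj b y → b = c := fun b hb => eq_of_degree_eq_one hy hb.symm hyc
  have hcount : innerDegree G c ≤ s.mem 3 c := by rw [h.count c hc]; omega
  obtain ⟨σ, hσ⟩ := h.slots
  refine ⟨⟨ht, fun x => by rw [hmem, if_neg (by omega), h.deg]⟩, ⟨fun j hj => ?_, fun j hj => ?_,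
    fun j hj m hm => ?_, fun j hj m hm => ?_⟩, fun x hx => ?_,
    Function.update σ y (s.mem 3 c), ⟨?_, ?_, ?_⟩⟩
  · rw [hpoint _ _ (hspine j), h.spine_x j hj]
  · rw [hpoint _ _ (hspine j), h.spine_y j hj]
  · rw [htable _ _ le_rfl, h.slot_x j hj m hm]
  · rw [htable _ _ (by norm_num), h.slot_y j hj m hm]
  · have hyx : y ≠ x := fun e => hx (e ▸ hy)
    rw [hmem, hsum, if_neg hyx]
    by_cases hcx : c = x
    · subst hcx
      simp [h.count c hc, hy]
      omega
    · have : (x : ℕ) ≠ c := fun e => hcx (Fin.ext e.symm)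
      simp [this, hcx, h.count x hx]
  · intro b x hb hx hbx hd
    by_cases hxy : x = y
    · subst hxy
      rw [hcen b hbx, Function.update_self, hmem]
      simp
      exact hcount
    · rw [Function.update_of_ne hxy]
      have := hσ.bounds b x hb hx hbx (hold x hx hxy hd)
      exact ⟨this.1, this.2.trans_le (hmono b)⟩
  · intro b x z hb hx hz hbx hbz hdx hdz hxz
    by_cases hxy : x = y <;> by_cases hzy : z = y
    · rw [hxy, hzy]
    · subst hxy
      rw [Function.update_self, Function.update_of_ne hzy] at hxz
      have := (hσ.bounds b z hb hz hbz (hold z hz hzy hdz)).2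
      rw [hcen b hbx] at this
      omega
    · subst hzy
      rw [Function.update_self, Function.update_of_ne hxy] at hxz
      have := (hσ.bounds b x hb hx hbx (hold x hx hxy hdx)).2
      rw [hcen b hbz] at this
      omega
    · rw [Function.update_of_ne hxy, Function.update_of_ne hzy] at hxz
      exact hσ.injective b x z hb hx hz hbx hbz (hold x hx hxy hdx) (hold z hz hzy hdz) hxz
  · intro b x hb hx hbx hd
    rw [htable 2 _ le_rfl, htable 3 _ (by norm_num)]
    by_cases hxy : x = y
    · subst hxy
      rw [hcen b hbx, Function.update_self, hrmem, hrmem]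
      simp
    · rw [Function.update_of_ne hxy, hpoint _ _ hxy, hpoint _ _ hxy]
      exact hσ.point b x hb hx hbx (hold x hx hxy hd)

theorem LeavesPlaced.skip {N : ℕ} {v : InnerPath G k} {i : ℕ} {s t : State}
    (h : LeavesPlaced N v E i s) {a b : Fin n} (ha : G.degree a ≠ 1) (hb : G.degree b ≠ 1)
    (hsum : ∀ f x, edgeSum f (E.take (i + 1)) x = edgeSum f (E.take i) x +
      ((if a = x then f b else 0) + if b = x then f a else 0))
    (ht : HasInput E t) (hmem : t.mem = s.mem) (hrmem : t.rmem = s.rmem) :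
    LeavesPlaced N v E (i + 1) t := by
  have hold : ∀ x, G.degree x = 1 →
      edgeSum (fun _ => 1) (E.take (i + 1)) x = edgeSum (fun _ => 1) (E.take i) x := fun x hx => by
    have hax : a ≠ x := fun e => ha (e ▸ hx)
    have hbx : b ≠ x := fun e => hb (e ▸ hx)
    rw [hsum, if_neg hax, if_neg hbx, add_zero, add_zero]
  obtain ⟨σ, hσ⟩ := h.slots
  refine ⟨⟨ht, by rw [hmem]; exact h.deg⟩, ⟨by rw [hrmem]; exact h.spine_x,
    by rw [hrmem]; exact h.spine_y, by rw [hrmem]; exact h.slot_x, by rw [hrmem]; exact h.slot_y⟩,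
    fun x hx => ?_, σ, ⟨?_, ?_, ?_⟩⟩
  · rw [hmem, hsum, h.count x hx]
    simp [ha, hb]
  · intro c x hc hx hcx hd
    rw [hmem]
    exact hσ.bounds c x hc hx hcx (by rwa [← hold x hx])
  · intro c x y hc hx hy hcx hcy hdx hdy
    exact hσ.injective c x y hc hx hy hcx hcy (by rwa [← hold x hx]) (by rwa [← hold y hy])
  · intro c x hc hx hcx hd
    rw [hrmem]
    exact hσ.point c x hc hx hcx (by rwa [← hold x hx])

theorem runs_leaf_loop {w N : ℕ} (hG : G.IsTree) (v : InnerPath G k) (hk : 0 < k)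
    (hE : IsEdgeList G E) (hw : 10 * n ≤ w) {s : State} (h2 : s.reg 2 = 0)
    (hs : LeavesPlaced N v E 0 s) :
    Runs w (.loop (.lt 2 1) leafBody) s (E.length * (leafBody.cost + 1) + 1)
      (LeavesPlaced N v E E.length) := by
  have hn := length_edgeList hE hG
  refine (Runs.forLoop (fun i s => s.reg 2 = i ∧ LeavesPlaced N v E i s) ?_ ?_ ⟨h2, hs⟩).mono
    le_rfl fun s h => h.2
  · rintro i s ⟨h2, h⟩
    exact ⟨h2, h.reg1⟩
  rintro i hi s ⟨h2, h⟩
  have hadj := hE.adj (List.getElem_mem hi)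
  have e1 := h.mem0 i hi
  have e2 := h.mem1 i hi
  have hsum : ∀ f x, edgeSum f (E.take (i + 1)) x = edgeSum f (E.take i) x +
      ((if E[i].1 = x then f E[i].2 else 0) + if E[i].2 = x then f E[i].1 else 0) :=
    fun f x => edgeSum_take_succ f x hi
  have hsum' : ∀ f x, edgeSum f (E.take (i + 1)) x = edgeSum f (E.take i) x +
      ((if E[i].2 = x then f E[i].1 else 0) + if E[i].1 = x then f E[i].2 else 0) :=
    fun f x => by rw [hsum, add_comm (ite (E[i].1 = x) _ _)]
  generalize E[i].1 = a at *
  generalize E[i].2 = b at *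
  have hcenter : ∀ x y, G.Adj x y → G.degree x = 1 → G.degree y ≠ 1 := fun x y hxy hx => by
    obtain ⟨j, hj⟩ := exists_spine_adj_of_leaf hG.connected v hk hx
    rw [eq_of_degree_eq_one hx hxy hj.symm]
    exact spine_degree_ne_one v j
  have hinput : ∀ (u : State) (m : ℕ), (∀ r, r ≤ 10 → r ≠ 2 → r ≠ 3 → r ≠ 4 → r ≠ 5 → r ≠ 6 →
      u.reg r = s.reg r) → u.mem 0 = s.mem 0 → u.mem 1 = s.mem 1 → HasInput E (u.setReg 2 m) := by
    intro u m hu h0 h1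
    exact ⟨by simp [hu, h.reg0], by simp [hu, h.reg1], by simp [hu, h.reg7], by simp [hu, h.reg10],
      by simpa [h0] using h.mem0, by simpa [h1] using h.mem1⟩
  have ha := a.2
  have hb := b.2
  have hdeg := fun x => (G.degree_lt_card_verts x).trans_eq (Fintype.card_fin n)
  refine runs_of_wp ?_
  simp only [leafBody, wp_cons, wp_block_cons, wp_block_nil, wp_load, wp_ite, holds_eq, wp_skip,
    State.setReg_reg, State.setReg_mem, Nat.reduceEqDiff, if_true, if_false, h2, e1, e2, h.deg,
    h.reg7]
  refine ⟨fun h5 => ?_, fun h5 => ⟨fun h6 => ?_, fun h6 => ?_⟩⟩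
  · have hc := hcenter a b hadj h5
    have hlt := h.count_lt hE h5 hc hsum
    have := hdeg b
    refine wp_mono (wp_placeLeaf (y := a) (c := b) (by norm_num) (by norm_num) (by simp) (by simp)
      (by simp [h.reg7]) (by simp; omega)) fun u hu => ?_
    have u2 : u.reg 2 = i := by simp [hu.reg, h2]
    have u7 : u.reg 7 = 1 := by simp [hu.reg, h.reg7]
    simp only [wp_cons, wp_block_cons, wp_block_nil, wp_nil, wp_add, u2, u7]
    refine ⟨by omega, by simp, h.place h5 hc hadj hsum (hinput u _ ?_ ?_ ?_) (by simp [hu.mem])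
      (by simp [hu.rmem])⟩
    · intro r h1 h2 h3 h4 h5 h6
      simp [hu.reg r h1, h3, h4, h5, h6]
    · ext j; simp [hu.mem]
    · ext j; simp [hu.mem]
  · have hc := hcenter b a hadj.symm h6
    have hlt := h.count_lt hE h6 hc hsum'
    have := hdeg a
    refine wp_mono (wp_placeLeaf (y := b) (c := a) (by norm_num) (by norm_num) (by simp) (by simp)
      (by simp [h.reg7]) (by simp; omega)) fun u hu => ?_
    have u2 : u.reg 2 = i := by simp [hu.reg, h2]
    have u7 : u.reg 7 = 1 := by simp [hu.reg, h.reg7]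
    simp only [wp_cons, wp_block_cons, wp_block_nil, wp_nil, wp_add, u2, u7]
    refine ⟨by omega, by simp, h.place h6 hc hadj.symm hsum' (hinput u _ ?_ ?_ ?_)
      (by simp [hu.mem]) (by simp [hu.rmem])⟩
    · intro r h1 h2 h3 h4 h5 h6
      simp [hu.reg r h1, h3, h4, h5, h6]
    · ext j; simp [hu.mem]
    · ext j; simp [hu.mem]
  · simp only [wp_add, State.setReg_reg, Nat.reduceEqDiff, if_false, h2, h.reg7]
    refine ⟨by omega, by simp, h.skip h5 h6 hsum (hinput _ _ ?_ rfl rfl) rfl rfl⟩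
    intro r h1 h2 h3 h4 h5 h6
    simp [h3, h4, h5, h6]

theorem LeavesPlaced.isUDCRepresentation {v : InnerPath G k} {s : State}
    (h : LeavesPlaced (n + 1) v E E.length s) (hG : G.IsTree) (hk : 0 < k) (hE : IsEdgeList G E)
    (hv : SpineCondition v) : IsUDCRepresentation G (outputPoints n s) := by
  have hdone : ∀ x, G.degree x = 1 → edgeSum (fun _ => 1) (E.take E.length) x ≠ 0 := fun x hx => by
    rw [List.take_length, edgeSum_one hE, hx]
    exact one_ne_zero
  have hcount : ∀ x, G.degree x ≠ 1 → s.mem 3 x = G.degree x := fun x hx => by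
    rw [h.count x hx, List.take_length, ← edgeSum_leaf hE x, add_comm]
  obtain ⟨σ, hσ⟩ := h.slots
  have hslot : IsSlotting v σ := by
    refine ⟨fun i x hx hi => ?_, fun i x y hx hy hi hj => ?_⟩
    · have hd := spine_degree_ne_one v i
      rw [← hcount _ hd]
      exact hσ.bounds _ x hd hx hi (hdone x hx)
    · exact hσ.injective _ x y (spine_degree_ne_one v i) hx hy hi hj (hdone x hx) (hdone y hy)
  refine isUDCRepresentation_of_slotting hG.connected v hk hv.admissible hv.1 hslot (N := n + 1)
    (by simp) (fun i => ?_) fun i x hx hi => ?_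
  · rw [outputPoints, h.spine_x i i.2, h.spine_y i i.2]
  · have h5 : σ x < 5 := (hslot.1 i x hx hi).2.trans_le (hv.1 i)
    have hp := hσ.point _ x (spine_degree_ne_one v i) hx hi (hdone x hx)
    rw [outputPoints, hp.1, hp.2, h.slot_x i i.2 _ h5, h.slot_y i i.2 _ h5]

theorem wp_setup {w : ℕ} {v : InnerPath G k} (hw : 10 * n ≤ w) (hn : 1 ≤ n) {s : State}
    (h : AtSpine E v 0 s) :
    wp w setup (fun t => AtSpine E v 0 t ∧ Drawn (n + 1) v 0 t) s := by
  have hN : (n : ℝ) + 1 ≠ 0 := by positivity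
  have ha : armed (degSeq v) 1 = false := by simp [armed, degSeq]
  have hd : dir (n + 1) (degSeq v) 1 = 0 := by simp [dir, degSeq]
  simp only [setup, wp_block_cons, wp_block_nil, wp_const, wp_add, wp_rofNat, wp_rconst, wp_rdiv,
    wp_rsqrt, wp_rmul, State.setReg_reg, State.setRReg_rreg, State.setReg_rreg,
    Nat.reduceEqDiff, if_true, if_false, h.reg0, h.reg7]
  refine ⟨by omega, by norm_num, by norm_num, ?_, ⟨⟨⟨⟨by simp [h.reg0], by simp [h.reg1],
    by simp [h.reg7], by simp [h.reg10], h.mem0, h.mem1⟩, h.deg⟩, h.cnt, h.sum⟩, by simp [h.reg2],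
    by simp [h.reg8], by simpa using h.reg3, by simpa using h.reg4⟩,
    ⟨by simp, by simp, by simp, ?_, ?_, by simp, by simp, ?_, by simp, by simp⟩,
    ⟨by simp [ha], by simp [hd], by simp [spineX, hd], by simp [spineY, hd]⟩,
    ⟨fun j hj => absurd hj (Nat.not_lt_zero _), fun j hj => absurd hj (Nat.not_lt_zero _),
      fun j hj => absurd hj (Nat.not_lt_zero _), fun j hj => absurd hj (Nat.not_lt_zero _)⟩⟩
  · push_cast
    positivity
  · simp [tick]
  · simp [bend, tick]
  · simp
    ring

/-- Without a spine there are exactly two vertices. -/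
theorem eq_two_of_spine_empty (hG : G.IsTree) (v : InnerPath G 0) (hn : 1 ≤ n) : n = 2 := by
  have hdeg : ∀ x, G.degree x = 1 := fun x => by
    by_contra hx
    obtain ⟨i, -⟩ := exists_spine_eq v hx
    exact i.elim0
  have hcomplete : G.neighborFinset ⟨0, hn⟩ = Finset.univ.erase ⟨0, hn⟩ := by
    ext y
    simp only [SimpleGraph.mem_neighborFinset, Finset.mem_erase, Finset.mem_univ, and_true]
    exact ⟨fun h => h.ne', fun h => adj_of_spine_empty hG.connected v h.symm⟩
  have h1 := hdeg ⟨0, hn⟩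
  rw [← SimpleGraph.card_neighborFinset_eq_degree, hcomplete,
    Finset.card_erase_of_mem (Finset.mem_univ _), Finset.card_univ, Fintype.card_fin] at h1
  omega

theorem isUDCRepresentation_of_spine_empty (hG : G.IsTree) (v : InnerPath G 0) (hn : n = 2)
    {s : State} (x0 : s.rmem 0 0 = 0) (y0 : s.rmem 1 0 = 0) (x1 : s.rmem 0 1 = 2)
    (y1 : s.rmem 1 1 = 0) : IsUDCRepresentation G (outputPoints n s) := by
  subst hn
  refine isUDCRepresentation_of_adj fun x y hxy =>
    ⟨adj_of_spine_empty hG.connected v hxy, ?_⟩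
  have h4 : Real.sqrt (2 ^ 2) = 2 := Real.sqrt_sq (by norm_num)
  rw [EuclideanSpace.dist_eq, Fin.sum_univ_two]
  fin_cases x <;> fin_cases y
  · exact absurd rfl hxy
  · simp [outputPoints, x0, y0, x1, y1, h4]
  · simp [outputPoints, x0, y0, x1, y1, h4]
  · exact absurd rfl hxy

theorem runs_construction {w : ℕ} (hG : G.IsTree) (v : InnerPath G k) (hE : IsEdgeList G E)
    (hU : IsUDCGraph G) (hw : 10 * n ≤ w) : Runs w construction (input E) (500 * n) fun s =>
      IsUDCRepresentation G (outputPoints n s) := by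
  have hn := length_edgeList hE hG
  have hkn := length_spine_le_card v
  rw [Fintype.card_fin] at hkn
  have c1 : setup.cost = 23 := rfl
  have c2 : draw.cost = 111 := rfl
  have c3 : leafBody.cost = 35 := rfl
  refine Runs.mono (T := 100 * n + (setup.cost + ((k * (draw.cost + 8) + 1 + (2 +
    ((E.length * (leafBody.cost + 1) + 1) + 1)) + 5 + 1) + 1)))
    (Runs.cons (runs_prep hG v hE hw) ?_) (by rw [c1, c2, c3]; omega) fun _ => id
  rintro s ⟨v, h⟩
  refine Runs.cons (runs_of_wp (wp_setup hw (by omega) h)) fun s hs => ?_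
  refine Runs.cons (R := fun s => IsUDCRepresentation G (outputPoints n s)) (Runs.ite
    (fun hb => ?_) fun hb => ?_) fun s hs => Runs.nil hs
  · have hk : k = 0 := by
      rw [holds_eq, hs.1.reg8, hs.2.reg16] at hb
      exact hb
    subst hk
    refine (runs_of_wp (Q := fun t => t.rmem 0 0 = 0 ∧ t.rmem 1 0 = 0 ∧ t.rmem 0 1 = 2 ∧
      t.rmem 1 1 = 0) ?_).mono (T := 5) (by omega) fun t ht =>
        isUDCRepresentation_of_spine_empty hG v (eq_two_of_spine_empty hG v (by omega)) ht.1 ht.2.1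
          ht.2.2.1 ht.2.2.2
    simp [hs.1.reg7, hs.2.reg16, hs.2.rreg5, hs.2.rreg9]
  · have hk : 0 < k := by
      rw [holds_eq, hs.1.reg8, hs.2.reg16] at hb
      omega
    refine Runs.mono (T := k * (draw.cost + 8) + 1 + (2 +
      ((E.length * (leafBody.cost + 1) + 1) + 1))) ?_ (by omega) fun _ => id
    refine Runs.cons (runs_walk hw (Drawn (n + 1) v) ?_ (fun i hi s h hs =>
      runs_of_wp (wp_draw hw hi h hs)) hs.1 hs.2) fun s hs => ?_
    · intro i s t hr hx hm h
      exact ⟨h.toHasConstants.congr (fun r hr' _ => hr r (by omega)) fun r _ => by rw [hx],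
        ⟨by rw [hr _ (by norm_num), h.flag], by rw [hx, h.dir], by rw [hx, h.x], by rw [hx, h.y]⟩,
        ⟨by rw [hm]; exact h.spine_x, by rw [hm]; exact h.spine_y, by rw [hm]; exact h.slot_x,
          by rw [hm]; exact h.slot_y⟩⟩
    refine Runs.cons (R := fun s => s.reg 2 = 0 ∧ LeavesPlaced (n + 1) v E 0 s) (runs_of_wp ?_)
      fun s hs => ?_
    · obtain ⟨h, hp⟩ := hs
      simp only [wp_block_cons, wp_const, wp_block_nil]
      have hnone : ∀ f x, edgeSum f (E.take 0) x = 0 := fun f x => by simp [edgeSum]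
      exact ⟨by simp, ⟨⟨⟨by simp [h.reg0], by simp [h.reg1], by simp [h.reg7], by simp [h.reg10],
        h.mem0, h.mem1⟩, h.deg⟩, ⟨hp.spine_x, hp.spine_y, hp.slot_x, hp.slot_y⟩,
        fun x hx => by rw [hnone]; exact h.cnt x hx, fun _ => 0,
        ⟨fun c x _ _ _ hd => absurd (hnone _ x) hd, fun c x y _ _ _ _ _ hd => absurd (hnone _ x) hd,
        fun c x _ _ _ hd => absurd (hnone _ x) hd⟩⟩⟩
    · refine Runs.cons (runs_leaf_loop hG v hk hE hw hs.1 hs.2) fun s hs => Runs.nil ?_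
      exact hs.isUDCRepresentation hG hk hE ((isUDCGraph_iff_spineCondition hG.connected v).1 hU)

end RealRAM

/-! ### Realizability, decision and construction -/

theorem mainTheorem1 :
    -- realizability of a caterpillar is settled by the vertex degrees
    (∀ (V : Type*) [Fintype V] (G : SimpleGraph V) [DecidableRel G.Adj], IsCaterpillar G →
      (G.maxDegree ≤ 4 → IsUDCGraph G) ∧
      (6 ≤ G.maxDegree → ¬ IsUDCGraph G) ∧
      (G.maxDegree = 5 → ∀ (k : ℕ) (v : InnerPath G k),
        (IsUDCGraph G ↔
          ∀ i j : Fin k, i < j → G.degree (v i) = 5 → G.degree (v j) = 5 →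
            ∃ l : Fin k, i < l ∧ l < j ∧ G.degree (v l) ≤ 3))) ∧
    -- it is decided in linear time, without real arithmetic
    (∃ (P : RealRAM.Prog) (c : ℕ), P.IsDiscrete ∧
      ∀ (n : ℕ) (G : SimpleGraph (Fin n)) [DecidableRel G.Adj] (E : List (Fin n × Fin n)),
        IsCaterpillar G → RealRAM.IsEdgeList G E →
        ∃ (s : RealRAM.State) (t : ℕ), RealRAM.Exec (c * n) P (RealRAM.input E) s t ∧
          t ≤ c * n ∧
          (IsUDCGraph G → s.reg 0 = 1) ∧ (¬ IsUDCGraph G → s.reg 0 = 0)) ∧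
    -- a representation is constructed in linear time on a Real RAM
    (∃ (P : RealRAM.Prog) (c : ℕ),
      ∀ (n : ℕ) (G : SimpleGraph (Fin n)) [DecidableRel G.Adj] (E : List (Fin n × Fin n)),
        IsCaterpillar G → RealRAM.IsEdgeList G E → IsUDCGraph G →
        ∃ (s : RealRAM.State) (t : ℕ), RealRAM.Exec (c * n) P (RealRAM.input E) s t ∧
          t ≤ c * n ∧
          IsUDCRepresentation G (RealRAM.outputPoints n s)) := by
  refine ⟨fun V _ G _ hG => ⟨isUDCGraph_of_maxDegree_le_four hG,
    not_isUDCGraph_of_six_le_maxDegree hG,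
    fun h k v => isUDCGraph_iff_of_maxDegree_eq_five hG h v⟩, ⟨RealRAM.decision, 200,
    RealRAM.isDiscrete_decision, fun n G _ E hG hE => ?_⟩, ⟨RealRAM.construction, 500,
    fun n G _ E hG hE hU => ?_⟩⟩
  · obtain ⟨hT, k, ⟨v⟩⟩ := hG
    rw [isUDCGraph_iff_spineCondition hT.connected v]
    exact RealRAM.runs_decision hT v hE (by omega)
  · obtain ⟨hT, k, ⟨v⟩⟩ := hG
    exact RealRAM.runs_construction hT v hE hU (by omega)
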